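/- Let $n \ge 5$ and $k > n$ be integers and let $\frac n2 - 1 < s \le \frac n2 - 1 + \frac{1}{2(n-2)}$. For real-valued radial test functions $u,v \in C^\infty_{c,\mathrm{rad}}(\mathbb R^n)$ and $r > -\frac n2$ put $\langle u,v\rangle_{\dot H^r} = \langle |\cdot|^r \mathcal F u, |\cdot|^r \mathcal F v\rangle_{L^2(\mathbb R^n)}$, where $\mathcal F u(\xi) = (2\pi)^{-n/2}\int_{\mathbb R^n} u(x) e^{-i\xi\cdot x}\,dx$, and let $\mathcal H_{s,k}$ be the completion of $C^\infty_{c,\mathrm{rad}}(\mathbb R^n)\times C^\infty_{c,\mathrm{rad}}(\mathbb R^n)$ under the norm $$\|(u_1,u_2)\|^2 = \|u_1\|_{\dot H^s}^2 + \|u_1\|_{\dot H^k}^2 + \|u_2\|_{\dot H^{s-1}}^2 + \|u_2\|_{\dot H^{k-1}}^2 .$$ Every element of $\mathcal H_{s,k}$ is identified with a pair of functions on $\mathbb R^n$, namely the uniform limit of any sequence of pairs of test functions that converges to it in $\mathcal H_{s,k}$; this limit exists, is unique, and determines the element. Let $$\eta(y) = 2y - \sin(2y), \qquad \phi_0(\xi)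 = \frac{2}{|\xi|}\arctan\!\Big(\frac{|\xi|}{\sqrt{n-4}}\Big),$$ $$N(\xi,y) = \frac{n-3}{2|\xi|^3}\Big(\eta\big(|\xi|(\phi_0(\xi)+y)\big) - \eta\big(|\xi|\phi_0(\xi)\big) - \eta'\big(|\xi|\phi_0(\xi)\big)|\xi|\,y\Big) \qquad (\xi \ne 0),$$ extended continuously to $\xi = 0$, and $\mathbf N(u_1,u_2) = (0, N(\cdot,u_1))$. Then $\mathbf N$ maps $\mathcal H_{s,k}$ into itself, and for every $\delta > 0$ there is a constant $C > 0$ (depending on $n,s,k,\delta$) such that $$\|\mathbf N(\mathbf u) - \mathbf N(\mathbf v)\| \le C\,(\|\mathbf u\| + \|\mathbf v\|)\,\|\mathbf u - \mathbf v\|$$ for all $\mathbf u,\mathbf v \in \mathcal H_{s,k}$ with $\|\mathbf u\|\le\delta$ and $\|\mathbf v\|\le\delta$. -/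

import Mathlib

open MeasureTheory Filter Topology
open scoped ContDiff FourierTransform SchwartzMap

noncomputable section

namespace WaveMap

/-- The Euclidean space `ℝⁿ`. -/
abbrev Sp (n : ℕ) : Type := EuclideanSpace ℝ (Fin n)

/-- The Fourier transform `(2π)^(-n/2) ∫ u(x) e^(-i ξ·x) dx` of a real-valued function `u`
(Mathlib's `𝓕` has the kernel `e^(-2πi ξ·x)`, hence the rescaling of `ξ`). -/
def FT {n : ℕ} (u : Sp n → ℝ) (ξ : Sp n) : ℂ :=
  (((2 * Real.pi) ^ (-(n : ℝ) / 2) : ℝ) : ℂ) *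
    𝓕 (fun x : Sp n => (u x : ℂ)) ((2 * Real.pi)⁻¹ • ξ)

/-- The defining formula of the Fourier transform. -/
theorem FT_eq_integral {n : ℕ} (u : Sp n → ℝ) (ξ : Sp n) :
    FT u ξ = (((2 * Real.pi) ^ (-(n : ℝ) / 2) : ℝ) : ℂ) *
      ∫ x, (u x : ℂ) * Complex.exp (-Complex.I * ((inner ℝ ξ x : ℝ) : ℂ)) := by
  unfold FT
  rw [Real.fourier_eq']
  congr 1
  apply integral_congr_ae
  filter_upwards with x
  rw [smul_eq_mul, mul_comm, inner_smul_right, real_inner_comm]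
  congr 2
  push_cast
  have : (Real.pi : ℂ) ≠ 0 := by exact_mod_cast Real.pi_ne_zero
  field_simp

/-- The real vector space of real-valued radial test functions, `C_c^∞` and depending only
on `|x|`. -/
def radialTest (n : ℕ) : Submodule ℝ (Sp n → ℝ) where
  carrier := {f | ContDiff ℝ ∞ f ∧ HasCompactSupport f ∧ ∀ x y, ‖x‖ = ‖y‖ → f x = f y}
  add_mem' := by
    rintro f g ⟨hf1, hf2, hf3⟩ ⟨hg1, hg2, hg3⟩
    refine ⟨hf1.add hg1, hf2.add hg2, fun x y h => ?_⟩
    simp [hf3 x y h, hg3 x y h]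
  zero_mem' := ⟨contDiff_const, HasCompactSupport.zero, fun _ _ _ => rfl⟩
  smul_mem' := by
    rintro c f ⟨hf1, hf2, hf3⟩
    refine ⟨contDiff_const.smul hf1, hf2.smul_left, fun x y h => ?_⟩
    simp [hf3 x y h]

/-- The (real) inner product of the homogeneous Sobolev space `Ḣ^s(ℝⁿ)`,
`⟨|·|^s 𝓕u, |·|^s 𝓕v⟩_{L²}`. -/
def sobInner {n : ℕ} (s : ℝ) (u v : Sp n → ℝ) : ℝ :=
  ∫ ξ : Sp n, ‖ξ‖ ^ (2 * s) * (FT u ξ * (starRingEnd ℂ) (FT v ξ)).re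

/-- A Schwartz function whose Fourier transform is `𝓕 f`. -/
theorem exists_schwartz {n : ℕ} (f : radialTest n) :
    ∃ φ : 𝓢(Sp n, ℂ), ∀ ξ, φ ξ = 𝓕 (fun x : Sp n => ((f : Sp n → ℝ) x : ℂ)) ξ := by
  obtain ⟨f, hf1, hf2, -⟩ := f
  have h2 : HasCompactSupport (fun x : Sp n => (f x : ℂ)) :=
    hf2.comp_left (g := fun t : ℝ => (t : ℂ)) (by simp)
  have h1 : ContDiff ℝ ∞ (fun x : Sp n => (f x : ℂ)) :=
    Complex.ofRealCLM.contDiff.comp hf1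
  exact ⟨𝓕 (h2.toSchwartzMap h1), fun ξ => rfl⟩

theorem integrable_radialTest {n : ℕ} (f : radialTest n) :
    Integrable (fun x : Sp n => ((f : Sp n → ℝ) x : ℂ)) := by
  obtain ⟨f, hf1, hf2, -⟩ := f
  have h2 : HasCompactSupport (fun x : Sp n => (f x : ℂ)) :=
    hf2.comp_left (g := fun t : ℝ => (t : ℂ)) (by simp)
  exact (Complex.continuous_ofReal.comp hf1.continuous).integrable_of_hasCompactSupport h2

/-- The weight `|ξ|^r`, `r > -n`, is integrable against Schwartz functions. -/
theorem integrable_weight {n : ℕ} {r : ℝ} (hr : -(n : ℝ) < r) (φ : 𝓢(Sp n, ℂ)) :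
    Integrable (fun ξ : Sp n => ‖ξ‖ ^ r * ‖φ ξ‖) := by
  have hmeas : AEStronglyMeasurable (fun ξ : Sp n => ‖ξ‖ ^ r * ‖φ ξ‖) volume := by
    have : Measurable (fun ξ : Sp n => ‖ξ‖ ^ r) := measurable_norm.pow_const r
    exact this.aestronglyMeasurable.mul φ.continuous.norm.aestronglyMeasurable
  have hnn : ∀ ξ : Sp n, 0 ≤ ‖ξ‖ ^ r := fun ξ => Real.rpow_nonneg (norm_nonneg _) _
  have hball : IntegrableOn (fun ξ : Sp n => ‖ξ‖ ^ r * ‖φ ξ‖) (Metric.ball 0 1) := by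
    obtain ⟨C, hC⟩ : ∃ C, ∀ ξ, ‖φ ξ‖ ≤ C := by
      obtain ⟨C, -, hC⟩ := φ.decay 0 0
      exact ⟨C, fun ξ => by simpa using hC ξ⟩
    rcases Nat.eq_zero_or_pos n with rfl | hn
    · have : Integrable (fun ξ : Sp 0 => ‖ξ‖ ^ r * ‖φ ξ‖) := by
        refine Integrable.of_bound hmeas ((0 : ℝ) ^ r * C) ?_
        filter_upwards with ξ
        have : ξ = 0 := Subsingleton.elim _ _
        rw [Real.norm_of_nonneg (mul_nonneg (hnn ξ) (norm_nonneg _)), this, norm_zero]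
        exact mul_le_mul_of_nonneg_left (hC 0) (Real.rpow_nonneg le_rfl _)
      exact this.integrableOn
    · refine integrableOn_ball_of_norm_le_rpow (C := C) (α := -r) ?_ ?_ ?_ hmeas
      · rw [finrank_euclideanSpace, Fintype.card_fin]
        exact hn
      · simp only [finrank_euclideanSpace, Fintype.card_fin]
        linarith
      · filter_upwards with ξ
        rw [Real.norm_of_nonneg (mul_nonneg (hnn ξ) (norm_nonneg _)), neg_neg, mul_comm]
        exact mul_le_mul_of_nonneg_right (hC ξ) (hnn ξ)
  have hcompl : IntegrableOn (fun ξ : Sp n => ‖ξ‖ ^ r * ‖φ ξ‖) (Metric.ball 0 1)ᶜ := by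
    obtain ⟨m, hm⟩ := exists_nat_ge r
    refine Integrable.mono' (φ.integrable_pow_mul volume m).integrableOn hmeas.restrict ?_
    filter_upwards [ae_restrict_mem Metric.isOpen_ball.measurableSet.compl] with ξ hξ
    have h1 : 1 ≤ ‖ξ‖ := by simpa using hξ
    rw [Real.norm_of_nonneg (mul_nonneg (hnn ξ) (norm_nonneg _)), ← Real.rpow_natCast]
    exact mul_le_mul_of_nonneg_right (Real.rpow_le_rpow_of_exponent_le h1 hm) (norm_nonneg _)
  have := hball.union hcompl
  rwa [Set.union_compl_self, integrableOn_univ] at this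

/-- For `s > -n/2` the integral that defines the inner product converges on test functions. -/
theorem integrable_sobInner {n : ℕ} {s : ℝ} (hs : -(n : ℝ) / 2 < s) (f g : radialTest n) :
    Integrable (fun ξ : Sp n => ‖ξ‖ ^ (2 * s) *
      (FT (f : Sp n → ℝ) ξ * (starRingEnd ℂ) (FT (g : Sp n → ℝ) ξ)).re) := by
  obtain ⟨φ, hφ⟩ := exists_schwartz f
  obtain ⟨ψ, hψ⟩ := exists_schwartz g
  obtain ⟨C, hC⟩ : ∃ C, ∀ ξ, ‖ψ ξ‖ ≤ C := by
    obtain ⟨C, -, hC⟩ := ψ.decay 0 0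
    exact ⟨C, fun ξ => by simpa using hC ξ⟩
  set c : ℝ := (2 * Real.pi) ^ (-(n : ℝ) / 2) with hc
  have hpi : (0 : ℝ) < 2 * Real.pi := by positivity
  have hc0 : 0 ≤ c := by positivity
  have h := ((integrable_weight (r := 2 * s) (by linarith) φ).comp_smul
    (R := (2 * Real.pi)⁻¹) (by positivity)).const_mul (c * c * C * (2 * Real.pi) ^ (2 * s))
  refine h.mono' ?_ ?_
  · have h1 : Measurable (fun ξ : Sp n => ‖ξ‖ ^ (2 * s)) := measurable_norm.pow_const _
    have h2 : Continuous (fun ξ : Sp n =>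
        (FT (f : Sp n → ℝ) ξ * (starRingEnd ℂ) (FT (g : Sp n → ℝ) ξ)).re) := by
      simp only [FT, ← hφ, ← hψ]
      fun_prop
    exact h1.aestronglyMeasurable.mul h2.aestronglyMeasurable
  · filter_upwards with ξ
    simp only [FT, ← hφ, ← hψ]
    have hw : 0 ≤ ‖ξ‖ ^ (2 * s) := Real.rpow_nonneg (norm_nonneg _) _
    have hw' : (2 * Real.pi) ^ (2 * s) * ‖(2 * Real.pi)⁻¹ • ξ‖ ^ (2 * s) = ‖ξ‖ ^ (2 * s) := by
      rw [norm_smul, Real.norm_of_nonneg (by positivity),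
        ← Real.mul_rpow hpi.le (by positivity), ← mul_assoc, mul_inv_cancel₀ hpi.ne', one_mul]
    rw [norm_mul, Real.norm_of_nonneg hw]
    calc _ ≤ ‖ξ‖ ^ (2 * s) * (c * ‖φ ((2 * Real.pi)⁻¹ • ξ)‖ * (c * C)) := by
          refine mul_le_mul_of_nonneg_left ?_ hw
          refine (Complex.abs_re_le_norm _).trans ?_
          rw [norm_mul, RCLike.norm_conj, norm_mul, norm_mul, Complex.norm_real,
            Real.norm_of_nonneg hc0]
          have := hC ((2 * Real.pi)⁻¹ • ξ)
          gcongr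
      _ = _ := by rw [← hw']; ring

theorem FT_add {n : ℕ} (f g : radialTest n) (ξ : Sp n) :
    FT ((f + g : radialTest n) : Sp n → ℝ) ξ
      = FT (f : Sp n → ℝ) ξ + FT (g : Sp n → ℝ) ξ := by
  simp only [FT, ← mul_add]
  congr 1
  simp only [Real.fourier_eq]
  rw [← integral_add]
  · simp [smul_add]
  · exact (Real.fourierIntegral_convergent_iff _).2 (integrable_radialTest f)
  · exact (Real.fourierIntegral_convergent_iff _).2 (integrable_radialTest g)

theorem FT_smul {n : ℕ} (c : ℝ) (f : radialTest n) (ξ : Sp n) :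
    FT ((c • f : radialTest n) : Sp n → ℝ) ξ = (c : ℂ) * FT (f : Sp n → ℝ) ξ := by
  simp only [FT, Real.fourier_eq]
  rw [mul_left_comm]
  congr 1
  rw [← integral_const_mul]
  apply integral_congr_ae
  filter_upwards with x
  simp only [Submodule.coe_smul, Pi.smul_apply, smul_eq_mul, Complex.ofReal_mul]
  rw [mul_smul_comm]

theorem sobInner_comm {n : ℕ} (s : ℝ) (u v : Sp n → ℝ) : sobInner s v u = sobInner s u v := by
  unfold sobInner
  congr 1
  ext ξ
  rw [← Complex.conj_re, map_mul, Complex.conj_conj, mul_comm (FT u ξ)]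

theorem sobInner_self_nonneg {n : ℕ} (s : ℝ) (u : Sp n → ℝ) : 0 ≤ sobInner s u u := by
  refine integral_nonneg fun ξ => mul_nonneg (Real.rpow_nonneg (norm_nonneg _) _) ?_
  rw [Complex.mul_conj, Complex.ofReal_re]
  exact Complex.normSq_nonneg _

theorem sobInner_add_left {n : ℕ} {s : ℝ} (hs : -(n : ℝ) / 2 < s) (f g h : radialTest n) :
    sobInner s ((f + g : radialTest n) : Sp n → ℝ) h
      = sobInner s (f : Sp n → ℝ) h + sobInner s (g : Sp n → ℝ) h := by
  unfold sobInner
  rw [← integral_add (integrable_sobInner hs f h) (integrable_sobInner hs g h)]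
  congr 1
  ext ξ
  rw [FT_add, add_mul, Complex.add_re, mul_add]

theorem sobInner_smul_left {n : ℕ} (s c : ℝ) (f h : radialTest n) :
    sobInner s ((c • f : radialTest n) : Sp n → ℝ) h = c * sobInner s (f : Sp n → ℝ) h := by
  unfold sobInner
  rw [← integral_const_mul]
  congr 1
  ext ξ
  rw [FT_smul, mul_assoc, Complex.re_ofReal_mul]
  ring

/-- Pairs of radial test functions. The type carries the exponents `s₁, s₂ > -n/2 + 1`, since its
norm depends on them. -/
def TestPair (n : ℕ) (s₁ s₂ : ℝ) (_ : -(n : ℝ) / 2 + 1 < s₁) (_ : -(n : ℝ) / 2 + 1 < s₂) : Type :=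
  radialTest n × radialTest n

section
variable {n : ℕ} {s₁ s₂ : ℝ} {h₁ : -(n : ℝ) / 2 + 1 < s₁} {h₂ : -(n : ℝ) / 2 + 1 < s₂}

instance instAddCommGroupPair : AddCommGroup (TestPair n s₁ s₂ h₁ h₂) :=
  inferInstanceAs (AddCommGroup (radialTest n × radialTest n))

instance instModulePair : Module ℝ (TestPair n s₁ s₂ h₁ h₂) :=
  inferInstanceAs (Module ℝ (radialTest n × radialTest n))

/-- First component of a pair of test functions. -/
def TestPair.fst (u : TestPair n s₁ s₂ h₁ h₂) : Sp n → ℝ := (Prod.fst u : radialTest n)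

/-- Second component of a pair of test functions. -/
def TestPair.snd (u : TestPair n s₁ s₂ h₁ h₂) : Sp n → ℝ := (Prod.snd u : radialTest n)

/-- The inner product of `(Ḣ^{s₁} ∩ Ḣ^{s₂}) × (Ḣ^{s₁-1} ∩ Ḣ^{s₂-1})` on pairs of test functions. -/
@[reducible] def pairCore (n : ℕ) (s₁ s₂ : ℝ) (h₁ : -(n : ℝ) / 2 + 1 < s₁) (h₂ : -(n : ℝ) / 2 + 1 < s₂) :
    PreInnerProductSpace.Core ℝ (TestPair n s₁ s₂ h₁ h₂) where
  inner u v := (sobInner s₁ u.fst v.fst + sobInner s₂ u.fst v.fst) +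
    (sobInner (s₁ - 1) u.snd v.snd + sobInner (s₂ - 1) u.snd v.snd)
  conj_inner_symm u v := by
    simp only [conj_trivial]
    rw [sobInner_comm s₁, sobInner_comm s₂, sobInner_comm (s₁ - 1), sobInner_comm (s₂ - 1)]
  re_inner_nonneg u := by
    simp only [RCLike.re_to_real]
    have := sobInner_self_nonneg s₁ u.fst
    have := sobInner_self_nonneg s₂ u.fst
    have := sobInner_self_nonneg (s₁ - 1) u.snd
    have := sobInner_self_nonneg (s₂ - 1) u.snd
    positivity
  add_left u v w := by
    have e1 := sobInner_add_left (s := s₁) (by linarith) u.1 v.1 w.1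
    have e2 := sobInner_add_left (s := s₂) (by linarith) u.1 v.1 w.1
    have e3 := sobInner_add_left (s := s₁ - 1) (by linarith) u.2 v.2 w.2
    have e4 := sobInner_add_left (s := s₂ - 1) (by linarith) u.2 v.2 w.2
    calc _ = _ := congrArg₂ (· + ·) (congrArg₂ (· + ·) e1 e2) (congrArg₂ (· + ·) e3 e4)
      _ = _ := by simp only [TestPair.fst, TestPair.snd]; ring
  smul_left u v c := by
    have e1 := sobInner_smul_left s₁ c u.1 v.1
    have e2 := sobInner_smul_left s₂ c u.1 v.1
    have e3 := sobInner_smul_left (s₁ - 1) c u.2 v.2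
    have e4 := sobInner_smul_left (s₂ - 1) c u.2 v.2
    calc _ = _ := congrArg₂ (· + ·) (congrArg₂ (· + ·) e1 e2) (congrArg₂ (· + ·) e3 e4)
      _ = _ := by simp only [TestPair.fst, TestPair.snd, conj_trivial]; ring

instance instSeminormedPair : SeminormedAddCommGroup (TestPair n s₁ s₂ h₁ h₂) :=
  @InnerProductSpace.Core.toSeminormedAddCommGroup ℝ _ _ _ _ (pairCore n s₁ s₂ h₁ h₂)

instance instInnerPair : InnerProductSpace ℝ (TestPair n s₁ s₂ h₁ h₂) :=
  InnerProductSpace.ofCore (pairCore n s₁ s₂ h₁ h₂)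

/-- The norm of a pair of test functions. -/
theorem TestPair.norm_sq (u : TestPair n s₁ s₂ h₁ h₂) :
    ‖u‖ ^ 2 = (sobInner s₁ u.fst u.fst + sobInner s₂ u.fst u.fst) +
      (sobInner (s₁ - 1) u.snd u.snd + sobInner (s₂ - 1) u.snd u.snd) := by
  rw [← real_inner_self_eq_norm_sq]
  rfl

end

/-- The space `𝓗_{s₁,s₂}` (its real subspace): the completion of the pairs of real-valued radial
test functions. -/
abbrev HSpace (n : ℕ) (s₁ s₂ : ℝ) (h₁ : -(n : ℝ) / 2 + 1 < s₁) (h₂ : -(n : ℝ) / 2 + 1 < s₂) :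
    Type :=
  UniformSpace.Completion (TestPair n s₁ s₂ h₁ h₂)

/-- The element `U` of the completion is the pair of functions `(u₁, u₂)`: some sequence of pairs
of test functions tends to `U` in `𝓗_{s₁,s₂}` and to `(u₁, u₂)` uniformly on `ℝⁿ`. -/
def Represents {n : ℕ} {s₁ s₂ : ℝ} {h₁ : -(n : ℝ) / 2 + 1 < s₁} {h₂ : -(n : ℝ) / 2 + 1 < s₂}
    (U : HSpace n s₁ s₂ h₁ h₂) (u : (Sp n → ℝ) × (Sp n → ℝ)) : Prop :=
  ∃ φ : ℕ → TestPair n s₁ s₂ h₁ h₂,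
    Tendsto (fun j => (φ j : HSpace n s₁ s₂ h₁ h₂)) atTop (𝓝 U) ∧
    TendstoUniformly (fun j => (φ j).fst) u.1 atTop ∧
    TendstoUniformly (fun j => (φ j).snd) u.2 atTop

/-- `η(y) = 2y - sin(2y)`. -/
def eta (y : ℝ) : ℝ := 2 * y - Real.sin (2 * y)

/-- The radial profile `ϕ(ρ) = (2/ρ) arctan(ρ/√(n-4))` (`ρ > 0`). -/
def profile (n : ℕ) (ρ : ℝ) : ℝ := 2 / ρ * Real.arctan (ρ / √((n : ℝ) - 4))

/-- The static solution `ϕ₀ = ϕ(|·|)`. -/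
def phi0 (n : ℕ) (ξ : Sp n) : ℝ := profile n ‖ξ‖

/-- The nonlinearity `N(ξ, y)`, for `ξ ≠ 0`. -/
def nonlin (n : ℕ) (ξ : Sp n) (y : ℝ) : ℝ :=
  ((n : ℝ) - 3) / (2 * ‖ξ‖ ^ 3) *
    (eta (‖ξ‖ * (phi0 n ξ + y)) - eta (‖ξ‖ * phi0 n ξ) - deriv eta (‖ξ‖ * phi0 n ξ) * (‖ξ‖ * y))

/-- The pair of functions `w` is `𝐍(u) = (0, N(·, u₁))`. The formula for `N` has a removable
singularity at the origin, so it is imposed at the points `ξ ≠ 0` only. -/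
def IsNonlin {n : ℕ} (u w : (Sp n → ℝ) × (Sp n → ℝ)) : Prop :=
  w.1 = 0 ∧ ∀ ξ : Sp n, ξ ≠ 0 → w.2 ξ = nonlin n ξ (u.1 ξ)

/-- The lower bound on `s` implied by `n/2 - 1 < s`. -/
theorem exponent_s {n : ℕ} {s : ℝ} (hn : 5 ≤ n) (hs : (n : ℝ) / 2 - 1 < s) :
    -(n : ℝ) / 2 + 1 < s := by
  have : (5 : ℝ) ≤ n := by exact_mod_cast hn
  linarith

/-- The lower bound on `k` implied by `n < k`. -/
theorem exponent_k {n k : ℕ} (hn : 5 ≤ n) (hk : n < k) : -(n : ℝ) / 2 + 1 < (k : ℝ) := by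
  have h5 : (5 : ℝ) ≤ n := by exact_mod_cast hn
  have : (n : ℝ) < k := by exact_mod_cast hk
  linarith

end WaveMap

end

/-! The singularity of N at the origin is only apparent. With ρ = |ξ| and a = √(n-4) one has ρ φ₀ =
2 arctan(ρ/a), and the addition formula turns N into (n-3) times the sum of (sin(4 arctan(ρ/a))/ρ)
(sin(ρy)/ρ)² and cos(4 arctan(ρ/a)) (2ρy - sin 2ρy)/(2ρ³). The coefficients are rational in ρ² and
the kernels are entire in ρ² and y (`nonlin_eq_nonlinExt`), so N acts on radial test functions.
Product formulas for sines express N(u) - N(v) through kernels evaluated at u - v, u + v and (u +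
v)/2 (`nonlinExt_sub`); every term has a factor in u - v and is at least quadratic in total.

Let m = ⌊(n-4)/2⌋. Since m ≤ s-1 ≤ k-1, the norm of the image is controlled by its homogeneous
Sobolev norms of the integer orders m and k-1, hence by the L² norms of pure derivatives in the
coordinate directions. Everything therefore reduces to calculus in one variable along the lines t ↦
x + te.

The input is the decay of radial functions. The Fourier transform of the unit sphere solves a Bessel
equation and decays, with all derivatives, like |x|^(-(n-1)/2); a radial function is a superposition
of its dilates, and Cauchy-Schwarz in frequency gives `exists_dirD_decay`. With l = max(1,|x|), δ =
1 - 1/n and W = l^δ, this yields |u| ≲ 1/W, and |∂^j u| ≲ l⁻¹ W^(-min(j,⌊(n-3)/2⌋)) for 1 ≤ j ≤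
(k-1)/2. Derivatives of higher order, up to k-1, are only known in L². In a Leibniz expansion of
order at most k-1 at most one factor has such a high order, so the derivatives of N(u) - N(v) are
bounded by l⁻¹ W⁻² W⁻ᵐ plus a term linear in the high derivatives (`exists_dirD_nonlin_le`). The
first function is square integrable precisely because δ is close to 1, while s + δ < n/2 keeps the
decay of u available. Squaring and integrating gives the Lipschitz bound on test functions.

For the completion: the norm dominates the supremum norm, so elements are pairs of functions. They
are determined by them because a Cauchy sequence that tends to zero uniformly tends to zero in norm
(`tendsto_interNorm_zero`). A map that is Lipschitz on bounded sets extends along sequences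
(`exists_extension`), and the extension is still N because uniform limits can be inserted into a
function that is continuous in y. -/

namespace WaveMap

/-! ### Leibniz and chain rule for weighted derivative bounds at a point -/

/-- A weight sequence compatible with the Leibniz rule up to order `N`. -/
structure JetWeight (N : ℕ) (w : ℕ → ℝ) : Prop where
  nonneg : ∀ j, 0 ≤ w j
  zero : w 0 = 1
  mul_le : ∀ i l, i + l ≤ N → w i * w l ≤ w (i + l)

theorem JetWeight.of_le {N M : ℕ} {w : ℕ → ℝ} (h : JetWeight N w) (hM : M ≤ N) :
    JetWeight M w :=
  ⟨h.nonneg, h.zero, fun i l hil => h.mul_le i l (hil.trans hM)⟩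

/-- The derivatives of `f` at `0` up to order `N` are bounded by `A` times the weights `w`. -/
def JetLE (N : ℕ) (w : ℕ → ℝ) (A : ℝ) (f : ℝ → ℝ) : Prop :=
  ContDiffAt ℝ ∞ f 0 ∧ ∀ j ≤ N, |iteratedDeriv j f 0| ≤ A * w j

theorem ContDiffAt.of_infty {f : ℝ → ℝ} {t : ℝ} (h : ContDiffAt ℝ ∞ f t) (j : ℕ) :
    ContDiffAt ℝ j f t :=
  h.of_le (by exact_mod_cast le_top)

theorem abs_iteratedDeriv_mul_le {f g : ℝ → ℝ} {t X : ℝ} {j : ℕ}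
    (hf : ContDiffAt ℝ ∞ f t) (hg : ContDiffAt ℝ ∞ g t)
    (h : ∀ i ≤ j, |iteratedDeriv i f t| * |iteratedDeriv (j - i) g t| ≤ X) :
    |iteratedDeriv j (fun s => f s * g s) t| ≤ 2 ^ j * X := by
  have := iteratedDeriv_fun_mul (ContDiffAt.of_infty hf j) (ContDiffAt.of_infty hg j)
  rw [this]
  refine (Finset.abs_sum_le_sum_abs _ _).trans ?_
  have h2 : (2 : ℝ) ^ j * X = ∑ i ∈ Finset.range (j + 1), (j.choose i : ℝ) * X := by
    rw [← Finset.sum_mul]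
    congr 1
    exact_mod_cast (Nat.sum_range_choose j).symm
  rw [h2]
  refine Finset.sum_le_sum fun i hi => ?_
  have hi' : i ≤ j := Nat.lt_succ_iff.1 (Finset.mem_range.1 hi)
  rw [abs_mul, abs_mul, Nat.abs_cast, mul_assoc]
  exact mul_le_mul_of_nonneg_left (h i hi') (Nat.cast_nonneg _)

theorem JetLE.coeff_nonneg {N : ℕ} {w : ℕ → ℝ} {A : ℝ} {f : ℝ → ℝ} (hw : JetWeight N w)
    (h : JetLE N w A f) : 0 ≤ A := by
  have := h.2 0 (Nat.zero_le _)
  rw [hw.zero, mul_one] at this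
  exact (abs_nonneg _).trans this

theorem JetLE.mono {N : ℕ} {w : ℕ → ℝ} {A B : ℝ} {f : ℝ → ℝ} (hw : JetWeight N w)
    (h : JetLE N w A f) (hAB : A ≤ B) : JetLE N w B f :=
  ⟨h.1, fun j hj => (h.2 j hj).trans (mul_le_mul_of_nonneg_right hAB (hw.nonneg j))⟩

theorem JetLE.mono_weight {N : ℕ} {w w' : ℕ → ℝ} {A : ℝ} {f : ℝ → ℝ} (hA : 0 ≤ A)
    (h : JetLE N w A f) (hww : ∀ j ≤ N, w j ≤ w' j) : JetLE N w' A f :=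
  ⟨h.1, fun j hj => (h.2 j hj).trans (mul_le_mul_of_nonneg_left (hww j hj) hA)⟩

theorem JetLE.congr {N : ℕ} {w : ℕ → ℝ} {A : ℝ} {f g : ℝ → ℝ}
    (h : JetLE N w A f) (hfg : g =ᶠ[𝓝 0] f) : JetLE N w A g :=
  ⟨h.1.congr_of_eventuallyEq hfg, fun j hj => by rw [hfg.iteratedDeriv_eq]; exact h.2 j hj⟩

/-- In the Leibniz sum `mul_le` collects each product `w i * w (j - i)` into `w j`, and the binomial
coefficients add up to 2 ^ j. -/
theorem JetLE.mul {N : ℕ} {w : ℕ → ℝ} {A B : ℝ} {f g : ℝ → ℝ} (hw : JetWeight N w)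
    (hf : JetLE N w A f) (hg : JetLE N w B g) :
    JetLE N w (2 ^ N * (A * B)) (fun t => f t * g t) := by
  have hA := hf.coeff_nonneg hw
  have hB := hg.coeff_nonneg hw
  refine ⟨hf.1.mul hg.1, fun j hj => ?_⟩
  have key : |iteratedDeriv j (fun s => f s * g s) 0| ≤ 2 ^ j * (A * B * w j) := by
    refine abs_iteratedDeriv_mul_le hf.1 hg.1 fun i hi => ?_
    calc _ ≤ (A * w i) * (B * w (j - i)) :=
          mul_le_mul (hf.2 i (hi.trans hj)) (hg.2 (j - i) ((Nat.sub_le _ _).trans hj))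
            (abs_nonneg _) (mul_nonneg hA (hw.nonneg _))
      _ = A * B * (w i * w (j - i)) := by ring
      _ ≤ A * B * w (i + (j - i)) :=
          mul_le_mul_of_nonneg_left (hw.mul_le _ _ (by omega)) (mul_nonneg hA hB)
      _ = _ := by rw [Nat.add_sub_cancel' hi]
  refine key.trans ?_
  rw [mul_assoc (2 ^ N)]
  exact mul_le_mul_of_nonneg_right (pow_le_pow_right₀ one_le_two hj)
    (mul_nonneg (mul_nonneg hA hB) (hw.nonneg _))

theorem JetLE.add {N : ℕ} {w : ℕ → ℝ} {A B : ℝ} {f g : ℝ → ℝ}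
    (hf : JetLE N w A f) (hg : JetLE N w B g) : JetLE N w (A + B) (fun t => f t + g t) := by
  refine ⟨hf.1.add hg.1, fun j hj => ?_⟩
  rw [iteratedDeriv_fun_add (ContDiffAt.of_infty hf.1 j) (ContDiffAt.of_infty hg.1 j), add_mul]
  exact (abs_add_le _ _).trans (add_le_add (hf.2 j hj) (hg.2 j hj))

theorem JetLE.const {N : ℕ} {w : ℕ → ℝ} (hw : JetWeight N w) (c : ℝ) :
    JetLE N w |c| (fun _ => c) := by
  refine ⟨contDiffAt_const, fun j _ => ?_⟩
  rw [iteratedDeriv_const]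
  split_ifs with h
  · rw [h, hw.zero, mul_one]
  · simpa using mul_nonneg (abs_nonneg c) (hw.nonneg j)

theorem JetLE.const_mul {N : ℕ} {w : ℕ → ℝ} {A : ℝ} {f : ℝ → ℝ} (hf : JetLE N w A f) (c : ℝ) :
    JetLE N w (|c| * A) (fun t => c * f t) := by
  refine ⟨contDiffAt_const.mul hf.1, fun j hj => ?_⟩
  rw [iteratedDeriv_const_mul c (ContDiffAt.of_infty hf.1 j), abs_mul, mul_assoc]
  exact mul_le_mul_of_nonneg_left (hf.2 j hj) (abs_nonneg _)

theorem ContDiffAt.deriv_infty {f : ℝ → ℝ} {t : ℝ} (h : ContDiffAt ℝ ∞ f t) :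
    ContDiffAt ℝ ∞ (deriv f) t := by
  have h1 : ContDiffAt ℝ ∞ (fderiv ℝ f) t := h.fderiv_right (by simp)
  have h2 : ContDiffAt ℝ ∞ (fun s => fderiv ℝ f s 1) t := h1.clm_apply contDiffAt_const
  exact h2

theorem ContDiffAt.eventually_differentiableAt {f : ℝ → ℝ} {t : ℝ} (h : ContDiffAt ℝ ∞ f t) :
    ∀ᶠ s in 𝓝 t, DifferentiableAt ℝ f s := by
  have h1 : ContDiffAt ℝ 1 f t := h.of_le (by exact_mod_cast le_top)
  filter_upwards [h1.eventually (by simp)] with s hs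
  exact hs.differentiableAt (by simp)

/-- Chain rule estimate: the derivatives of `F ∘ g` of positive order are controlled linearly by
those of `g`. -/
theorem exists_jet_comp_bound (N : ℕ) (B : ℝ) (hB : 0 ≤ B) :
    ∃ C : ℝ, 0 ≤ C ∧ ∀ (F g : ℝ → ℝ) (w : ℕ → ℝ) (A b : ℝ), JetWeight N w → ContDiff ℝ ∞ F →
      ContDiffAt ℝ ∞ g 0 → 0 ≤ b → b ≤ B →
      (∀ i ≤ N, |iteratedDeriv i F (g 0)| ≤ A) →
      (∀ j, 1 ≤ j → j ≤ N → |iteratedDeriv j g 0| ≤ b * w j) →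
      ∀ j, 1 ≤ j → j ≤ N → |iteratedDeriv j (fun t => F (g t)) 0| ≤ C * (A * b) * w j := by
  -- Induction on the order through (F ∘ g)' = (F' ∘ g) g'. The factor g' supplies the linear
  -- dependence on `b`; further powers of `b` are absorbed by `B`. The value `g 0` is not required
  -- to be small or bounded, which matters for g = |x| y.
  induction N with
  | zero => exact ⟨0, le_rfl, fun _ _ _ _ _ _ _ _ _ _ _ _ j h1 h2 => by omega⟩
  | succ N ih =>
    obtain ⟨C, hC0, hC⟩ := ih
    refine ⟨2 ^ N * (1 + C * B), by positivity, ?_⟩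
    intro F g w A b hw hF hg hb hbB hFA hgb j hj1 hj
    obtain ⟨j, rfl⟩ : ∃ l, j = l + 1 := ⟨j - 1, by omega⟩
    have hA : 0 ≤ A := (abs_nonneg _).trans (hFA 0 (Nat.zero_le _))
    have hF' : ContDiff ℝ ∞ (deriv F) := (contDiff_infty_iff_deriv.1 hF).2
    have hcomp : ContDiffAt ℝ ∞ (fun t => deriv F (g t)) 0 := hF'.contDiffAt.comp 0 hg
    have heq : deriv (fun t => F (g t)) =ᶠ[𝓝 0] fun t => deriv F (g t) * deriv g t := by
      filter_upwards [ContDiffAt.eventually_differentiableAt hg] with s hs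
      exact ((hF.differentiable (by simp) (g s)).hasDerivAt.comp s hs.hasDerivAt).deriv
    -- The value of F' ∘ g is at most `A`; its positive orders are at most C A b ≤ C A B by
    -- induction. Hence the factor 1 + C B.
    have hjet : ∀ i ≤ N, |iteratedDeriv i (fun t => deriv F (g t)) 0| ≤ (1 + C * B) * A * w i := by
      intro i hi
      rcases Nat.eq_zero_or_pos i with rfl | hi0
      · rw [hw.zero, mul_one, iteratedDeriv_zero]
        have := hFA 1 (by omega)
        rw [iteratedDeriv_one] at this
        exact this.trans (le_mul_of_one_le_left hA (by nlinarith))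
      · refine (hC (deriv F) g w A b (hw.of_le (Nat.le_succ _)) hF' hg hb hbB ?_ ?_ i hi0 hi).trans ?_
        · intro l hl
          have := hFA (l + 1) (by omega)
          rwa [iteratedDeriv_succ'] at this
        · exact fun l h1 h2 => hgb l h1 (by omega)
        · refine mul_le_mul_of_nonneg_right ?_ (hw.nonneg _)
          have : C * (A * b) ≤ C * (A * B) := by gcongr
          nlinarith
    rw [iteratedDeriv_succ', heq.iteratedDeriv_eq]
    have key : |iteratedDeriv j (fun s => deriv F (g s) * deriv g s) 0| ≤
        2 ^ j * ((1 + C * B) * A * b * w (j + 1)) := by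
      refine abs_iteratedDeriv_mul_le hcomp (ContDiffAt.deriv_infty hg) fun i hi => ?_
      rw [← iteratedDeriv_succ']
      calc _ ≤ ((1 + C * B) * A * w i) * (b * w (j - i + 1)) :=
            mul_le_mul (hjet i (by omega)) (hgb _ (by omega) (by omega)) (abs_nonneg _)
              (mul_nonneg (by positivity) (hw.nonneg _))
        _ = (1 + C * B) * A * b * (w i * w (j - i + 1)) := by ring
        _ ≤ (1 + C * B) * A * b * w (i + (j - i + 1)) :=
            mul_le_mul_of_nonneg_left (hw.mul_le _ _ (by omega)) (by positivity)
        _ = _ := by congr 2; omega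
    refine key.trans ?_
    have h2 : (2 : ℝ) ^ j ≤ 2 ^ N := pow_le_pow_right₀ one_le_two (by omega)
    have h3 : 0 ≤ (1 + C * B) * A * b * w (j + 1) := mul_nonneg (by positivity) (hw.nonneg _)
    calc _ ≤ 2 ^ N * ((1 + C * B) * A * b * w (j + 1)) := mul_le_mul_of_nonneg_right h2 h3
      _ = _ := by ring

/-- The derivatives of `f` are those of `f'`. -/
theorem JetLE.of_deriv {N : ℕ} {w v : ℕ → ℝ} {A B : ℝ} {f f' : ℝ → ℝ}
    (hf : ContDiffAt ℝ ∞ f 0) (hderiv : ∀ᶠ s in 𝓝 0, HasDerivAt f (f' s) s)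
    (h0 : |f 0| ≤ A * w 0) (h : JetLE N v B f') (hvw : ∀ j ≤ N, B * v j ≤ A * w (j + 1)) :
    JetLE (N + 1) w A f := by
  refine ⟨hf, fun j hj => ?_⟩
  rcases j with _ | j
  · simpa using h0
  · have heq : deriv f =ᶠ[𝓝 0] f' := hderiv.mono fun s hs => hs.deriv
    rw [iteratedDeriv_succ', heq.iteratedDeriv_eq]
    exact (h.2 j (by omega)).trans (hvw j (by omega))

/-! ### Symbol estimates for functions of |x| along lines -/

theorem jetWeight_zpow {l : ℝ} (hl : 0 < l) (N : ℕ) : JetWeight N (fun j => (l ^ j)⁻¹) :=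
  ⟨fun j => by positivity, by simp, fun i k _ => by rw [pow_add, mul_inv]⟩

theorem jetLE_affine {c l : ℝ} (hl : 0 < l) (hc : |c| ≤ l) (N : ℕ) :
    JetLE N (fun j => (l ^ j)⁻¹) l (fun t => c + t) := by
  refine ⟨by fun_prop, fun j _ => ?_⟩
  rcases j with _ | _ | j
  · simpa using hc
  · have : iteratedDeriv 1 (fun t => c + t) 0 = 1 := by simp [iteratedDeriv_one]
    rw [zero_add, this]
    simp [hl.ne']
  · have : iteratedDeriv (j + 2) (fun t => c + t) 0 = 0 := by
      have h : deriv (fun t : ℝ => c + t) = fun _ => 1 := by ext; simp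
      rw [iteratedDeriv_succ', h, iteratedDeriv_const]
      simp
    rw [this, abs_zero]
    positivity

/-- For a unit vector e the polynomial equals |x + te|² with r = |x| and c = ⟨x, e⟩, so |c| ≤ r. All
functions of |x| enter the line estimates through it. -/
theorem hasDerivAt_quadratic (r c s : ℝ) :
    HasDerivAt (fun t : ℝ => r ^ 2 + 2 * c * t + t ^ 2) (2 * (c + s)) s := by
  have h1 : HasDerivAt (fun t : ℝ => 2 * c * t) (2 * c * 1) s := (hasDerivAt_id s).const_mul (2 * c)
  have h2 : HasDerivAt (fun t : ℝ => t ^ 2) (2 * s ^ 1) s := by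
    simpa using hasDerivAt_pow 2 s
  exact ((h1.const_add (r ^ 2)).add h2).congr_deriv (by ring)

theorem eventually_quadratic_pos {r : ℝ} (hr : 0 < r) (c : ℝ) :
    ∀ᶠ s in 𝓝 (0 : ℝ), 0 < r ^ 2 + 2 * c * s + s ^ 2 := by
  have hc : Continuous (fun s : ℝ => r ^ 2 + 2 * c * s + s ^ 2) := by fun_prop
  refine hc.continuousAt.eventually (lt_mem_nhds ?_)
  simp only [mul_zero, add_zero, ne_eq, OfNat.ofNat_ne_zero, not_false_eq_true, zero_pow]
  positivity

theorem jetLE_quadratic {r c l : ℝ} (hl : 0 < l) (hr : |r| ≤ l) (hc : |c| ≤ l) (N : ℕ) :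
    JetLE N (fun j => (l ^ j)⁻¹) (2 ^ (N + 1) * l ^ 2) (fun t => r ^ 2 + 2 * c * t + t ^ 2) := by
  have hw := jetWeight_zpow hl N
  have hr2 : r ^ 2 ≤ l ^ 2 := sq_le_sq' (by linarith [abs_le.1 hr]) (abs_le.1 hr).2
  have hp1 : (1 : ℝ) ≤ 2 ^ N := one_le_pow₀ one_le_two
  rcases N with _ | N
  · refine ⟨by fun_prop, fun j hj => ?_⟩
    obtain rfl : j = 0 := by omega
    simp only [iteratedDeriv_zero]
    simp only [mul_zero, add_zero, ne_eq, OfNat.ofNat_ne_zero, not_false_eq_true, zero_pow,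
      pow_zero, inv_one, mul_one, zero_add, pow_one]
    rw [abs_of_nonneg (sq_nonneg _)]
    nlinarith [sq_nonneg l]
  · refine JetLE.of_deriv (v := fun j => (l ^ j)⁻¹) (B := 2 * l) (f' := fun t => 2 * (c + t))
      (by fun_prop) ?_ ?_ ?_ ?_
    · exact Eventually.of_forall fun s => hasDerivAt_quadratic r c s
    · simp only [mul_zero, add_zero, ne_eq, OfNat.ofNat_ne_zero, not_false_eq_true, zero_pow,
        pow_zero, inv_one, mul_one]
      rw [abs_of_nonneg (sq_nonneg _)]
      have : (1 : ℝ) ≤ 2 ^ (N + 1 + 1) := one_le_pow₀ one_le_two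
      nlinarith [sq_nonneg l]
    · simpa using (jetLE_affine hl hc N).const_mul 2
    · intro j _
      have : l ^ 2 * (l ^ (j + 1))⁻¹ = l * (l ^ j)⁻¹ := by
        rw [pow_succ l j]
        field_simp
      rw [mul_assoc, mul_assoc, this]
      have h2 : (2 : ℝ) ≤ 2 ^ (N + 1 + 1) := by
        calc (2 : ℝ) = 2 ^ 1 := by norm_num
          _ ≤ _ := pow_le_pow_right₀ one_le_two (by omega)
      exact mul_le_mul_of_nonneg_right h2 (by positivity)

/-- The symbol estimates of `(a² + |x|²)⁻¹` on lines. -/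
theorem exists_jetLE_inv_add_sq (a : ℝ) (ha : 0 < a) (N : ℕ) :
    ∃ C : ℝ, 0 ≤ C ∧ ∀ r c l : ℝ, 0 ≤ r → |c| ≤ r → l = max 1 r →
      JetLE N (fun j => (l ^ j)⁻¹) (C * (l ^ 2)⁻¹)
        (fun t => (a ^ 2 + (r ^ 2 + 2 * c * t + t ^ 2))⁻¹) := by
  -- Completing the square: r² + 2ct + t² = (r² - c²) + (c + t)².
  have hpos : ∀ r c t : ℝ, 0 ≤ r → |c| ≤ r → 0 < a ^ 2 + (r ^ 2 + 2 * c * t + t ^ 2) := by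
    intro r c t hr hc
    have : c ^ 2 ≤ r ^ 2 := sq_le_sq' (by linarith [abs_le.1 hc]) (abs_le.1 hc).2
    nlinarith [sq_nonneg (c + t), pow_pos ha 2]
  have hsm : ∀ r c : ℝ, 0 ≤ r → |c| ≤ r →
      ContDiffAt ℝ ∞ (fun t => (a ^ 2 + (r ^ 2 + 2 * c * t + t ^ 2))⁻¹) 0 := by
    intro r c hr hc
    exact ContDiffAt.inv (by fun_prop) (hpos r c 0 hr hc).ne'
  have h0 : ∀ r c l : ℝ, 0 ≤ r → |c| ≤ r → l = max 1 r →
      |(a ^ 2 + (r ^ 2 + 2 * c * 0 + 0 ^ 2))⁻¹| ≤ (1 + (a ^ 2)⁻¹) * (l ^ 2)⁻¹ := by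
    intro r c l hr hc hl
    have hp : 0 < a ^ 2 + r ^ 2 := by positivity
    have e : a ^ 2 + (r ^ 2 + 2 * c * 0 + 0 ^ 2) = a ^ 2 + r ^ 2 := by ring
    rw [e, abs_of_pos (inv_pos.2 hp)]
    have hl0 : 0 < l := by rw [hl]; positivity
    have : l ^ 2 ≤ (1 + (a ^ 2)⁻¹) * (a ^ 2 + r ^ 2) := by
      have e2 : (1 + (a ^ 2)⁻¹) * (a ^ 2 + r ^ 2) = a ^ 2 + r ^ 2 + 1 + (a ^ 2)⁻¹ * r ^ 2 := by
        field_simp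
        ring
      rw [e2]
      have h3 : 0 ≤ (a ^ 2)⁻¹ * r ^ 2 := by positivity
      rcases max_choice 1 r with h | h <;> rw [hl, h] <;> nlinarith [sq_nonneg a, sq_nonneg r]
    rw [← div_eq_mul_inv, inv_eq_one_div, div_le_div_iff₀ hp (by positivity)]
    linarith
  induction N with
  | zero =>
    refine ⟨1 + (a ^ 2)⁻¹, by positivity, fun r c l hr hc hl => ⟨hsm r c hr hc, fun j hj => ?_⟩⟩
    obtain rfl : j = 0 := by omega
    rw [iteratedDeriv_zero]
    simpa using h0 r c l hr hc hl
  | succ N ih =>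
    -- For p = (a² + |x + te|²)⁻¹ one has p' = -2 (c + t) p², so bounds of p to order N give bounds
    -- to order N + 1. The sizes match: l · l⁻² · l⁻² = l⁻² · l⁻¹.
    obtain ⟨C, hC0, hC⟩ := ih
    refine ⟨1 + (a ^ 2)⁻¹ + 2 * (2 ^ N * (1 * (2 ^ N * (C * C)))), by positivity,
      fun r c l hr hc hl => ?_⟩
    have hl1 : 1 ≤ l := by rw [hl]; exact le_max_left _ _
    have hl0 : 0 < l := by linarith
    have hw := jetWeight_zpow hl0 N
    have hcl : |c| ≤ l := hc.trans (by rw [hl]; exact le_max_right _ _)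
    have hp := hC r c l hr hc hl
    have hjet := ((jetLE_affine hl0 hcl N).mul hw (hp.mul hw hp)).const_mul (-2)
    refine JetLE.of_deriv (hsm r c hr hc) ?_ ?_ hjet ?_
    · refine Eventually.of_forall fun s => ?_
      have h1 : HasDerivAt (fun t : ℝ => a ^ 2 + (r ^ 2 + 2 * c * t + t ^ 2))
          (2 * (c + s)) s := (hasDerivAt_quadratic r c s).const_add _
      refine (h1.inv (hpos r c s hr hc).ne').congr_deriv ?_
      rw [div_eq_mul_inv, sq (a ^ 2 + _ : ℝ), mul_inv]
      ring
    · rw [pow_zero, inv_one, mul_one]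
      refine (h0 r c l hr hc hl).trans (mul_le_mul_of_nonneg_right ?_ (by positivity))
      linarith [show 0 ≤ 2 * (2 ^ N * (1 * (2 ^ N * (C * C)))) by positivity]
    · intro j _
      have e : |(-2 : ℝ)| * (2 ^ N * (l * (2 ^ N * (C * (l ^ 2)⁻¹ * (C * (l ^ 2)⁻¹))))) * (l ^ j)⁻¹
          = 2 * (2 ^ N * (1 * (2 ^ N * (C * C)))) * (l ^ 2)⁻¹ * (l ^ (j + 1))⁻¹ := by
        rw [abs_of_neg (by norm_num), pow_succ l j]
        field_simp
      rw [e]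
      refine mul_le_mul_of_nonneg_right (mul_le_mul_of_nonneg_right ?_ (by positivity))
        (by positivity)
      linarith [show 0 ≤ (a ^ 2)⁻¹ by positivity]

/-- The symbol estimates of `|x|⁻¹` on lines, away from the origin. -/
theorem exists_jetLE_inv_norm (N : ℕ) :
    ∃ C : ℝ, 0 ≤ C ∧ ∀ r c : ℝ, 1 ≤ r → |c| ≤ r →
      JetLE N (fun j => (r ^ j)⁻¹) (C * r⁻¹) (fun t => (√(r ^ 2 + 2 * c * t + t ^ 2))⁻¹) := by
  have hsm : ∀ r c : ℝ, 1 ≤ r →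
      ContDiffAt ℝ ∞ (fun t => (√(r ^ 2 + 2 * c * t + t ^ 2))⁻¹) 0 := by
    intro r c hr
    have hp : r ^ 2 + 2 * c * 0 + 0 ^ 2 ≠ 0 := by
      have : r ^ 2 + 2 * c * 0 + 0 ^ 2 = r ^ 2 := by ring
      rw [this]; positivity
    refine ContDiffAt.inv (ContDiffAt.sqrt (by fun_prop) hp) ?_
    rw [show r ^ 2 + 2 * c * 0 + 0 ^ 2 = r ^ 2 by ring, Real.sqrt_sq (by linarith)]
    linarith
  have h0 : ∀ r c : ℝ, 1 ≤ r → |(√(r ^ 2 + 2 * c * 0 + 0 ^ 2))⁻¹| = r⁻¹ := by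
    intro r c hr
    rw [show r ^ 2 + 2 * c * 0 + 0 ^ 2 = r ^ 2 by ring, Real.sqrt_sq (by linarith),
      abs_of_pos (by positivity)]
  induction N with
  | zero =>
    refine ⟨1, by positivity, fun r c hr hc => ⟨hsm r c hr, fun j hj => ?_⟩⟩
    obtain rfl : j = 0 := by omega
    rw [iteratedDeriv_zero, h0 r c hr]
    simp
  | succ N ih =>
    -- The same bootstrap for p = |x + te|⁻¹, where p' = -(c + t) p³ and r · r⁻³ = r⁻¹ · r⁻¹.
    obtain ⟨C, hC0, hC⟩ := ih
    refine ⟨1 + 2 ^ N * (2 ^ N * (C * (2 ^ N * (C * C)))), by positivity, fun r c hr hc => ?_⟩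
    have hr0 : 0 < r := by linarith
    have hw := jetWeight_zpow hr0 N
    have hp := hC r c hr hc
    have hjet := ((jetLE_affine hr0 hc N).mul hw (hp.mul hw (hp.mul hw hp))).const_mul (-1)
    refine JetLE.of_deriv (hsm r c hr) ?_ ?_ hjet ?_
    · filter_upwards [eventually_quadratic_pos hr0 c] with s hs
      have h3 := ((hasDerivAt_quadratic r c s).sqrt hs.ne').inv (Real.sqrt_pos.2 hs).ne'
      refine h3.congr_deriv ?_
      have hne := (Real.sqrt_pos.2 hs).ne'
      generalize √(r ^ 2 + 2 * c * s + s ^ 2) = z at hne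
      field_simp
    · rw [pow_zero, inv_one, mul_one, h0 r c hr]
      refine le_mul_of_one_le_left (by positivity) ?_
      linarith [show 0 ≤ 2 ^ N * (2 ^ N * (C * (2 ^ N * (C * C)))) by positivity]
    · intro j _
      have e : |(-1 : ℝ)| * (2 ^ N * (r * (2 ^ N * (C * r⁻¹ * (2 ^ N * (C * r⁻¹ * (C * r⁻¹))))))) *
          (r ^ j)⁻¹ = 2 ^ N * (2 ^ N * (C * (2 ^ N * (C * C)))) * r⁻¹ * (r ^ (j + 1))⁻¹ := by
        rw [abs_neg, abs_one, pow_succ r j]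
        field_simp
      rw [e]
      refine mul_le_mul_of_nonneg_right (mul_le_mul_of_nonneg_right ?_ (by positivity))
        (by positivity)
      linarith

/-- The symbol estimates of `|x|` on lines, away from the origin. -/
theorem exists_jetLE_norm (N : ℕ) :
    ∃ C : ℝ, 0 ≤ C ∧ ∀ r c : ℝ, 1 ≤ r → |c| ≤ r →
      JetLE N (fun j => (r ^ j)⁻¹) (C * r) (fun t => √(r ^ 2 + 2 * c * t + t ^ 2)) := by
  obtain ⟨C, hC0, hC⟩ := exists_jetLE_inv_norm N
  refine ⟨2 ^ N * (2 ^ (N + 1) * C), by positivity, fun r c hr hc => ?_⟩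
  have hr0 : 0 < r := by linarith
  have hw := jetWeight_zpow hr0 N
  -- |x| = |x|² · |x|⁻¹, so no further induction is needed.
  have h := (jetLE_quadratic hr0 (abs_of_pos hr0).le hc N).mul hw (hC r c hr hc)
  have h2 := h.mono (B := 2 ^ N * (2 ^ (N + 1) * C) * r) hw
    (le_of_eq (by field_simp))
  refine h2.congr ?_
  filter_upwards [eventually_quadratic_pos hr0 c] with s hs
  have := Real.sqrt_pos.2 hs
  rw [← div_eq_mul_inv, eq_div_iff this.ne', Real.mul_self_sqrt hs.le]

/-! ### The nonlinearity as a smooth function of |ξ|² and y, and its differences -/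

/-- A power series with coefficients bounded by `1 / k!` is a smooth function on the line. -/
theorem contDiff_tsum_of_factorial_bound {c : ℕ → ℝ} (hc : ∀ k, |c k| ≤ (k.factorial : ℝ)⁻¹) :
    ContDiff ℝ ∞ (fun t : ℝ => ∑' k, c k * t ^ k) := by
  set p := FormalMultilinearSeries.ofScalars ℝ c with hp
  have hr : p.radius = ⊤ := by
    refine ENNReal.eq_top_of_forall_nnreal_le fun r => ?_
    refine p.le_radius_of_summable_norm ?_
    have hs : Summable fun k : ℕ => ((k.factorial : ℝ)⁻¹) * (r : ℝ) ^ k := by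
      simpa [div_eq_inv_mul] using Real.summable_pow_div_factorial (r : ℝ)
    refine Summable.of_nonneg_of_le (fun k => by positivity) (fun k => ?_) hs
    refine mul_le_mul_of_nonneg_right ?_ (by positivity)
    rw [hp, FormalMultilinearSeries.ofScalars_norm]
    exact hc k
  have h : HasFPowerSeriesOnBall p.sum p 0 ⊤ := by
    rw [← hr]
    exact p.hasFPowerSeriesOnBall (by rw [hr]; exact ENNReal.zero_lt_top)
  have hsum : p.sum = fun t : ℝ => ∑' k, c k * t ^ k := by
    ext t
    simp only [FormalMultilinearSeries.sum, hp]
    refine tsum_congr fun k => ?_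
    rw [FormalMultilinearSeries.ofScalars_apply_eq, smul_eq_mul]
  rw [← hsum, ← contDiffOn_univ]
  have h2 : AnalyticOnNhd ℝ p.sum Set.univ := by
    intro t _
    exact h.analyticOnNhd t (by simp)
  exact h2.contDiffOn_of_completeSpace

noncomputable section

/-- The entire function `sin √t / √t`. -/
def sincSqrt (t : ℝ) : ℝ := ∑' k : ℕ, ((-1) ^ k / ((2 * k + 1).factorial : ℝ)) * t ^ k

/-- The entire function `(√t - sin √t) / √t ^ 3`. -/
def cubicSqrt (t : ℝ) : ℝ := ∑' k : ℕ, ((-1) ^ k / ((2 * k + 3).factorial : ℝ)) * t ^ k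

theorem contDiff_sincSqrt : ContDiff ℝ ∞ sincSqrt := by
  refine contDiff_tsum_of_factorial_bound fun k => ?_
  rw [abs_div, abs_pow, abs_neg, abs_one, one_pow, Nat.abs_cast, one_div]
  gcongr
  omega

theorem contDiff_cubicSqrt : ContDiff ℝ ∞ cubicSqrt := by
  refine contDiff_tsum_of_factorial_bound fun k => ?_
  rw [abs_div, abs_pow, abs_neg, abs_one, one_pow, Nat.abs_cast, one_div]
  gcongr
  omega

theorem mul_sincSqrt_sq (q : ℝ) : q * sincSqrt (q ^ 2) = Real.sin q := by
  rw [sincSqrt, ← tsum_mul_left, Real.sin_eq_tsum]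
  refine tsum_congr fun k => ?_
  rw [← pow_mul]
  ring

theorem mul_cubicSqrt_sq (q : ℝ) : q ^ 3 * cubicSqrt (q ^ 2) = q - Real.sin q := by
  have h := Real.hasSum_sin q
  have h1 := h.summable.tsum_eq_zero_add
  rw [h.tsum_eq] at h1
  rw [cubicSqrt, ← tsum_mul_left, h1]
  simp only [pow_zero, mul_zero, zero_add, pow_one, Nat.factorial_one, Nat.cast_one, div_one,
    one_mul]
  rw [sub_add_cancel_left, ← tsum_neg]
  refine tsum_congr fun k => ?_
  rw [← pow_mul, show 2 * (k + 1) + 1 = 2 * k + 3 by ring, pow_succ (-1 : ℝ) k]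
  ring

theorem sincSqrt_zero : sincSqrt 0 = 1 := by
  rw [sincSqrt, tsum_eq_single 0 (fun k hk => by simp [hk])]
  simp

theorem cubicSqrt_zero : cubicSqrt 0 = 1 / 6 := by
  rw [cubicSqrt, tsum_eq_single 0 (fun k hk => by simp [hk])]
  norm_num [Nat.factorial]

/-- The smooth extension of `sin (ρ y) / ρ` as a function of `q = ρ²` and `y`. -/
def sinKer (q y : ℝ) : ℝ := y * sincSqrt (q * y ^ 2)

/-- The smooth extension of `(ρ y - sin (ρ y)) / ρ³` as a function of `q = ρ²` and `y`. -/
def cubKer (q y : ℝ) : ℝ := y ^ 3 * cubicSqrt (q * y ^ 2)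

theorem mul_sinKer (ρ y : ℝ) : ρ * sinKer (ρ ^ 2) y = Real.sin (ρ * y) := by
  rw [sinKer, ← mul_sincSqrt_sq, mul_pow]
  ring

theorem mul_cubKer (ρ y : ℝ) : ρ ^ 3 * cubKer (ρ ^ 2) y = ρ * y - Real.sin (ρ * y) := by
  rw [cubKer, ← mul_cubicSqrt_sq, mul_pow]
  ring_nf

/-- With q = ρ² this is sin² α - sin² β = sin(α - β) sin(α + β) divided by ρ²; the case q = 0 is u²
- v² = (u - v)(u + v). -/
theorem sinKer_sq_sub_sq {q : ℝ} (hq : 0 ≤ q) (u v : ℝ) :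
    sinKer q u ^ 2 - sinKer q v ^ 2 = sinKer q (u - v) * sinKer q (u + v) := by
  rcases hq.eq_or_lt with rfl | hq
  · simp only [sinKer, zero_mul, sincSqrt_zero]
    ring
  · obtain ⟨ρ, hρ, rfl⟩ : ∃ ρ : ℝ, 0 < ρ ∧ q = ρ ^ 2 :=
      ⟨√q, Real.sqrt_pos.2 hq, (Real.sq_sqrt hq.le).symm⟩
    have h : ρ ^ 2 * (sinKer (ρ ^ 2) u ^ 2 - sinKer (ρ ^ 2) v ^ 2) =
        ρ ^ 2 * (sinKer (ρ ^ 2) (u - v) * sinKer (ρ ^ 2) (u + v)) := by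
      have e1 : ρ ^ 2 * (sinKer (ρ ^ 2) u ^ 2 - sinKer (ρ ^ 2) v ^ 2) =
          (ρ * sinKer (ρ ^ 2) u) ^ 2 - (ρ * sinKer (ρ ^ 2) v) ^ 2 := by ring
      have e2 : ρ ^ 2 * (sinKer (ρ ^ 2) (u - v) * sinKer (ρ ^ 2) (u + v)) =
          (ρ * sinKer (ρ ^ 2) (u - v)) * (ρ * sinKer (ρ ^ 2) (u + v)) := by ring
      rw [e1, e2, mul_sinKer, mul_sinKer, mul_sinKer, mul_sinKer, mul_sub, mul_add,
        Real.sin_sub, Real.sin_add]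
      linear_combination (Real.sin (ρ * u)) ^ 2 * Real.sin_sq_add_cos_sq (ρ * v) * (-1) +
        (Real.sin (ρ * v)) ^ 2 * Real.sin_sq_add_cos_sq (ρ * u)
    exact mul_left_cancel₀ (by positivity) h

/-- After multiplication by ρ³ the left side is ρ(u-v) - sin(ρ(u-v)) cos(ρ(u+v)). Writing the cosine
as 1 - 2 sin²(ρ(u+v)/2) splits off the cubic kernel of u - v; the remainder carries a factor in u -
v and two in u + v. -/
theorem cubKer_sub {q : ℝ} (hq : 0 ≤ q) (u v : ℝ) :
    cubKer q (2 * u) / 2 - cubKer q (2 * v) / 2 =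
      cubKer q (u - v) + 2 * (sinKer q (u - v) * sinKer q ((u + v) / 2) ^ 2) := by
  rcases hq.eq_or_lt with rfl | hq
  · simp only [cubKer, sinKer, zero_mul, sincSqrt_zero, cubicSqrt_zero]
    ring
  · obtain ⟨ρ, hρ, rfl⟩ : ∃ ρ : ℝ, 0 < ρ ∧ q = ρ ^ 2 :=
      ⟨√q, Real.sqrt_pos.2 hq, (Real.sq_sqrt hq.le).symm⟩
    refine mul_left_cancel₀ (pow_ne_zero 3 hρ.ne') ?_
    have e1 : ρ ^ 3 * (cubKer (ρ ^ 2) (2 * u) / 2 - cubKer (ρ ^ 2) (2 * v) / 2) =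
        (ρ ^ 3 * cubKer (ρ ^ 2) (2 * u) - ρ ^ 3 * cubKer (ρ ^ 2) (2 * v)) / 2 := by ring
    have e2 : ρ ^ 3 * (cubKer (ρ ^ 2) (u - v) +
          2 * (sinKer (ρ ^ 2) (u - v) * sinKer (ρ ^ 2) ((u + v) / 2) ^ 2)) =
        ρ ^ 3 * cubKer (ρ ^ 2) (u - v) +
          2 * ((ρ * sinKer (ρ ^ 2) (u - v)) * (ρ * sinKer (ρ ^ 2) ((u + v) / 2)) ^ 2) := by ring
    rw [e1, e2, mul_cubKer, mul_cubKer, mul_cubKer, mul_sinKer, mul_sinKer]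
    have hs : Real.sin (ρ * ((u + v) / 2)) ^ 2 = (1 - Real.cos (ρ * (u + v))) / 2 := by
      have := Real.cos_two_mul (ρ * ((u + v) / 2))
      rw [show 2 * (ρ * ((u + v) / 2)) = ρ * (u + v) by ring] at this
      have h2 := Real.sin_sq_add_cos_sq (ρ * ((u + v) / 2))
      linarith
    have hd : Real.sin (ρ * (2 * u)) - Real.sin (ρ * (2 * v)) =
        2 * (Real.sin (ρ * (u - v)) * Real.cos (ρ * (u + v))) := by
      have e3 : ρ * (2 * u) = ρ * (u + v) + ρ * (u - v) := by ring
      have e4 : ρ * (2 * v) = ρ * (u + v) - ρ * (u - v) := by ring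
      rw [e3, e4, Real.sin_add, Real.sin_sub]
      ring
    rw [hs]
    linear_combination (-1 / 2) * hd

/-- The coefficient `cos (4 arctan (ρ / a))` as a function of `p = (a² + ρ²)⁻¹`. -/
def cosCoeff (a p : ℝ) : ℝ := 2 * (2 * a ^ 2 * p - 1) ^ 2 - 1

/-- The coefficient `sin (4 arctan (ρ / a)) / ρ` as a function of `p = (a² + ρ²)⁻¹`. -/
def sinCoeff (a p : ℝ) : ℝ := 4 * a * p * (2 * a ^ 2 * p - 1)

/-- The smooth extension of the nonlinearity as a function of `q = |ξ|²` and `y`. -/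
def nonlinExt (n : ℕ) (q y : ℝ) : ℝ :=
  ((n : ℝ) - 3) *
    (sinCoeff √((n : ℝ) - 4) ((√((n : ℝ) - 4)) ^ 2 + q)⁻¹ * sinKer q y ^ 2 +
      cosCoeff √((n : ℝ) - 4) ((√((n : ℝ) - 4)) ^ 2 + q)⁻¹ * (cubKer q (2 * y) / 2))

/-- The difference now depends on u and v only through u - v and u + v inside kernels, so it can be
bounded by a product of a size of u - v and a size of u + v without a mean value theorem in y. -/
theorem nonlinExt_sub (n : ℕ) {q : ℝ} (hq : 0 ≤ q) (u v : ℝ) :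
    nonlinExt n q u - nonlinExt n q v = ((n : ℝ) - 3) *
      (sinCoeff √((n : ℝ) - 4) ((√((n : ℝ) - 4)) ^ 2 + q)⁻¹ *
          (sinKer q (u - v) * sinKer q (u + v)) +
        cosCoeff √((n : ℝ) - 4) ((√((n : ℝ) - 4)) ^ 2 + q)⁻¹ *
          (cubKer q (u - v) + 2 * (sinKer q (u - v) * sinKer q ((u + v) / 2) ^ 2))) := by
  rw [← sinKer_sq_sub_sq hq, ← cubKer_sub hq]
  unfold nonlinExt
  ring

/-- Two applications of the double angle formula starting from cos²(arctan(ρ/a)) = a²/(a² + ρ²). The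
angle 4 arctan(ρ/a) is 2ρφ₀, the argument of the trigonometric terms of η and η'. -/
theorem cos_four_arctan {a : ℝ} (ha : 0 < a) (ρ : ℝ) :
    Real.cos (4 * Real.arctan (ρ / a)) = cosCoeff a (a ^ 2 + ρ ^ 2)⁻¹ := by
  have hc : Real.cos (Real.arctan (ρ / a)) ^ 2 = a ^ 2 * (a ^ 2 + ρ ^ 2)⁻¹ := by
    rw [Real.cos_sq_arctan]
    field_simp
  have h2 : Real.cos (2 * Real.arctan (ρ / a)) = 2 * a ^ 2 * (a ^ 2 + ρ ^ 2)⁻¹ - 1 := by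
    rw [Real.cos_two_mul, hc]; ring
  rw [show 4 * Real.arctan (ρ / a) = 2 * (2 * Real.arctan (ρ / a)) by ring, Real.cos_two_mul, h2,
    cosCoeff]

theorem sin_four_arctan {a : ℝ} (ha : 0 < a) (ρ : ℝ) :
    Real.sin (4 * Real.arctan (ρ / a)) = ρ * sinCoeff a (a ^ 2 + ρ ^ 2)⁻¹ := by
  have hc : Real.cos (Real.arctan (ρ / a)) ^ 2 = a ^ 2 * (a ^ 2 + ρ ^ 2)⁻¹ := by
    rw [Real.cos_sq_arctan]
    field_simp
  have h2 : Real.cos (2 * Real.arctan (ρ / a)) = 2 * a ^ 2 * (a ^ 2 + ρ ^ 2)⁻¹ - 1 := by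
    rw [Real.cos_two_mul, hc]; ring
  have hs : Real.sin (2 * Real.arctan (ρ / a)) = 2 * ρ * a * (a ^ 2 + ρ ^ 2)⁻¹ := by
    have ht : Real.sin (Real.arctan (ρ / a)) = ρ / a * Real.cos (Real.arctan (ρ / a)) := by
      rw [Real.sin_arctan, Real.cos_arctan]; ring
    rw [Real.sin_two_mul, ht]
    have : 2 * (ρ / a * Real.cos (Real.arctan (ρ / a))) * Real.cos (Real.arctan (ρ / a)) =
        2 * (ρ / a) * Real.cos (Real.arctan (ρ / a)) ^ 2 := by ring
    rw [this, hc]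
    field_simp
  rw [show 4 * Real.arctan (ρ / a) = 2 * (2 * Real.arctan (ρ / a)) by ring, Real.sin_two_mul, h2,
    hs, sinCoeff]
  ring

theorem deriv_eta (y : ℝ) : deriv eta y = 2 - 2 * Real.cos (2 * y) := by
  have h2 : HasDerivAt (fun y : ℝ => 2 * y) 2 y := by
    simpa using (hasDerivAt_id y).const_mul (2 : ℝ)
  have h : HasDerivAt eta (2 - Real.cos (2 * y) * 2) y := h2.sub h2.sin
  rw [h.deriv]
  ring

/-- With θ = 2ρφ₀, the linear terms in η cancel and the bracket becomes sin θ (1 - cos 2ρy) + cos θ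
(2ρy - sin 2ρy). The first factor 1 - cos 2ρy is 2 sin²(ρy), and sin θ has a factor ρ. -/
theorem nonlin_eq_nonlinExt {n : ℕ} (hn : 5 ≤ n) {ξ : Sp n} (hξ : ξ ≠ 0) (y : ℝ) :
    nonlin n ξ y = nonlinExt n (‖ξ‖ ^ 2) y := by
  have hn5 : (5 : ℝ) ≤ n := by exact_mod_cast hn
  have ha : 0 < √((n : ℝ) - 4) := Real.sqrt_pos.2 (by linarith)
  have hρ : 0 < ‖ξ‖ := norm_pos_iff.2 hξ
  unfold nonlin nonlinExt
  rw [deriv_eta]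
  set a := √((n : ℝ) - 4) with had
  set ρ := ‖ξ‖ with hρd
  have hphi : ρ * phi0 n ξ = 2 * Real.arctan (ρ / a) := by
    rw [phi0, profile, ← hρd, ← had]
    field_simp
  have e1 : 2 * (ρ * (phi0 n ξ + y)) = 4 * Real.arctan (ρ / a) + 2 * (ρ * y) := by
    rw [mul_add, hphi]; ring
  have e2 : 2 * (ρ * phi0 n ξ) = 4 * Real.arctan (ρ / a) := by rw [hphi]; ring
  unfold eta
  rw [e1, e2, Real.sin_add, cos_four_arctan ha, sin_four_arctan ha]
  set s4 := sinCoeff a (a ^ 2 + ρ ^ 2)⁻¹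
  set c4 := cosCoeff a (a ^ 2 + ρ ^ 2)⁻¹
  have h1 := mul_sinKer ρ y
  have h2 := mul_cubKer ρ (2 * y)
  have h3 : Real.cos (2 * (ρ * y)) = 1 - 2 * (ρ * sinKer (ρ ^ 2) y) ^ 2 := by
    rw [h1, Real.cos_two_mul]
    linarith [Real.sin_sq_add_cos_sq (ρ * y)]
  have h4 : Real.sin (2 * (ρ * y)) = 2 * (ρ * y) - ρ ^ 3 * cubKer (ρ ^ 2) (2 * y) := by
    rw [h2, show ρ * (2 * y) = 2 * (ρ * y) by ring]; ring
  rw [h3, h4]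
  field_simp
  ring

end

/-! ### Pointwise estimates of the kernels and of the nonlinear difference -/

/-- The weights `w`, the size `l = max 1 |x|` and the decay factor `W` used in the pointwise
estimates. -/
structure DecayWeight (N : ℕ) (w : ℕ → ℝ) (l W : ℝ) : Prop extends JetWeight N w where
  one_le_W : 1 ≤ W
  W_le : W ≤ l
  symbol_le : ∀ j ≤ N, (l ^ j)⁻¹ ≤ w j
  shift_le : ∀ j, 1 ≤ j → j ≤ N → l * (l ^ j)⁻¹ ≤ W * w j

/-- Admissible derivative bounds of size `b` for a function on a line. -/
structure Adm (N : ℕ) (w : ℕ → ℝ) (l W b : ℝ) (y : ℝ → ℝ) : Prop where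
  smooth : ContDiffAt ℝ ∞ y 0
  value : |y 0| ≤ b / W
  deriv : ∀ j, 1 ≤ j → j ≤ N → |iteratedDeriv j y 0| ≤ b / l * w j

variable {N : ℕ} {w : ℕ → ℝ} {l W b : ℝ} {y : ℝ → ℝ}

theorem DecayWeight.W_pos (h : DecayWeight N w l W) : 0 < W := lt_of_lt_of_le one_pos h.one_le_W

theorem DecayWeight.l_pos (h : DecayWeight N w l W) : 0 < l := h.W_pos.trans_le h.W_le

theorem DecayWeight.one_le_l (h : DecayWeight N w l W) : 1 ≤ l := h.one_le_W.trans h.W_le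

theorem Adm.coeff_nonneg (hw : DecayWeight N w l W) (h : Adm N w l W b y) : 0 ≤ b := by
  have := (abs_nonneg _).trans h.value
  rcases div_nonneg_iff.1 this with h | h
  · exact h.1
  · linarith [h.2, hw.W_pos]

theorem Adm.jetLE (hw : DecayWeight N w l W) (h : Adm N w l W b y) : JetLE N w (b / W) y := by
  have hb := h.coeff_nonneg hw
  refine ⟨h.smooth, fun j hj => ?_⟩
  rcases Nat.eq_zero_or_pos j with rfl | hj0
  · simpa [hw.zero] using h.value
  · refine (h.deriv j hj0 hj).trans (mul_le_mul_of_nonneg_right ?_ (hw.nonneg j))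
    exact div_le_div_of_nonneg_left hb hw.W_pos hw.W_le

theorem JetLE.of_symbol (hw : DecayWeight N w l W) {A : ℝ} (hA : 0 ≤ A) {f : ℝ → ℝ}
    (h : JetLE N (fun j => (l ^ j)⁻¹) A f) : JetLE N w A f :=
  h.mono_weight hA hw.symbol_le

/-- The derivatives of `|x| y` on lines. -/
theorem exists_adm_norm_mul (N : ℕ) :
    ∃ C : ℝ, 0 ≤ C ∧ ∀ (w : ℕ → ℝ) (r c W b : ℝ) (y : ℝ → ℝ), 1 ≤ r → |c| ≤ r →
      DecayWeight N w r W → Adm N w r W b y →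
      ∀ j, 1 ≤ j → j ≤ N →
        |iteratedDeriv j (fun t => √(r ^ 2 + 2 * c * t + t ^ 2) * y t) 0| ≤ C * b * w j := by
  obtain ⟨C, hC0, hC⟩ := exists_jetLE_norm N
  refine ⟨2 ^ N * C, by positivity, fun w r c W b y hr hc hw hy j hj1 hj => ?_⟩
  have hρ := hC r c hr hc
  have hb := hy.coeff_nonneg hw
  have hr0 : 0 < r := by linarith
  have key : |iteratedDeriv j (fun t => √(r ^ 2 + 2 * c * t + t ^ 2) * y t) 0| ≤
      2 ^ j * (C * b * w j) := by
    refine abs_iteratedDeriv_mul_le hρ.1 hy.smooth fun i hi => ?_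
    have h1 := hρ.2 i (hi.trans hj)
    -- If all derivatives fall on |x|, then y decays only like 1/W, and `shift_le` repairs the loss.
    -- If y is differentiated at least once, its decay 1/r cancels the size of |x|.
    rcases hi.eq_or_lt with rfl | hlt
    · rw [Nat.sub_self, iteratedDeriv_zero]
      calc _ ≤ (C * r * (r ^ i)⁻¹) * (b / W) :=
            mul_le_mul h1 hy.value (abs_nonneg _) (by positivity)
        _ = C * b * (r * (r ^ i)⁻¹ / W) := by ring
        _ ≤ C * b * w i := by
            refine mul_le_mul_of_nonneg_left ?_ (by positivity)
            rw [div_le_iff₀ hw.W_pos, mul_comm (w i)]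
            exact hw.shift_le i hj1 hj
    · calc _ ≤ (C * r * (r ^ i)⁻¹) * (b / r * w (j - i)) :=
            mul_le_mul h1 (hy.deriv _ (by omega) (by omega)) (abs_nonneg _) (by positivity)
        _ = C * b * ((r ^ i)⁻¹ * w (j - i)) := by field_simp
        _ ≤ C * b * (w i * w (j - i)) := by
            refine mul_le_mul_of_nonneg_left ?_ (by positivity)
            exact mul_le_mul_of_nonneg_right (hw.symbol_le i (by omega)) (hw.nonneg _)
        _ ≤ C * b * w (i + (j - i)) :=
            mul_le_mul_of_nonneg_left (hw.mul_le _ _ (by omega)) (by positivity)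
        _ = _ := by rw [Nat.add_sub_cancel' hi]
  refine key.trans ?_
  have : (2 : ℝ) ^ j ≤ 2 ^ N := pow_le_pow_right₀ one_le_two hj
  have h3 : 0 ≤ C * b * w j := mul_nonneg (by positivity) (hw.nonneg _)
  calc _ ≤ 2 ^ N * (C * b * w j) := mul_le_mul_of_nonneg_right this h3
    _ = _ := by ring

theorem abs_iteratedDeriv_sin_le (i : ℕ) (t : ℝ) : |iteratedDeriv i Real.sin t| ≤ 1 :=
  Real.abs_iteratedDeriv_sin_le_one i t

theorem abs_iteratedDeriv_one_sub_cos_le (i : ℕ) (t : ℝ) :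
    |iteratedDeriv i (fun t => 1 - Real.cos t) t| ≤ 2 := by
  rcases i with _ | i
  · rw [iteratedDeriv_zero, abs_le]
    constructor <;> linarith [Real.neg_one_le_cos t, Real.cos_le_one t]
  · have : deriv (fun t : ℝ => 1 - Real.cos t) = Real.sin := by
      ext s; simp
    rw [iteratedDeriv_succ', this]
    exact (abs_iteratedDeriv_sin_le i t).trans one_le_two

theorem abs_one_sub_cos_le (t : ℝ) : |1 - Real.cos t| ≤ |t| := by
  rw [abs_of_nonneg (by linarith [Real.cos_le_one t])]
  rcases le_total |t| 2 with h | h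
  · have h1 := Real.one_sub_sq_div_two_le_cos (x := t)
    nlinarith [abs_nonneg t, sq_abs t]
  · linarith [Real.neg_one_le_cos t]

/-- The left side is cubic for small t and linear for large t; the square dominates both, and a
quadratic gain is all that is required. -/
theorem abs_sub_sin_le_sq (t : ℝ) : |t - Real.sin t| ≤ t ^ 2 := by
  rw [← sq_abs]
  rcases le_total |t| 2 with h | h
  · refine (Real.abs_sub_sin_le t).trans ?_
    nlinarith [abs_nonneg t, sq_nonneg |t|]
  · have h1 := abs_sub t (Real.sin t)
    nlinarith [Real.abs_sin_le_one t]

/-- Far from the origin: estimates of `sin g` and `g - sin g` for `g = |x| y`. -/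
theorem exists_jetLE_sin_norm_mul (N : ℕ) (B : ℝ) (hB : 0 ≤ B) :
    ∃ C : ℝ, 0 ≤ C ∧ ∀ (w : ℕ → ℝ) (r c W b : ℝ) (y : ℝ → ℝ), 1 ≤ r → |c| ≤ r →
      DecayWeight N w r W → Adm N w r W b y → b ≤ B →
      JetLE N w C (fun t => Real.sin (√(r ^ 2 + 2 * c * t + t ^ 2) * y t)) ∧
      JetLE N w (C * (b * (r / W)))
        (fun t => Real.sin (√(r ^ 2 + 2 * c * t + t ^ 2) * y t)) ∧
      JetLE N w (C * (b * (r / W)) ^ 2)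
        (fun t => √(r ^ 2 + 2 * c * t + t ^ 2) * y t -
          Real.sin (√(r ^ 2 + 2 * c * t + t ^ 2) * y t)) := by
  obtain ⟨C₀, hC₀, hg⟩ := exists_adm_norm_mul N
  obtain ⟨C₁, hC₁, hcomp⟩ := exists_jet_comp_bound N (C₀ * B) (by positivity)
  refine ⟨1 + C₁ * C₀ * (1 + B) + 2 ^ N * ((1 + 2 * C₁ * C₀) * C₀), by positivity,
    fun w r c W b y hr hc hw hy hbB => ?_⟩
  have hb := hy.coeff_nonneg hw
  have hr0 : 0 < r := by linarith
  have hW := hw.W_pos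
  have hrW : 1 ≤ r / W := (one_le_div hW).2 hw.W_le
  -- `X` bounds g(0) = r y(0) and may be arbitrarily large, whereas the derivatives of g of positive
  -- order are bounded by `C₀ * b * w j`. The chain rule bound needs only the latter.
  set X := b * (r / W) with hX
  have hbX : b ≤ X := le_mul_of_one_le_right hb hrW
  have hX0 : 0 ≤ X := hb.trans hbX
  set g : ℝ → ℝ := fun t => √(r ^ 2 + 2 * c * t + t ^ 2) * y t with hgdef
  have hgj : ∀ j, 1 ≤ j → j ≤ N → |iteratedDeriv j g 0| ≤ C₀ * b * w j :=
    hg w r c W b y hr hc hw hy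
  have hgs : ContDiffAt ℝ ∞ g 0 := by
    refine ContDiffAt.mul (ContDiffAt.sqrt (by fun_prop) ?_) hy.smooth
    simp only [mul_zero, add_zero, ne_eq, OfNat.ofNat_ne_zero, not_false_eq_true, zero_pow]
    positivity
  have hg0 : |g 0| ≤ X := by
    have : g 0 = r * y 0 := by
      simp only [hgdef, mul_zero, add_zero, ne_eq, OfNat.ofNat_ne_zero, not_false_eq_true, zero_pow]
      rw [Real.sqrt_sq hr0.le]
    rw [this, abs_mul, abs_of_pos hr0]
    calc _ ≤ r * (b / W) := mul_le_mul_of_nonneg_left hy.value hr0.le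
      _ = X := by rw [hX]; ring
  have hC₀b : 0 ≤ C₀ * b := by positivity
  have hC₀B : C₀ * b ≤ C₀ * B := by gcongr
  have hsin : ∀ j, 1 ≤ j → j ≤ N →
      |iteratedDeriv j (fun t => Real.sin (g t)) 0| ≤ C₁ * (1 * (C₀ * b)) * w j :=
    hcomp Real.sin g w 1 (C₀ * b) hw.toJetWeight Real.contDiff_sin hgs hC₀b hC₀B
      (fun i _ => abs_iteratedDeriv_sin_le i _) hgj
  have hcos : ∀ j, 1 ≤ j → j ≤ N →
      |iteratedDeriv j (fun t => 1 - Real.cos (g t)) 0| ≤ C₁ * (2 * (C₀ * b)) * w j :=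
    hcomp (fun t => 1 - Real.cos t) g w 2 (C₀ * b) hw.toJetWeight
      (contDiff_const.sub Real.contDiff_cos) hgs hC₀b hC₀B
      (fun i _ => abs_iteratedDeriv_one_sub_cos_le i _) hgj
  have hsins : ContDiffAt ℝ ∞ (fun t => Real.sin (g t)) 0 := hgs.sin
  have hcoss : ContDiffAt ℝ ∞ (fun t => 1 - Real.cos (g t)) 0 := contDiffAt_const.sub hgs.cos
  have hcosj : JetLE N w ((1 + 2 * C₁ * C₀) * X) (fun t => 1 - Real.cos (g t)) := by
    refine ⟨hcoss, fun j hj => ?_⟩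
    rcases Nat.eq_zero_or_pos j with rfl | hj0
    · rw [iteratedDeriv_zero, hw.zero, mul_one]
      refine (abs_one_sub_cos_le _).trans (hg0.trans ?_)
      exact le_mul_of_one_le_left hX0 (by linarith [mul_nonneg hC₁ hC₀])
    · refine (hcos j hj0 hj).trans (mul_le_mul_of_nonneg_right ?_ (hw.nonneg _))
      calc C₁ * (2 * (C₀ * b)) = 2 * C₁ * C₀ * b := by ring
        _ ≤ 2 * C₁ * C₀ * X := by gcongr
        _ ≤ _ := by linarith
  have e0 : 0 ≤ C₁ * C₀ * (1 + B) := by positivity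
  have e1 : 0 ≤ 2 ^ N * ((1 + 2 * C₁ * C₀) * C₀) := by positivity
  refine ⟨⟨hsins, fun j hj => ?_⟩, ⟨hsins, fun j hj => ?_⟩, ⟨hgs.sub hsins, fun j hj => ?_⟩⟩
  · rcases Nat.eq_zero_or_pos j with rfl | hj0
    · rw [iteratedDeriv_zero, hw.zero, mul_one]
      linarith [Real.abs_sin_le_one (g 0)]
    · refine (hsin j hj0 hj).trans (mul_le_mul_of_nonneg_right ?_ (hw.nonneg _))
      calc C₁ * (1 * (C₀ * b)) = C₁ * C₀ * b := by ring
        _ ≤ C₁ * C₀ * (1 + B) := by gcongr; linarith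
        _ ≤ _ := by linarith
  · rcases Nat.eq_zero_or_pos j with rfl | hj0
    · rw [iteratedDeriv_zero, hw.zero, mul_one]
      refine (Real.abs_sin_le_abs).trans (hg0.trans (le_mul_of_one_le_left hX0 (by linarith)))
    · refine (hsin j hj0 hj).trans (mul_le_mul_of_nonneg_right ?_ (hw.nonneg _))
      calc C₁ * (1 * (C₀ * b)) = C₁ * C₀ * 1 * b := by ring
        _ ≤ C₁ * C₀ * (1 + B) * X := by gcongr; linarith
        _ ≤ _ := mul_le_mul_of_nonneg_right (by linarith) hX0
  · rcases j with _ | j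
    · rw [iteratedDeriv_zero, hw.zero, mul_one]
      refine (abs_sub_sin_le_sq _).trans ?_
      rw [← sq_abs]
      calc _ ≤ X ^ 2 := by gcongr
        _ ≤ _ := le_mul_of_one_le_left (by positivity) (by linarith)
    -- (g - sin g)' = (1 - cos g) g'. The first factor is of size X and the second of size b ≤ X,
    -- which gives the square.
    · have heq : deriv (fun t => g t - Real.sin (g t)) =ᶠ[𝓝 0]
          fun t => (1 - Real.cos (g t)) * deriv g t := by
        filter_upwards [ContDiffAt.eventually_differentiableAt hgs] with s hs
        refine (hs.hasDerivAt.sub hs.hasDerivAt.sin).deriv.trans ?_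
        ring
      rw [iteratedDeriv_succ', heq.iteratedDeriv_eq]
      have key : |iteratedDeriv j (fun t => (1 - Real.cos (g t)) * deriv g t) 0| ≤
          2 ^ j * ((1 + 2 * C₁ * C₀) * C₀ * X ^ 2 * w (j + 1)) := by
        refine abs_iteratedDeriv_mul_le hcoss (ContDiffAt.deriv_infty hgs) fun i hi => ?_
        rw [← iteratedDeriv_succ']
        calc _ ≤ ((1 + 2 * C₁ * C₀) * X * w i) * (C₀ * b * w (j - i + 1)) :=
              mul_le_mul (hcosj.2 i (by omega)) (hgj _ (by omega) (by omega)) (abs_nonneg _)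
                (mul_nonneg (by positivity) (hw.nonneg _))
          _ = (1 + 2 * C₁ * C₀) * X * C₀ * b * (w i * w (j - i + 1)) := by ring
          _ ≤ (1 + 2 * C₁ * C₀) * X * C₀ * X * w (i + (j - i + 1)) := by
              have := hw.mul_le i (j - i + 1) (by omega)
              have h0 : 0 ≤ w i * w (j - i + 1) := mul_nonneg (hw.nonneg _) (hw.nonneg _)
              gcongr
          _ = _ := by rw [show i + (j - i + 1) = j + 1 by omega]; ring
      refine key.trans ?_
      have h2 : (2 : ℝ) ^ j ≤ 2 ^ N := pow_le_pow_right₀ one_le_two (by omega)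
      have hwn := hw.nonneg (j + 1)
      calc _ ≤ 2 ^ N * ((1 + 2 * C₁ * C₀) * C₀ * X ^ 2 * w (j + 1)) := by gcongr
        _ = 2 ^ N * ((1 + 2 * C₁ * C₀) * C₀) * X ^ 2 * w (j + 1) := by ring
        _ ≤ _ := by gcongr; linarith

/-- Bounds for the derivatives of a smooth function on a compact interval. -/
theorem exists_iteratedDeriv_bound {F : ℝ → ℝ} (hF : ContDiff ℝ ∞ F) (N : ℕ) (R : ℝ) :
    ∃ A : ℝ, 0 ≤ A ∧ ∀ i ≤ N, ∀ t, |t| ≤ R → |iteratedDeriv i F t| ≤ A := by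
  have h : ∀ i : ℕ, ∃ A : ℝ, 0 ≤ A ∧ ∀ t, |t| ≤ R → |iteratedDeriv i F t| ≤ A := by
    intro i
    have hc : Continuous (iteratedDeriv i F) :=
      hF.continuous_iteratedDeriv i (by exact_mod_cast le_top)
    obtain ⟨A, hA⟩ := (isCompact_Icc (a := -R) (b := R)).exists_bound_of_continuousOn
      hc.continuousOn
    exact ⟨|A|, abs_nonneg _, fun t ht => (hA t (abs_le.1 ht)).trans (le_abs_self _)⟩
  choose A hA0 hA using h
  refine ⟨∑ i ∈ Finset.range (N + 1), A i, Finset.sum_nonneg fun i _ => hA0 i,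
    fun i hi t ht => (hA i t ht).trans ?_⟩
  exact Finset.single_le_sum (f := A) (fun i _ => hA0 i) (Finset.mem_range.2 (by omega))

/-- Near the origin: composition of a smooth function with `|x|² y²`. -/
theorem exists_jetLE_comp_near {F : ℝ → ℝ} (hF : ContDiff ℝ ∞ F) (N : ℕ) (B : ℝ) (hB : 0 ≤ B) :
    ∃ C : ℝ, 0 ≤ C ∧ ∀ (w : ℕ → ℝ) (r c b : ℝ) (y : ℝ → ℝ), 0 ≤ r → r ≤ 1 → |c| ≤ r →
      DecayWeight N w 1 1 → Adm N w 1 1 b y → b ≤ B →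
      JetLE N w C (fun t => F ((r ^ 2 + 2 * c * t + t ^ 2) * y t ^ 2)) := by
  -- `D` bounds the derivatives of |x|² y² for |x| ≤ 1: the factor `2 ^ (N + 1)` comes from |x|²,
  -- the product `B * B` from y².
  set D : ℝ := 2 ^ N * (2 ^ (N + 1) * (2 ^ N * (B * B))) with hD
  obtain ⟨A, hA0, hA⟩ := exists_iteratedDeriv_bound hF N (B ^ 2)
  obtain ⟨C₁, hC₁, hcomp⟩ := exists_jet_comp_bound N D (by positivity)
  refine ⟨A + C₁ * (A * D), by positivity, fun w r c b y hr hr1 hc hw hy hbB => ?_⟩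
  have hb := hy.coeff_nonneg hw
  have hyj : JetLE N w B y := (hy.jetLE hw).mono hw.toJetWeight (by simpa using hbB)
  have hq : JetLE N w (2 ^ (N + 1)) (fun t => r ^ 2 + 2 * c * t + t ^ 2) := by
    have := (jetLE_quadratic (r := r) (c := c) one_pos (by rwa [abs_of_nonneg hr])
      (hc.trans hr1) N).of_symbol hw (by positivity)
    simpa using this
  have hg : JetLE N w D (fun t => (r ^ 2 + 2 * c * t + t ^ 2) * y t ^ 2) := by
    simpa only [sq (y _)] using hq.mul hw.toJetWeight (hyj.mul hw.toJetWeight hyj)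
  have hg0 : |(r ^ 2 + 2 * c * 0 + 0 ^ 2) * y 0 ^ 2| ≤ B ^ 2 := by
    have h1 : |y 0| ≤ B := hy.value.trans (by simpa using hbB)
    have h2 : |(r ^ 2 + 2 * c * 0 + 0 ^ 2) * y 0 ^ 2| = r ^ 2 * |y 0| ^ 2 := by
      have e : (r ^ 2 + 2 * c * 0 + 0 ^ 2) * y 0 ^ 2 = r ^ 2 * y 0 ^ 2 := by ring
      rw [e, sq_abs, abs_of_nonneg (by positivity)]
    rw [h2]
    have h3 : r ^ 2 ≤ 1 := pow_le_one₀ hr hr1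
    calc _ ≤ 1 * B ^ 2 := by gcongr
      _ = _ := one_mul _
  refine ⟨hF.contDiffAt.comp 0 hg.1, fun j hj => ?_⟩
  rcases Nat.eq_zero_or_pos j with rfl | hj0
  · rw [iteratedDeriv_zero, hw.zero, mul_one]
    have := hA 0 (Nat.zero_le _) _ hg0
    rw [iteratedDeriv_zero] at this
    linarith [show 0 ≤ C₁ * (A * D) by positivity]
  · refine (hcomp F _ w A D hw.toJetWeight hF hg.1 (by positivity) le_rfl
      (fun i hi => hA i hi _ hg0) (fun i _ hi => hg.2 i hi) j hj0 hj).trans ?_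
    exact mul_le_mul_of_nonneg_right (by linarith) (hw.nonneg _)

/-- Estimates of the kernel `sin (|x| y) / |x|` and of `(|x| y - sin (|x| y)) / |x|³` on lines. -/
theorem exists_jetLE_kernels (N : ℕ) (B : ℝ) (hB : 0 ≤ B) :
    ∃ C : ℝ, 0 ≤ C ∧ ∀ (w : ℕ → ℝ) (r c l W b : ℝ) (y : ℝ → ℝ), 0 ≤ r → |c| ≤ r →
      l = max 1 r → DecayWeight N w l W → Adm N w l W b y → b ≤ B →
      JetLE N w (C * l⁻¹) (fun t => sinKer (r ^ 2 + 2 * c * t + t ^ 2) (y t)) ∧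
      JetLE N w (C * (b / W)) (fun t => sinKer (r ^ 2 + 2 * c * t + t ^ 2) (y t)) ∧
      JetLE N w (C * ((b / W) ^ 2 * l⁻¹)) (fun t => cubKer (r ^ 2 + 2 * c * t + t ^ 2) (y t)) := by
  obtain ⟨C₁, hC₁, hfar⟩ := exists_jetLE_sin_norm_mul N B hB
  obtain ⟨C₂, hC₂, hinv⟩ := exists_jetLE_inv_norm N
  obtain ⟨C₃, hC₃, hS⟩ := exists_jetLE_comp_near contDiff_sincSqrt N B hB
  obtain ⟨C₄, hC₄, hT⟩ := exists_jetLE_comp_near contDiff_cubicSqrt N B hB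
  set D : ℝ := 2 ^ N * C₃ * (1 + B) + 2 ^ N * (2 ^ N * (2 ^ N * B)) * C₄ +
    2 ^ N * C₁ * C₂ + 2 ^ N * C₁ * (2 ^ N * (C₂ * (2 ^ N * (C₂ * C₂)))) with hD
  have p1 : 0 ≤ 2 ^ N * C₃ * (1 + B) := by positivity
  have p2 : 0 ≤ 2 ^ N * (2 ^ N * (2 ^ N * B)) * C₄ := by positivity
  have p3 : 0 ≤ 2 ^ N * C₁ * C₂ := by positivity
  have p4 : 0 ≤ 2 ^ N * C₁ * (2 ^ N * (C₂ * (2 ^ N * (C₂ * C₂)))) := by positivity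
  refine ⟨D, by positivity, fun w r c l W b y hr hc hl hw hy hbB => ?_⟩
  have hb := hy.coeff_nonneg hw
  have hj := hw.toJetWeight
  -- For |x| < 1 one has l = W = 1 and the entire functions are composed with |x|² y². For |x| ≥ 1
  -- the bounds of sin(|x| y) and |x| y - sin(|x| y) are divided by |x| and |x|³; note (b l/W)² l⁻³
  -- = (b/W)² l⁻¹.
  rcases lt_or_ge r 1 with hr1 | hr1
  · have hl1 : l = 1 := by rw [hl, max_eq_left hr1.le]
    subst hl1
    have hW : W = 1 := le_antisymm hw.W_le hw.one_le_W
    subst hW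
    have hyj : JetLE N w b y := by simpa using hy.jetLE hw
    have h1 := hyj.mul hj (hS w r c b y hr hr1.le hc hw hy hbB)
    have h2 := (hyj.mul hj (hyj.mul hj hyj)).mul hj (hT w r c b y hr hr1.le hc hw hy hbB)
    have e1 : 2 ^ N * (b * C₃) ≤ D * b := by
      calc 2 ^ N * (b * C₃) = 2 ^ N * C₃ * 1 * b := by ring
        _ ≤ 2 ^ N * C₃ * (1 + B) * b := by gcongr; linarith
        _ ≤ _ := mul_le_mul_of_nonneg_right (by linarith) hb
    have e0 : 2 ^ N * (b * C₃) ≤ D := by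
      calc 2 ^ N * (b * C₃) = 2 ^ N * C₃ * b := by ring
        _ ≤ 2 ^ N * C₃ * (1 + B) := by gcongr; linarith
        _ ≤ _ := by linarith
    have e2 : 2 ^ N * (2 ^ N * (b * (2 ^ N * (b * b))) * C₄) ≤ D * b ^ 2 := by
      calc 2 ^ N * (2 ^ N * (b * (2 ^ N * (b * b))) * C₄)
          = 2 ^ N * (2 ^ N * (2 ^ N * b)) * C₄ * b ^ 2 := by ring
        _ ≤ 2 ^ N * (2 ^ N * (2 ^ N * B)) * C₄ * b ^ 2 := by gcongr
        _ ≤ _ := mul_le_mul_of_nonneg_right (by linarith) (by positivity)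
    simp only [inv_one, mul_one, div_one]
    refine ⟨h1.mono hj e0, h1.mono hj e1, ?_⟩
    have h3 := h2.mono hj e2
    refine h3.congr (Eventually.of_forall fun t => ?_)
    simp only [cubKer]
    ring
  · have hlr : l = r := by rw [hl, max_eq_right hr1]
    subst hlr
    have hl0 : 0 < l := by linarith
    have hW := hw.W_pos
    obtain ⟨f1, f2, f3⟩ := hfar w l c W b y hr1 hc hw hy hbB
    have hi := (hinv l c hr1 hc).of_symbol hw (by positivity)
    have hev := eventually_quadratic_pos hl0 c
    have hK : (fun t => sinKer (l ^ 2 + 2 * c * t + t ^ 2) (y t)) =ᶠ[𝓝 0]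
        fun t => Real.sin (√(l ^ 2 + 2 * c * t + t ^ 2) * y t) *
          (√(l ^ 2 + 2 * c * t + t ^ 2))⁻¹ := by
      filter_upwards [hev] with t ht
      have h0 := (Real.sqrt_pos.2 ht).ne'
      rw [eq_mul_inv_iff_mul_eq₀ h0, mul_comm, ← mul_sinKer, Real.sq_sqrt ht.le]
    have hR : (fun t => cubKer (l ^ 2 + 2 * c * t + t ^ 2) (y t)) =ᶠ[𝓝 0]
        fun t => (√(l ^ 2 + 2 * c * t + t ^ 2) * y t -
          Real.sin (√(l ^ 2 + 2 * c * t + t ^ 2) * y t)) *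
          ((√(l ^ 2 + 2 * c * t + t ^ 2))⁻¹ * ((√(l ^ 2 + 2 * c * t + t ^ 2))⁻¹ *
            (√(l ^ 2 + 2 * c * t + t ^ 2))⁻¹)) := by
      filter_upwards [hev] with t ht
      have h0 := (Real.sqrt_pos.2 ht).ne'
      rw [← mul_cubKer, Real.sq_sqrt ht.le]
      field_simp
    refine ⟨((f1.mul hj hi).mono hj ?_).congr hK, ((f2.mul hj hi).mono hj ?_).congr hK,
      ((f3.mul hj (hi.mul hj (hi.mul hj hi))).mono hj ?_).congr hR⟩
    · calc _ = 2 ^ N * C₁ * C₂ * l⁻¹ := by ring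
        _ ≤ _ := mul_le_mul_of_nonneg_right (by linarith) (by positivity)
    · calc _ = 2 ^ N * C₁ * C₂ * (b / W) := by field_simp
        _ ≤ _ := mul_le_mul_of_nonneg_right (by linarith) (by positivity)
    · calc _ = 2 ^ N * C₁ * (2 ^ N * (C₂ * (2 ^ N * (C₂ * C₂)))) * ((b / W) ^ 2 * l⁻¹) := by
            field_simp
        _ ≤ _ := mul_le_mul_of_nonneg_right (by linarith) (by positivity)

/-- The coefficients of the nonlinearity are symbols. -/
theorem exists_jetLE_coeff (a : ℝ) (ha : 0 < a) (N : ℕ) :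
    ∃ C : ℝ, 0 ≤ C ∧ ∀ (w : ℕ → ℝ) (r c l W : ℝ), 0 ≤ r → |c| ≤ r →
      l = max 1 r → DecayWeight N w l W →
      JetLE N w C (fun t => cosCoeff a (a ^ 2 + (r ^ 2 + 2 * c * t + t ^ 2))⁻¹) ∧
      JetLE N w (C * l⁻¹) (fun t => sinCoeff a (a ^ 2 + (r ^ 2 + 2 * c * t + t ^ 2))⁻¹) := by
  obtain ⟨C₁, hC₁, hp⟩ := exists_jetLE_inv_add_sq a ha N
  set A : ℝ := |2 * a ^ 2| * C₁ + |(-1)| with hA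
  have hA0 : 0 ≤ A := by positivity
  refine ⟨|2| * (2 ^ N * (A * A)) + |(-1)| + 2 ^ N * (|4 * a| * C₁ * A), by positivity,
    fun w r c l W hr hc hl hw => ?_⟩
  have hj := hw.toJetWeight
  have hl1 := hw.one_le_l
  have hl0 := hw.l_pos
  have hli : l⁻¹ ≤ 1 := inv_le_one_of_one_le₀ hl1
  have h := (hp r c l hr hc hl).of_symbol hw (by positivity)
  have h1 : JetLE N w (C₁ * l⁻¹) (fun t => (a ^ 2 + (r ^ 2 + 2 * c * t + t ^ 2))⁻¹) := by
    refine h.mono hj (mul_le_mul_of_nonneg_left ?_ hC₁)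
    rw [sq, mul_inv]
    exact mul_le_of_le_one_left (by positivity) hli
  have h2 : JetLE N w A
      (fun t => 2 * a ^ 2 * (a ^ 2 + (r ^ 2 + 2 * c * t + t ^ 2))⁻¹ + (-1)) := by
    refine JetLE.add (JetLE.const_mul (h1.mono hj ?_) _) (JetLE.const hj _)
    exact mul_le_of_le_one_right hC₁ hli
  have h3 : JetLE N w _ (fun t => 2 *
      ((2 * a ^ 2 * (a ^ 2 + (r ^ 2 + 2 * c * t + t ^ 2))⁻¹ + (-1)) *
      (2 * a ^ 2 * (a ^ 2 + (r ^ 2 + 2 * c * t + t ^ 2))⁻¹ + (-1))) + (-1)) :=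
    ((h2.mul hj h2).const_mul 2).add (JetLE.const hj (-1))
  have h4 := (h1.const_mul (4 * a)).mul hj h2
  constructor
  · refine (h3.mono hj ?_).congr (Eventually.of_forall fun t => ?_)
    · linarith [show 0 ≤ 2 ^ N * (|4 * a| * C₁ * A) by positivity]
    · simp only [cosCoeff]
      ring
  · refine (h4.mono hj ?_).congr (Eventually.of_forall fun t => ?_)
    · calc _ = 2 ^ N * (|4 * a| * C₁ * A) * l⁻¹ := by ring
        _ ≤ _ := by
          refine mul_le_mul_of_nonneg_right ?_ (by positivity)
          linarith [show 0 ≤ |(2 : ℝ)| * (2 ^ N * (A * A)) + |(-1 : ℝ)| by positivity]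
    · simp only [sinCoeff]
      ring

/-- The pointwise form of the nonlinear estimate. -/
theorem exists_jetLE_nonlinExt_sub {n : ℕ} (hn : 5 ≤ n) (N : ℕ) (B : ℝ) (hB : 0 ≤ B) :
    ∃ C : ℝ, 0 ≤ C ∧ ∀ (w : ℕ → ℝ) (r c l W a b : ℝ) (u v : ℝ → ℝ), 0 ≤ r → |c| ≤ r →
      l = max 1 r → DecayWeight N w l W → a ≤ b → b ≤ B →
      Adm N w l W a (fun t => u t - v t) → Adm N w l W b (fun t => u t + v t) →
      JetLE N w (C * (a * b * (l⁻¹ * (W ^ 2)⁻¹)))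
        (fun t => nonlinExt n (r ^ 2 + 2 * c * t + t ^ 2) (u t) -
          nonlinExt n (r ^ 2 + 2 * c * t + t ^ 2) (v t)) := by
  have hn5 : (5 : ℝ) ≤ n := by exact_mod_cast hn
  have ha : 0 < √((n : ℝ) - 4) := Real.sqrt_pos.2 (by linarith)
  obtain ⟨C₁, hC₁, hk⟩ := exists_jetLE_kernels N B hB
  obtain ⟨C₂, hC₂, hc⟩ := exists_jetLE_coeff _ ha N
  refine ⟨|(n : ℝ) - 3| * (2 ^ N * (C₂ * (2 ^ N * (C₁ * C₁))) +
    2 ^ N * (C₂ * (C₁ + |2| * (2 ^ N * (C₁ * (2 ^ N * (C₁ * C₁))))))), by positivity,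
    fun w r c l W a b u v hr hcr hl hw hab hbB hd hs => ?_⟩
  have hj := hw.toJetWeight
  have ha0 := hd.coeff_nonneg hw
  have hb0 := hs.coeff_nonneg hw
  have hl0 := hw.l_pos
  have hW := hw.W_pos
  have hz : Adm N w l W b (fun t => (u t + v t) / 2) := by
    have e : (fun t => (u t + v t) / 2) = fun t => (1 / 2 : ℝ) * (u t + v t) := by
      ext t; ring
    rw [e]
    refine ⟨contDiffAt_const.mul hs.smooth, ?_, fun j h1 h2 => ?_⟩
    · rw [abs_mul]
      refine (mul_le_of_le_one_left (abs_nonneg _) ?_).trans hs.value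
      rw [abs_of_pos] <;> norm_num
    · rw [iteratedDeriv_const_mul _ (ContDiffAt.of_infty hs.smooth j), abs_mul]
      refine (mul_le_of_le_one_left (abs_nonneg _) ?_).trans (hs.deriv j h1 h2)
      rw [abs_of_pos] <;> norm_num
  obtain ⟨-, hKd, hRd⟩ := hk w r c l W a _ hr hcr hl hw hd (hab.trans hbB)
  obtain ⟨-, hKs, -⟩ := hk w r c l W b _ hr hcr hl hw hs hbB
  -- In the square of the kernel at (u + v)/2 one factor is estimated by l⁻¹ and the other by b/W.
  -- Together with a/W from the kernel at u - v this is again a b l⁻¹ W⁻².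
  obtain ⟨hKz1, hKz2, -⟩ := hk w r c l W b _ hr hcr hl hw hz hbB
  obtain ⟨hc4, hs4⟩ := hc w r c l W hr hcr hl hw
  -- The cubic kernel of u - v gives a²; the assumption a ≤ b puts it into the common form.
  have hR' : JetLE N w (C₁ * (a * b * (l⁻¹ * (W ^ 2)⁻¹)))
      (fun t => cubKer (r ^ 2 + 2 * c * t + t ^ 2) (u t - v t)) := by
    refine hRd.mono hj (mul_le_mul_of_nonneg_left ?_ hC₁)
    calc (a / W) ^ 2 * l⁻¹ = a * a * (l⁻¹ * (W ^ 2)⁻¹) := by field_simp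
      _ ≤ _ := by gcongr
  have hmain := (((hs4.mul hj (hKd.mul hj hKs)).add
    (hc4.mul hj (hR'.add ((hKd.mul hj (hKz1.mul hj hKz2)).const_mul 2)))).const_mul ((n : ℝ) - 3))
  refine (hmain.mono hj (le_of_eq ?_)).congr (Eventually.of_forall fun t => ?_)
  · field_simp
  · have hq : 0 ≤ r ^ 2 + 2 * c * t + t ^ 2 := by
      have : c ^ 2 ≤ r ^ 2 := sq_le_sq' (by linarith [abs_le.1 hcr]) (abs_le.1 hcr).2
      nlinarith [sq_nonneg (c + t)]
    simp only [nonlinExt_sub n hq]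
    ring

/-! ### Decay of the Fourier transform of the unit sphere -/

noncomputable section

/-- The rotation invariant measure on the unit sphere, obtained by radial projection of the
unit ball. -/
def sphMeasure (n : ℕ) : Measure (Sp n) :=
  (volume.restrict (Metric.ball (0 : Sp n) 1)).map (fun y => ‖y‖⁻¹ • y)

theorem measurable_radialProj (n : ℕ) : Measurable (fun y : Sp n => ‖y‖⁻¹ • y) :=
  measurable_norm.inv.smul measurable_id

instance instFiniteSph (n : ℕ) : IsFiniteMeasure (sphMeasure n) := by
  have : IsFiniteMeasure (volume.restrict (Metric.ball (0 : Sp n) 1)) :=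
    ⟨by rw [Measure.restrict_apply_univ]; exact measure_ball_lt_top⟩
  unfold sphMeasure
  infer_instance

theorem sphMeasure_univ_pos (n : ℕ) : 0 < (sphMeasure n).real Set.univ := by
  rw [Measure.real, ENNReal.toReal_pos_iff]
  refine ⟨?_, measure_lt_top _ _⟩
  rw [sphMeasure, Measure.map_apply (measurable_radialProj n) MeasurableSet.univ,
    Set.preimage_univ, Measure.restrict_apply_univ]
  exact Metric.measure_ball_pos _ _ one_pos

theorem ae_sphMeasure_norm {n : ℕ} (hn : 0 < n) : ∀ᵐ σ ∂(sphMeasure n), ‖σ‖ = 1 := by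
  have : Nontrivial (Sp n) := by
    have : Nonempty (Fin n) := ⟨⟨0, hn⟩⟩
    infer_instance
  rw [sphMeasure, ae_map_iff (measurable_radialProj n).aemeasurable
    (measurableSet_eq_fun measurable_norm measurable_const)]
  refine ae_restrict_of_ae ?_
  have h0 : ∀ᵐ y : Sp n, y ≠ 0 := by
    rw [ae_iff]
    simp
  filter_upwards [h0] with y hy
  rw [norm_smul, norm_inv, norm_norm, inv_mul_cancel₀ (norm_ne_zero_iff.2 hy)]

theorem integral_sphMeasure_comp {n : ℕ} {G : Type*} [NormedAddCommGroup G] [NormedSpace ℝ G]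
    (A : Sp n ≃ₗᵢ[ℝ] Sp n) (F : Sp n → G) :
    ∫ σ, F (A σ) ∂(sphMeasure n) = ∫ σ, F σ ∂(sphMeasure n) := by
  have hA : MeasurePreserving A (sphMeasure n) (sphMeasure n) := by
    refine ⟨A.continuous.measurable, ?_⟩
    rw [sphMeasure, Measure.map_map A.continuous.measurable (measurable_radialProj n)]
    have hc : (A ∘ fun y : Sp n => ‖y‖⁻¹ • y) = (fun y : Sp n => ‖y‖⁻¹ • y) ∘ A := by
      ext1 y
      simp
    rw [hc, ← Measure.map_map (measurable_radialProj n) A.continuous.measurable]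
    congr 1
    have h := (A.measurePreserving).restrict_preimage
      (Metric.isOpen_ball (x := (0 : Sp n)) (ε := 1)).measurableSet
    have hp : A ⁻¹' (Metric.ball (0 : Sp n) 1) = Metric.ball 0 1 := by
      ext y
      simp
    rw [hp] at h
    exact h.map_eq
  exact hA.integral_comp A.toHomeomorph.measurableEmbedding F

theorem exists_isometry_map_eq {n : ℕ} {x y : Sp n} (h : ‖x‖ = ‖y‖) :
    ∃ A : Sp n ≃ₗᵢ[ℝ] Sp n, A x = y :=
  ⟨(ℝ ∙ (x - y))ᗮ.reflection, Submodule.reflection_sub h⟩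

/-- A function of `⟪x, σ⟫` integrates over the sphere to a radial function of `x`. -/
theorem integral_sph_inner_radial {n : ℕ} {G : Type*} [NormedAddCommGroup G] [NormedSpace ℝ G]
    (F : ℝ → G) {x y : Sp n} (h : ‖x‖ = ‖y‖) :
    ∫ σ, F (inner ℝ x σ) ∂(sphMeasure n) = ∫ σ, F (inner ℝ y σ) ∂(sphMeasure n) := by
  obtain ⟨A, rfl⟩ := exists_isometry_map_eq h
  rw [← integral_sphMeasure_comp A (fun σ => F (inner ℝ (A x) σ))]
  simp only [LinearIsometryEquiv.inner_map_map]

/-- Differentiation under the integral over a finite measure. -/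
theorem hasDerivAt_integral_of_bounded {α G : Type*} [MeasurableSpace α] {ν : Measure α}
    [IsFiniteMeasure ν] [NormedAddCommGroup G] [NormedSpace ℝ G] [CompleteSpace G]
    {F F' : ℝ → α → G} {C D : ℝ}
    (hm : ∀ t, AEStronglyMeasurable (F t) ν) (hm' : ∀ t, AEStronglyMeasurable (F' t) ν)
    (hb : ∀ t, ∀ᵐ σ ∂ν, ‖F t σ‖ ≤ D) (hb' : ∀ᵐ σ ∂ν, ∀ t, ‖F' t σ‖ ≤ C)
    (hd : ∀ σ t, HasDerivAt (fun s => F s σ) (F' t σ) t) (t : ℝ) :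
    HasDerivAt (fun s => ∫ σ, F s σ ∂ν) (∫ σ, F' t σ ∂ν) t :=
  (hasDerivAt_integral_of_dominated_loc_of_deriv_le (s := Set.univ) (bound := fun _ => C)
    Filter.univ_mem (Eventually.of_forall hm) (Integrable.of_bound (hm t) D (hb t)) (hm' t)
    (hb'.mono fun _ h s _ => h s) (integrable_const C)
    (Eventually.of_forall fun σ s _ => hd σ s)).2

variable {n : ℕ}

theorem ae_abs_coord_le (i : Fin n) : ∀ᵐ σ ∂(sphMeasure n), |σ i| ≤ 1 := by
  filter_upwards [ae_sphMeasure_norm (Fin.pos i)] with σ hσ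
  rw [← hσ, ← Real.norm_eq_abs]
  exact PiLp.norm_apply_le σ i

/-- The spherical averages of `σ_i ^ 0, 1, 2` against `cos, sin` of `t σ_i`. -/
def sphCos (i : Fin n) (t : ℝ) : ℝ := ∫ σ, Real.cos (t * σ i) ∂(sphMeasure n)

/-- The derivative of `sphCos`. -/
def sphCos1 (i : Fin n) (t : ℝ) : ℝ := ∫ σ, -Real.sin (t * σ i) * σ i ∂(sphMeasure n)

/-- The second derivative of `sphCos`. -/
def sphCos2 (i : Fin n) (t : ℝ) : ℝ := ∫ σ, -(Real.cos (t * σ i) * σ i) * σ i ∂(sphMeasure n)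

theorem hasDerivAt_sphCos (i : Fin n) (t : ℝ) : HasDerivAt (sphCos i) (sphCos1 i t) t := by
  refine hasDerivAt_integral_of_bounded (C := 1) (D := 1)
    (F := fun t (σ : Sp n) => Real.cos (t * σ i)) (F' := fun t (σ : Sp n) => -Real.sin (t * σ i) * σ i)
    (fun t => ?_) (fun t => ?_) (fun t => ?_) ?_ ?_ t
  · exact Continuous.aestronglyMeasurable (by fun_prop)
  · exact Continuous.aestronglyMeasurable (by fun_prop)
  · exact Eventually.of_forall fun σ => Real.abs_cos_le_one _
  · filter_upwards [ae_abs_coord_le i] with σ hσ s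
    rw [norm_mul, norm_neg]
    exact mul_le_one₀ (Real.abs_sin_le_one _) (norm_nonneg _) hσ
  · intro σ s
    have h : HasDerivAt (fun s : ℝ => s * σ i) (σ i) s := by
      simpa using (hasDerivAt_id s).mul_const (σ i)
    exact h.cos

theorem hasDerivAt_sphCos1 (i : Fin n) (t : ℝ) : HasDerivAt (sphCos1 i) (sphCos2 i t) t := by
  refine hasDerivAt_integral_of_bounded (C := 1) (D := 1)
    (F := fun t (σ : Sp n) => -Real.sin (t * σ i) * σ i)
    (F' := fun t (σ : Sp n) => -(Real.cos (t * σ i) * σ i) * σ i)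
    (fun t => ?_) (fun t => ?_) (fun t => ?_) ?_ ?_ t
  · exact Continuous.aestronglyMeasurable (by fun_prop)
  · exact Continuous.aestronglyMeasurable (by fun_prop)
  · filter_upwards [ae_abs_coord_le i] with σ hσ
    rw [norm_mul, norm_neg]
    exact mul_le_one₀ (Real.abs_sin_le_one _) (norm_nonneg _) hσ
  · filter_upwards [ae_abs_coord_le i] with σ hσ s
    rw [norm_mul, norm_neg, norm_mul]
    exact mul_le_one₀ (mul_le_one₀ (Real.abs_cos_le_one _) (norm_nonneg _) hσ) (norm_nonneg _) hσ
  · intro σ s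
    have h : HasDerivAt (fun s : ℝ => s * σ i) (σ i) s := by
      simpa using (hasDerivAt_id s).mul_const (σ i)
    exact h.sin.neg.mul_const _

/-- Infinitesimal rotation in the plane of the coordinates `i, l`. -/
theorem integral_sph_rotation {i l : Fin n} (hil : i ≠ l) (t : ℝ) :
    ∫ σ, (Real.sin (t * σ i) * (t * σ i) - Real.cos (t * σ i) * (t * σ l) * (t * σ l))
      ∂(sphMeasure n) = 0 := by
  -- `α θ` is t times the i-th coordinate after a rotation by θ in the (i, l)-plane, and `β θ` is
  -- its derivative in θ. The spherical average of cos (α θ) does not depend on θ; the identity is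
  -- its vanishing second derivative at θ = 0.
  set α : ℝ → Sp n → ℝ := fun θ σ => t * (Real.cos θ * σ i + Real.sin θ * σ l) with hα
  set β : ℝ → Sp n → ℝ := fun θ σ => t * (-Real.sin θ * σ i + Real.cos θ * σ l) with hβ
  have hαd : ∀ σ θ, HasDerivAt (fun s => α s σ) (β θ σ) θ := fun σ θ =>
    (((Real.hasDerivAt_cos θ).mul_const (σ i)).add
      ((Real.hasDerivAt_sin θ).mul_const (σ l))).const_mul t
  have hβd : ∀ σ θ, HasDerivAt (fun s => β s σ) (-α θ σ) θ := fun σ θ =>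
    ((((Real.hasDerivAt_sin θ).neg.mul_const (σ i)).add
      ((Real.hasDerivAt_cos θ).mul_const (σ l))).const_mul t).congr_deriv (by simp only [hα]; ring)
  have hαb : ∀ᵐ σ ∂(sphMeasure n), ∀ θ, |α θ σ| ≤ |t| * 2 := by
    filter_upwards [ae_abs_coord_le i, ae_abs_coord_le l] with σ h1 h2 θ
    rw [hα, abs_mul]
    refine mul_le_mul_of_nonneg_left ((abs_add_le _ _).trans ?_) (abs_nonneg _)
    rw [abs_mul, abs_mul]
    have := mul_le_one₀ (Real.abs_cos_le_one θ) (abs_nonneg _) h1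
    have := mul_le_one₀ (Real.abs_sin_le_one θ) (abs_nonneg _) h2
    linarith
  have hβb : ∀ᵐ σ ∂(sphMeasure n), ∀ θ, |β θ σ| ≤ |t| * 2 := by
    filter_upwards [ae_abs_coord_le i, ae_abs_coord_le l] with σ h1 h2 θ
    rw [hβ, abs_mul]
    refine mul_le_mul_of_nonneg_left ((abs_add_le _ _).trans ?_) (abs_nonneg _)
    rw [abs_mul, abs_mul, abs_neg]
    have := mul_le_one₀ (Real.abs_sin_le_one θ) (abs_nonneg _) h1
    have := mul_le_one₀ (Real.abs_cos_le_one θ) (abs_nonneg _) h2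
    linarith
  have hconst : ∀ θ, ∫ σ, Real.cos (α θ σ) ∂(sphMeasure n) = sphCos i t := by
    intro θ
    have h := integral_sph_inner_radial (n := n) Real.cos
      (x := t • (Real.cos θ • EuclideanSpace.single i 1 + Real.sin θ • EuclideanSpace.single l 1))
      (y := t • EuclideanSpace.single i 1) ?_
    · simp only [inner_smul_left, inner_add_left, EuclideanSpace.inner_single_left, map_one,
        one_mul, conj_trivial] at h
      exact h
    · rw [norm_smul, norm_smul]
      congr 1
      rw [← sq_eq_sq₀ (norm_nonneg _) (norm_nonneg _), norm_add_sq_real]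
      simp [norm_smul, inner_smul_left, inner_smul_right, EuclideanSpace.inner_single_left, hil]
  have h1 : ∀ θ, HasDerivAt (fun s => ∫ σ, Real.cos (α s σ) ∂(sphMeasure n))
      (∫ σ, -Real.sin (α θ σ) * β θ σ ∂(sphMeasure n)) θ := by
    intro θ
    refine hasDerivAt_integral_of_bounded (C := |t| * 2) (D := 1)
      (F := fun t σ => Real.cos (α t σ)) (F' := fun t σ => -Real.sin (α t σ) * β t σ)
      (fun t => ?_) (fun t => ?_) (fun t => ?_) ?_ ?_ θ
    · exact Continuous.aestronglyMeasurable (by fun_prop)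
    · exact Continuous.aestronglyMeasurable (by fun_prop)
    · exact Eventually.of_forall fun σ => Real.abs_cos_le_one _
    · filter_upwards [hβb] with σ hσ s
      rw [norm_mul, norm_neg]
      exact (mul_le_of_le_one_left (norm_nonneg _) (Real.abs_sin_le_one _)).trans (hσ s)
    · exact fun σ s => (hαd σ s).cos
  have h1' : ∀ θ, ∫ σ, -Real.sin (α θ σ) * β θ σ ∂(sphMeasure n) = 0 := by
    intro θ
    have h := h1 θ
    simp only [hconst] at h
    exact h.unique (hasDerivAt_const θ _)
  have h2 : HasDerivAt (fun s => ∫ σ, -Real.sin (α s σ) * β s σ ∂(sphMeasure n))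
      (∫ σ, (-(Real.cos (α 0 σ) * β 0 σ) * β 0 σ + -Real.sin (α 0 σ) * (-α 0 σ))
        ∂(sphMeasure n)) 0 := by
    refine hasDerivAt_integral_of_bounded (C := |t| * 2 * (|t| * 2) + |t| * 2) (D := |t| * 2)
      (F := fun t σ => -Real.sin (α t σ) * β t σ)
      (F' := fun t σ => -(Real.cos (α t σ) * β t σ) * β t σ + -Real.sin (α t σ) * (-α t σ))
      (fun t => ?_) (fun t => ?_) (fun t => ?_) ?_ ?_ 0
    · exact Continuous.aestronglyMeasurable (by fun_prop)
    · exact Continuous.aestronglyMeasurable (by fun_prop)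
    · filter_upwards [hβb] with σ hσ
      rw [norm_mul, norm_neg]
      exact (mul_le_of_le_one_left (norm_nonneg _) (Real.abs_sin_le_one _)).trans (hσ t)
    · filter_upwards [hβb, hαb] with σ hσ1 hσ2 s
      refine (norm_add_le _ _).trans (add_le_add ?_ ?_)
      · rw [norm_mul, norm_neg, norm_mul]
        refine mul_le_mul ?_ (hσ1 s) (norm_nonneg _) (by positivity)
        exact (mul_le_of_le_one_left (norm_nonneg _) (Real.abs_cos_le_one _)).trans (hσ1 s)
      · rw [norm_mul, norm_neg, norm_neg]
        exact (mul_le_of_le_one_left (norm_nonneg _) (Real.abs_sin_le_one _)).trans (hσ2 s)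
    · exact fun σ s => (hαd σ s).sin.neg.mul (hβd σ s)
  simp only [h1'] at h2
  have h3 := h2.unique (hasDerivAt_const 0 _)
  rw [← h3]
  refine integral_congr_ae (Eventually.of_forall fun σ => ?_)
  simp only [hα, hβ, Real.cos_zero, Real.sin_zero]
  ring_nf

theorem integrable_sph_of_bound {f : Sp n → ℝ} {C : ℝ} (hf : Continuous f)
    (hb : ∀ᵐ σ ∂(sphMeasure n), |f σ| ≤ C) : Integrable f (sphMeasure n) :=
  Integrable.of_bound hf.aestronglyMeasurable C hb

/-- The Bessel equation of the spherical average. -/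
theorem sphCos_ode (i : Fin n) {t : ℝ} (ht : t ≠ 0) :
    t * sphCos2 i t + ((n : ℝ) - 1) * sphCos1 i t + t * sphCos i t = 0 := by
  -- Summing the rotation identities over l ≠ i and using Σ_{l ≠ i} σ_l² = 1 - σ_i² on the sphere
  -- yields -t times the equation; this is why t ≠ 0 is assumed.
  have hsum : ∑ l ∈ Finset.univ.erase i,
      ∫ σ, (Real.sin (t * σ i) * (t * σ i) - Real.cos (t * σ i) * (t * σ l) * (t * σ l))
        ∂(sphMeasure n) = 0 :=
    Finset.sum_eq_zero fun l hl => integral_sph_rotation (Finset.ne_of_mem_erase hl).symm t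
  have hint : ∀ l, Integrable (fun σ : Sp n =>
      Real.sin (t * σ i) * (t * σ i) - Real.cos (t * σ i) * (t * σ l) * (t * σ l))
      (sphMeasure n) := by
    intro l
    refine integrable_sph_of_bound (C := |t| + |t| * |t|) (by fun_prop) ?_
    filter_upwards [ae_abs_coord_le i, ae_abs_coord_le l] with σ h1 h2
    refine (abs_sub _ _).trans (add_le_add ?_ ?_)
    · rw [abs_mul, abs_mul]
      calc _ ≤ 1 * (|t| * 1) := by gcongr; exact Real.abs_sin_le_one _
        _ = _ := by ring
    · rw [abs_mul, abs_mul, abs_mul]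
      calc _ ≤ 1 * (|t| * 1) * (|t| * 1) := by gcongr; exact Real.abs_cos_le_one _
        _ = _ := by ring
  rw [← integral_finsetSum _ fun l _ => hint l] at hsum
  have hi0 : Integrable (fun σ : Sp n => Real.cos (t * σ i)) (sphMeasure n) :=
    integrable_sph_of_bound (C := 1) (by fun_prop)
      (Eventually.of_forall fun σ => Real.abs_cos_le_one _)
  have hi1 : Integrable (fun σ : Sp n => -Real.sin (t * σ i) * σ i) (sphMeasure n) := by
    refine integrable_sph_of_bound (C := 1) (by fun_prop) ?_
    filter_upwards [ae_abs_coord_le i] with σ hσ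
    rw [abs_mul, abs_neg]
    exact mul_le_one₀ (Real.abs_sin_le_one _) (abs_nonneg _) hσ
  have hi2 : Integrable (fun σ : Sp n => -(Real.cos (t * σ i) * σ i) * σ i) (sphMeasure n) := by
    refine integrable_sph_of_bound (C := 1) (by fun_prop) ?_
    filter_upwards [ae_abs_coord_le i] with σ hσ
    rw [abs_mul, abs_neg, abs_mul]
    exact mul_le_one₀ (mul_le_one₀ (Real.abs_cos_le_one _) (abs_nonneg _) hσ) (abs_nonneg _) hσ
  have key : t * (t * sphCos2 i t + ((n : ℝ) - 1) * sphCos1 i t + t * sphCos i t) =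
      -∫ σ, ∑ l ∈ Finset.univ.erase i,
        (Real.sin (t * σ i) * (t * σ i) - Real.cos (t * σ i) * (t * σ l) * (t * σ l))
        ∂(sphMeasure n) := by
    have hA : Integrable (fun σ : Sp n => t * (-(Real.cos (t * σ i) * σ i) * σ i) +
        ((n : ℝ) - 1) * (-Real.sin (t * σ i) * σ i)) (sphMeasure n) :=
      (hi2.const_mul t).add (hi1.const_mul _)
    unfold sphCos sphCos1 sphCos2
    rw [← integral_const_mul, ← integral_const_mul, ← integral_const_mul,
      ← integral_add (hi2.const_mul t) (hi1.const_mul _),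
      ← integral_add hA (hi0.const_mul t),
      ← integral_const_mul, ← integral_neg]
    refine integral_congr_ae ?_
    filter_upwards [ae_sphMeasure_norm (Fin.pos i)] with σ hσ
    have h1 : ∑ l, σ l ^ 2 = 1 := by
      have := EuclideanSpace.real_norm_sq_eq σ
      rw [hσ] at this
      linarith
    have h2 : ∑ l ∈ Finset.univ.erase i, σ l ^ 2 = 1 - σ i ^ 2 := by
      rw [← h1, ← Finset.add_sum_erase _ _ (Finset.mem_univ i)]
      ring
    have h3 : ∑ l ∈ Finset.univ.erase i, Real.cos (t * σ i) * (t * σ l) * (t * σ l) =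
        Real.cos (t * σ i) * t ^ 2 * (1 - σ i ^ 2) := by
      rw [← h2, Finset.mul_sum]
      exact Finset.sum_congr rfl fun l _ => by ring
    rw [Finset.sum_sub_distrib, h3, Finset.sum_const, Finset.card_erase_of_mem (Finset.mem_univ i),
      Finset.card_univ, Fintype.card_fin, nsmul_eq_mul, Nat.cast_sub (Fin.pos i)]
    push_cast
    ring
  rw [hsum, neg_zero] at key
  exact (mul_eq_zero.1 key).resolve_left ht

/-- Solutions of the Bessel equation decay like `t ^ (-(n - 1) / 2)`. -/
theorem exists_sphCos_decay (hn : 3 ≤ n) (i : Fin n) :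
    ∃ C : ℝ, 0 ≤ C ∧ ∀ t : ℝ, 1 ≤ t → |sphCos i t| ≤ C * t ^ (-(((n : ℝ) - 1) / 2)) := by
  have hn3 : (3 : ℝ) ≤ n := by exact_mod_cast hn
  set m : ℝ := ((n : ℝ) - 1) / 2 with hm
  have hm1 : 1 ≤ m := by rw [hm]; linarith
  set c : ℝ := m * (m - 1) with hc
  have hc0 : 0 ≤ c := mul_nonneg (by linarith) (by linarith)
  -- The factor t^m with m = (n-1)/2 removes the first-order term: h'' = (c/t² - 1) h, where c =
  -- m(m-1) ≥ 0 because n ≥ 3.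
  set h : ℝ → ℝ := fun t => t ^ m * sphCos i t with hh
  set h1 : ℝ → ℝ := fun t => m * t ^ (m - 1) * sphCos i t + t ^ m * sphCos1 i t with hh1
  have hd : ∀ t, 0 < t → HasDerivAt h (h1 t) t := fun t ht =>
    ((Real.hasDerivAt_rpow_const (p := m) (Or.inl ht.ne')).mul (hasDerivAt_sphCos i t))
  have hd1 : ∀ t, 0 < t → HasDerivAt h1 ((c / t ^ 2 - 1) * h t) t := by
    intro t ht
    have e1 : t ^ m = t ^ (m - 2) * t ^ 2 := by
      rw [← Real.rpow_natCast, ← Real.rpow_add ht]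
      norm_num
    have e2 : t ^ (m - 1) = t ^ (m - 2) * t := by
      nth_rewrite 3 [← Real.rpow_one t]
      rw [← Real.rpow_add ht]
      ring_nf
    have h0 := (((Real.hasDerivAt_rpow_const (p := m - 1) (Or.inl ht.ne')).const_mul m).mul
      (hasDerivAt_sphCos i t)).add
      ((Real.hasDerivAt_rpow_const (p := m) (Or.inl ht.ne')).mul (hasDerivAt_sphCos1 i t))
    refine h0.congr_deriv ?_
    have ode := sphCos_ode i ht.ne'
    have ode' : t * sphCos2 i t = -(2 * m) * sphCos1 i t - t * sphCos i t := by
      rw [hm]; linarith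
    rw [show m - 1 - 1 = m - 2 by ring]
    simp only [hh, hc]
    rw [e1, e2]
    field_simp
    linear_combination t * ode'
  -- An energy with an integrating factor: its derivative is -(c/t²) e^(c/t) (h - h')² ≤ 0, so h is
  -- bounded on [1, ∞).
  set G : ℝ → ℝ := fun t => (h t ^ 2 + h1 t ^ 2) * Real.exp (c / t) with hG
  have hGd : ∀ t, 0 < t → HasDerivAt G
      ((2 * h t * h1 t + 2 * h1 t * ((c / t ^ 2 - 1) * h t)) * Real.exp (c / t) +
        (h t ^ 2 + h1 t ^ 2) * (Real.exp (c / t) * (-c / t ^ 2))) t := by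
    intro t ht
    have a1 : HasDerivAt (fun s => h s ^ 2 + h1 s ^ 2)
        (2 * h t * h1 t + 2 * h1 t * ((c / t ^ 2 - 1) * h t)) t := by
      exact (((hd t ht).pow 2).add ((hd1 t ht).pow 2)).congr_deriv (by norm_num)
    have a2 : HasDerivAt (fun s : ℝ => c / s) (-c / t ^ 2) t := by
      exact ((hasDerivAt_const t c).div (hasDerivAt_id t) ht.ne').congr_deriv (by simp)
    exact a1.mul a2.exp
  have hanti : AntitoneOn G (Set.Ici 1) := by
    refine antitoneOn_of_deriv_nonpos (convex_Ici 1) ?_ ?_ ?_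
    · intro t ht
      exact (hGd t (lt_of_lt_of_le one_pos ht)).continuousAt.continuousWithinAt
    · intro t ht
      rw [interior_Ici] at ht
      exact (hGd t (one_pos.trans ht)).differentiableAt.differentiableWithinAt
    · intro t ht
      rw [interior_Ici] at ht
      have ht0 : 0 < t := one_pos.trans ht
      rw [(hGd t ht0).deriv]
      have e : (2 * h t * h1 t + 2 * h1 t * ((c / t ^ 2 - 1) * h t)) * Real.exp (c / t) +
          (h t ^ 2 + h1 t ^ 2) * (Real.exp (c / t) * (-c / t ^ 2)) =
          -(c / t ^ 2 * Real.exp (c / t) * (h t - h1 t) ^ 2) := by ring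
      rw [e]
      exact neg_nonpos.2 (by positivity)
  refine ⟨√(G 1), Real.sqrt_nonneg _, fun t ht => ?_⟩
  have ht0 : 0 < t := by linarith
  have hle : h t ^ 2 ≤ G 1 := by
    refine le_trans ?_ (hanti (Set.mem_Ici.2 le_rfl) (Set.mem_Ici.2 ht) ht)
    have : 1 ≤ Real.exp (c / t) := Real.one_le_exp (by positivity)
    simp only [hG]
    nlinarith [sq_nonneg (h t), sq_nonneg (h1 t)]
  have habs : |h t| ≤ √(G 1) := Real.abs_le_sqrt hle
  have e : sphCos i t = h t * t ^ (-m) := by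
    simp only [hh]
    rw [Real.rpow_neg ht0.le]
    have := (Real.rpow_pos_of_pos ht0 m).ne'
    field_simp
  rw [e, abs_mul, abs_of_pos (Real.rpow_pos_of_pos ht0 _)]
  exact mul_le_mul_of_nonneg_right habs (Real.rpow_pos_of_pos ht0 _).le

/-- The Fourier transform of the sphere and its derivatives in the direction `e`. -/
def sphExp (e : Sp n) (j : ℕ) (x : Sp n) : ℂ :=
  ∫ σ, (Complex.I * (inner ℝ e σ : ℝ)) ^ j * Complex.exp (Complex.I * (inner ℝ x σ : ℝ))
    ∂(sphMeasure n)

theorem norm_exp_I_mul (t : ℝ) : ‖Complex.exp (Complex.I * (t : ℂ))‖ = 1 := by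
  rw [mul_comm]
  exact Complex.norm_exp_ofReal_mul_I t

theorem ae_norm_sphExp_integrand_le (hn : 0 < n) {e : Sp n} (he : ‖e‖ = 1) (j : ℕ) :
    ∀ᵐ σ ∂(sphMeasure n), ∀ x : Sp n,
      ‖(Complex.I * (inner ℝ e σ : ℝ)) ^ j * Complex.exp (Complex.I * (inner ℝ x σ : ℝ))‖ ≤ 1 := by
  filter_upwards [ae_sphMeasure_norm hn] with σ hσ x
  rw [norm_mul, norm_exp_I_mul, mul_one, norm_pow, norm_mul, Complex.norm_I, one_mul,
    Complex.norm_real]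
  refine pow_le_one₀ (norm_nonneg _) ?_
  have := norm_inner_le_norm (𝕜 := ℝ) e σ
  rwa [he, hσ, one_mul] at this

theorem norm_sphExp_le (hn : 0 < n) {e : Sp n} (he : ‖e‖ = 1) (j : ℕ) (x : Sp n) :
    ‖sphExp e j x‖ ≤ (sphMeasure n).real Set.univ := by
  have := norm_integral_le_of_norm_le_const
    ((ae_norm_sphExp_integrand_le hn he j).mono fun σ h => h x)
  simpa [sphExp] using this

theorem hasDerivAt_sphExp (hn : 0 < n) {e : Sp n} (he : ‖e‖ = 1) (j : ℕ) (x : Sp n) (ρ t : ℝ) :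
    HasDerivAt (fun s : ℝ => sphExp e j (ρ • (x + s • e)))
      ((ρ : ℂ) * sphExp e (j + 1) (ρ • (x + t • e))) t := by
  have key : HasDerivAt (fun s : ℝ => sphExp e j (ρ • (x + s • e)))
      (∫ σ, (ρ : ℂ) * ((Complex.I * (inner ℝ e σ : ℝ)) ^ (j + 1) *
        Complex.exp (Complex.I * (inner ℝ (ρ • (x + t • e)) σ : ℝ))) ∂(sphMeasure n)) t := by
    refine hasDerivAt_integral_of_bounded (C := |ρ|) (D := 1)
      (F := fun (s : ℝ) (σ : Sp n) => (Complex.I * (inner ℝ e σ : ℝ)) ^ j *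
        Complex.exp (Complex.I * (inner ℝ (ρ • (x + s • e)) σ : ℝ)))
      (F' := fun (s : ℝ) (σ : Sp n) => (ρ : ℂ) * ((Complex.I * (inner ℝ e σ : ℝ)) ^ (j + 1) *
        Complex.exp (Complex.I * (inner ℝ (ρ • (x + s • e)) σ : ℝ))))
      (fun t => ?_) (fun t => ?_) (fun t => ?_) ?_ ?_ t
    · exact Continuous.aestronglyMeasurable (by fun_prop)
    · exact Continuous.aestronglyMeasurable (by fun_prop)
    · exact (ae_norm_sphExp_integrand_le hn he j).mono fun σ h => h _
    · filter_upwards [ae_norm_sphExp_integrand_le hn he (j + 1)] with σ h s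
      rw [norm_mul, Complex.norm_real]
      exact mul_le_of_le_one_right (norm_nonneg _) (h _)
    · intro σ s
      have h1 : HasDerivAt (fun s : ℝ => (inner ℝ (ρ • (x + s • e)) σ : ℝ)) (ρ * inner ℝ e σ) s := by
        have : (fun s : ℝ => (inner ℝ (ρ • (x + s • e)) σ : ℝ)) =
            fun s : ℝ => ρ * (inner ℝ x σ + s * inner ℝ e σ) := by
          ext s
          simp only [inner_smul_left, inner_add_left, conj_trivial]
        rw [this]
        have h2 := (((hasDerivAt_id s).mul_const (inner ℝ e σ : ℝ)).const_add
          (inner ℝ x σ : ℝ)).const_mul ρ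
        simpa using h2
      have h3 := ((h1.ofReal_comp.const_mul Complex.I).cexp).const_mul
        ((Complex.I * ((inner ℝ e σ : ℝ) : ℂ)) ^ j)
      refine h3.congr_deriv ?_
      push_cast
      ring
  rwa [integral_const_mul] at key

/-- The average is radial in x, so x may be replaced by |x| times a coordinate vector. The sine part
is odd in x and radial, hence zero. -/
theorem sphExp_zero_eq (i : Fin n) (e x : Sp n) : sphExp e 0 x = (sphCos i ‖x‖ : ℂ) := by
  have h : ‖x‖ = ‖‖x‖ • EuclideanSpace.single i (1 : ℝ)‖ := by simp [norm_smul]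
  have h1 := integral_sph_inner_radial (n := n)
    (fun t : ℝ => Complex.exp (Complex.I * (t : ℂ))) h
  have h2 := integral_sph_inner_radial (n := n)
    (fun t : ℝ => Real.sin t) (x := ‖x‖ • EuclideanSpace.single i (1 : ℝ))
    (y := -(‖x‖ • EuclideanSpace.single i (1 : ℝ))) (norm_neg _).symm
  simp only [inner_neg_left, inner_smul_left, EuclideanSpace.inner_single_left, map_one, one_mul,
    conj_trivial, Real.sin_neg, integral_neg] at h1 h2
  have h3 : ∫ σ : Sp n, Real.sin (‖x‖ * σ i) ∂(sphMeasure n) = 0 := by linarith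
  unfold sphExp
  simp only [pow_zero, one_mul]
  rw [h1, sphCos]
  have hc : Integrable (fun σ : Sp n => Real.cos (‖x‖ * σ i)) (sphMeasure n) :=
    integrable_sph_of_bound (C := 1) (by fun_prop)
      (Eventually.of_forall fun _ => Real.abs_cos_le_one _)
  have hs : Integrable (fun σ : Sp n => Real.sin (‖x‖ * σ i)) (sphMeasure n) :=
    integrable_sph_of_bound (C := 1) (by fun_prop)
      (Eventually.of_forall fun _ => Real.abs_sin_le_one _)
  have e1 : ∀ σ : Sp n, Complex.exp (Complex.I * ((‖x‖ * σ i : ℝ) : ℂ)) =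
      ((Real.cos (‖x‖ * σ i) : ℝ) : ℂ) + ((Real.sin (‖x‖ * σ i) : ℝ) : ℂ) * Complex.I := by
    intro σ
    rw [mul_comm, Complex.exp_mul_I, Complex.ofReal_cos, Complex.ofReal_sin]
  simp only [e1]
  rw [integral_add hc.ofReal (hs.ofReal.mul_const _), integral_mul_const, integral_complex_ofReal,
    integral_complex_ofReal, h3]
  simp

theorem sphExp_zero_radial (e : Sp n) {x y : Sp n} (h : ‖x‖ = ‖y‖) :
    sphExp e 0 x = sphExp e 0 y := by
  unfold sphExp
  simpa using integral_sph_inner_radial (n := n)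
    (fun t : ℝ => Complex.exp (Complex.I * (t : ℂ))) h

theorem one_add_rpow_neg_ge {r A : ℝ} (hr : 0 ≤ r) (hA : 0 ≤ A) (h : r ≤ 1) :
    1 ≤ 2 ^ A * (1 + r) ^ (-A) := by
  rw [Real.rpow_neg (by linarith), ← div_eq_mul_inv, one_le_div (by positivity)]
  exact Real.rpow_le_rpow (by linarith) (by linarith) hA

theorem exists_sphExp_zero_decay (hn : 3 ≤ n) (e : Sp n) {A : ℝ} (hA : 0 ≤ A)
    (hA' : A ≤ ((n : ℝ) - 1) / 2) :
    ∃ C : ℝ, 0 ≤ C ∧ ∀ x : Sp n, ‖sphExp e 0 x‖ ≤ C * (1 + ‖x‖) ^ (-A) := by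
  have i : Fin n := ⟨0, by omega⟩
  obtain ⟨C, hC0, hC⟩ := exists_sphCos_decay hn i
  set V := (sphMeasure n).real Set.univ with hV
  have hV0 : 0 ≤ V := measureReal_nonneg
  refine ⟨(V + C) * 2 ^ A, by positivity, fun x => ?_⟩
  have hx := norm_nonneg x
  have hp : 0 ≤ 2 ^ A * (1 + ‖x‖) ^ (-A) := by positivity
  rw [mul_assoc]
  rcases le_total ‖x‖ 1 with h | h
  · have h1 : ‖sphExp e 0 x‖ ≤ V := by
      rw [sphExp]
      have h2 : ∀ᵐ σ ∂(sphMeasure n), ‖(Complex.I * ((inner ℝ e σ : ℝ) : ℂ)) ^ 0 *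
          Complex.exp (Complex.I * ((inner ℝ x σ : ℝ) : ℂ))‖ ≤ 1 :=
        Eventually.of_forall fun σ => by rw [pow_zero, one_mul, norm_exp_I_mul]
      have := norm_integral_le_of_norm_le_const h2
      simpa using this
    have h2 := one_add_rpow_neg_ge hx hA h
    nlinarith
  · rw [sphExp_zero_eq i, Complex.norm_real]
    have hx0 : 0 < ‖x‖ := by linarith
    have h2 : ‖x‖ ^ (-(((n : ℝ) - 1) / 2)) ≤ 2 ^ A * (1 + ‖x‖) ^ (-A) := by
      calc ‖x‖ ^ (-(((n : ℝ) - 1) / 2)) ≤ ‖x‖ ^ (-A) :=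
            Real.rpow_le_rpow_of_exponent_le h (by linarith)
        _ ≤ _ := by
            rw [Real.rpow_neg hx, Real.rpow_neg (by linarith), ← div_eq_mul_inv,
              inv_eq_one_div, div_le_div_iff₀ (by positivity) (by positivity), one_mul,
              ← Real.mul_rpow (by norm_num) hx]
            exact Real.rpow_le_rpow (by linarith) (by linarith) hA
    calc _ ≤ C * ‖x‖ ^ (-(((n : ℝ) - 1) / 2)) := hC _ h
      _ ≤ C * (2 ^ A * (1 + ‖x‖) ^ (-A)) := mul_le_mul_of_nonneg_left h2 hC0
      _ ≤ _ := mul_le_mul_of_nonneg_right (by linarith) hp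

/-- A Schwartz function whose Fourier transform on the sphere of radius `(2π)⁻¹` is the symbol
of the `j`-th derivative in the direction `e`. -/
theorem exists_schwartz_symbol (e : Sp n) (j : ℕ) :
    ∃ κ : 𝓢(Sp n, ℂ), ∀ σ : Sp n, ‖σ‖ = 1 →
      ∫ y, κ y * Complex.exp (-(Complex.I * (inner ℝ y σ : ℝ))) =
        (Complex.I * (inner ℝ e σ : ℝ)) ^ j := by
  -- The cutoff turns the polynomial symbol into a compactly supported smooth function, whose
  -- inverse Fourier transform is Schwartz. It equals 1 on the closed unit ball, which contains the
  -- points σ/(2π) at which the symbol is read off.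
  let χ : ContDiffBump (0 : Sp n) := ⟨1, 2, one_pos, one_lt_two⟩
  set g : Sp n → ℂ := fun ζ => ((χ ζ : ℝ) : ℂ) *
    (2 * Real.pi * Complex.I * (inner ℝ e ζ : ℝ)) ^ j with hg
  have hin : ContDiff ℝ ∞ (fun ζ : Sp n => ((inner ℝ e ζ : ℝ) : ℂ)) :=
    Complex.ofRealCLM.contDiff.comp (contDiff_const.inner ℝ contDiff_id)
  have hgs : ContDiff ℝ ∞ g :=
    (Complex.ofRealCLM.contDiff.comp χ.contDiff).mul ((contDiff_const.mul hin).pow j)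
  have hgc : HasCompactSupport g :=
    (χ.hasCompactSupport.comp_left (g := fun t : ℝ => (t : ℂ)) (by simp)).mul_right
  set G : 𝓢(Sp n, ℂ) := hgc.toSchwartzMap hgs with hG
  refine ⟨𝓕⁻ G, fun σ hσ => ?_⟩
  have h1 : 𝓕 (𝓕⁻ G) ((2 * Real.pi)⁻¹ • σ) = g ((2 * Real.pi)⁻¹ • σ) := by
    rw [FourierTransform.fourier_fourierInv_eq]
    rfl
  have hpi : (0 : ℝ) < 2 * Real.pi := by positivity
  have h2 : χ ((2 * Real.pi)⁻¹ • σ) = 1 := by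
    refine χ.one_of_mem_closedBall ?_
    rw [mem_closedBall_zero_iff, norm_smul, hσ, mul_one, norm_inv, Real.norm_of_nonneg hpi.le]
    exact inv_le_one_of_one_le₀ (by linarith [Real.pi_gt_three])
  have h3 : g ((2 * Real.pi)⁻¹ • σ) = (Complex.I * (inner ℝ e σ : ℝ)) ^ j := by
    simp only [hg, h2, inner_smul_right]
    push_cast
    rw [one_mul]
    congr 1
    have : (Real.pi : ℂ) ≠ 0 := by exact_mod_cast Real.pi_ne_zero
    field_simp
  rw [← h3, ← h1, SchwartzMap.fourier_coe, Real.fourier_eq']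
  refine integral_congr_ae (Eventually.of_forall fun y => ?_)
  simp only [smul_eq_mul, inner_smul_right]
  rw [mul_comm]
  congr 2
  push_cast
  have : (Real.pi : ℂ) ≠ 0 := by exact_mod_cast Real.pi_ne_zero
  field_simp

theorem integrable_schwartz_mul_rpow (κ : 𝓢(Sp n, ℂ)) (A : ℝ) :
    Integrable (fun y => ‖κ y‖ * (1 + ‖y‖) ^ A) := by
  obtain ⟨m, hm⟩ := exists_nat_ge A
  have h0 : Integrable (fun y => ‖κ y‖) := κ.integrable.norm
  have h1 : Integrable (fun y => ‖y‖ ^ m * ‖κ y‖) := κ.integrable_pow_mul volume m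
  refine ((h0.add h1).const_mul (2 ^ m)).mono' ?_ (Eventually.of_forall fun y => ?_)
  · have : Measurable (fun y : Sp n => (1 + ‖y‖) ^ A) :=
      (measurable_const.add measurable_norm).pow_const A
    exact κ.continuous.norm.aestronglyMeasurable.mul this.aestronglyMeasurable
  · have hy := norm_nonneg y
    rw [Real.norm_of_nonneg (by positivity)]
    have h2 : (1 + ‖y‖) ^ A ≤ 2 ^ m * (1 + ‖y‖ ^ m) := by
      calc (1 + ‖y‖) ^ A ≤ (1 + ‖y‖) ^ (m : ℝ) :=
            Real.rpow_le_rpow_of_exponent_le (by linarith) hm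
        _ = (1 + ‖y‖) ^ m := Real.rpow_natCast _ _
        _ ≤ _ := by
            rcases le_total ‖y‖ 1 with h | h
            · calc (1 + ‖y‖) ^ m ≤ 2 ^ m := pow_le_pow_left₀ (by linarith) (by linarith) m
                _ ≤ _ := le_mul_of_one_le_right (by positivity) (by linarith [pow_nonneg hy m])
            · calc (1 + ‖y‖) ^ m ≤ (2 * ‖y‖) ^ m :=
                    pow_le_pow_left₀ (by linarith) (by linarith) m
                _ = 2 ^ m * ‖y‖ ^ m := mul_pow _ _ _
                _ ≤ _ := by gcongr; linarith
    calc _ ≤ ‖κ y‖ * (2 ^ m * (1 + ‖y‖ ^ m)) := mul_le_mul_of_nonneg_left h2 (norm_nonneg _)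
      _ = _ := by simp only [Pi.add_apply]; ring

/-- All derivatives of the Fourier transform of the sphere decay. -/
theorem exists_sphExp_decay (hn : 3 ≤ n) (e : Sp n) (j : ℕ) {A : ℝ} (hA : 0 ≤ A)
    (hA' : A ≤ ((n : ℝ) - 1) / 2) :
    ∃ C : ℝ, 0 ≤ C ∧ ∀ x : Sp n, ‖sphExp e j x‖ ≤ C * (1 + ‖x‖) ^ (-A) := by
  obtain ⟨C, hC0, hC⟩ := exists_sphExp_zero_decay hn e hA hA'
  obtain ⟨κ, hκ⟩ := exists_schwartz_symbol e j
  have hint := integrable_schwartz_mul_rpow κ A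
  refine ⟨∫ y, ‖κ y‖ * (1 + ‖y‖) ^ A * C, integral_nonneg fun y => by positivity, fun x => ?_⟩
  -- On the sphere the symbol of the j-th derivative is the Fourier transform of κ, so
  -- differentiation acts as convolution with a Schwartz function, and polynomial decay survives
  -- convolution.
  have hrep : sphExp e j x = ∫ y, κ y * sphExp e 0 (x - y) := by
    have hprod : Integrable (Function.uncurry fun (y : Sp n) (σ : Sp n) =>
        κ y * Complex.exp (Complex.I * (inner ℝ (x - y) σ : ℝ)))
        (volume.prod (sphMeasure n)) := by
      have h1 : Integrable (fun p : Sp n × Sp n => κ p.1) (volume.prod (sphMeasure n)) :=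
        κ.integrable.comp_fst _
      refine h1.norm.mono' ?_ (Eventually.of_forall fun p => ?_)
      · refine Continuous.aestronglyMeasurable ?_
        have := κ.continuous
        simp only [Function.uncurry_def]
        fun_prop
      · rw [Function.uncurry, norm_mul, norm_exp_I_mul, mul_one]
    have e1 : ∀ y, κ y * sphExp e 0 (x - y) =
        ∫ σ, κ y * Complex.exp (Complex.I * (inner ℝ (x - y) σ : ℝ)) ∂(sphMeasure n) := by
      intro y
      rw [sphExp, ← integral_const_mul]
      simp
    simp only [e1]
    rw [integral_integral_swap hprod]
    refine integral_congr_ae ?_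
    filter_upwards [ae_sphMeasure_norm (n := n) (by omega)] with σ hσ
    rw [← hκ σ hσ, ← integral_mul_const]
    refine integral_congr_ae (Eventually.of_forall fun y => ?_)
    simp only [inner_sub_left]
    rw [mul_assoc, ← Complex.exp_add]
    congr 2
    push_cast
    ring
  rw [hrep, ← integral_mul_const]
  refine norm_integral_le_of_norm_le ((hint.mul_const C).mul_const _)
    (Eventually.of_forall fun y => ?_)
  rw [norm_mul, mul_assoc, mul_assoc]
  refine mul_le_mul_of_nonneg_left ((hC _).trans ?_) (norm_nonneg _)
  rw [mul_left_comm]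
  refine mul_le_mul_of_nonneg_left ?_ hC0
  have hx := norm_nonneg x
  have hy := norm_nonneg y
  have hxy := norm_nonneg (x - y)
  rw [Real.rpow_neg (by linarith), Real.rpow_neg (by linarith), ← div_eq_mul_inv, inv_eq_one_div,
    div_le_div_iff₀ (by positivity) (by positivity), one_mul, ← Real.mul_rpow (by linarith)
    (by linarith)]
  -- Peetre's inequality 1 + |x| ≤ (1 + |x - y|)(1 + |y|).
  refine Real.rpow_le_rpow (by linarith) ?_ hA
  have : ‖x‖ ≤ ‖x - y‖ + ‖y‖ := by simpa using norm_add_le (x - y) y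
  nlinarith

end

/-! ### Weighted L¹ bounds for Fourier transforms of test functions -/

open scoped LineDeriv

noncomputable section

variable {n : ℕ}

/-- A radial test function as a complex Schwartz function. -/
def cplx (f : radialTest n) : 𝓢(Sp n, ℂ) :=
  HasCompactSupport.toSchwartzMap
    (f.2.2.1.comp_left (g := fun t : ℝ => (t : ℂ)) (by simp))
    (Complex.ofRealCLM.contDiff.comp f.2.1)

/-- The Fourier transform of a radial test function, in the normalization of Mathlib. -/
def hat (f : radialTest n) : 𝓢(Sp n, ℂ) := 𝓕 (cplx f)

theorem cplx_apply (f : radialTest n) (x : Sp n) : cplx f x = (((f : Sp n → ℝ) x : ℝ) : ℂ) := rfl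

theorem FT_eq_hat (f : radialTest n) (ξ : Sp n) :
    FT (f : Sp n → ℝ) ξ =
      (((2 * Real.pi) ^ (-(n : ℝ) / 2) : ℝ) : ℂ) * hat f ((2 * Real.pi)⁻¹ • ξ) := rfl

/-- The squared homogeneous Sobolev norm in the normalization of Mathlib. -/
def homSq (r : ℝ) (f : radialTest n) : ℝ := ∫ ζ, ‖ζ‖ ^ (2 * r) * ‖hat f ζ‖ ^ 2

theorem two_pi_pos : (0 : ℝ) < 2 * Real.pi := by positivity

theorem sobInner_eq_homSq (r : ℝ) (f : radialTest n) :
    sobInner r (f : Sp n → ℝ) f = (2 * Real.pi) ^ (2 * r) * homSq r f := by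
  have hpi := two_pi_pos
  set c : ℝ := (2 * Real.pi) ^ (-(n : ℝ) / 2) with hc
  have hG : ∀ ξ : Sp n, ‖ξ‖ ^ (2 * r) *
      (FT (f : Sp n → ℝ) ξ * (starRingEnd ℂ) (FT (f : Sp n → ℝ) ξ)).re =
      (fun ζ : Sp n => (2 * Real.pi) ^ (2 * r) * c ^ 2 * (‖ζ‖ ^ (2 * r) * ‖hat f ζ‖ ^ 2))
        ((2 * Real.pi)⁻¹ • ξ) := by
    intro ξ
    have hw' : (2 * Real.pi) ^ (2 * r) * ‖(2 * Real.pi)⁻¹ • ξ‖ ^ (2 * r) = ‖ξ‖ ^ (2 * r) := by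
      rw [norm_smul, norm_inv, Real.norm_of_nonneg hpi.le,
        ← Real.mul_rpow hpi.le (by positivity), ← mul_assoc, mul_inv_cancel₀ hpi.ne', one_mul]
    rw [Complex.mul_conj, Complex.ofReal_re, Complex.normSq_eq_norm_sq, FT_eq_hat, norm_mul,
      Complex.norm_real, Real.norm_of_nonneg (by positivity), ← hw']
    ring
  unfold sobInner
  simp only [hG]
  rw [Measure.integral_comp_inv_smul_of_nonneg volume (fun ζ : Sp n =>
    (2 * Real.pi) ^ (2 * r) * c ^ 2 * (‖ζ‖ ^ (2 * r) * ‖hat f ζ‖ ^ 2)) hpi.le,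
    integral_const_mul, finrank_euclideanSpace, Fintype.card_fin, smul_eq_mul, homSq]
  have hc2 : (2 * Real.pi) ^ n * c ^ 2 = 1 := by
    rw [hc, ← Real.rpow_natCast, ← Real.rpow_natCast, ← Real.rpow_mul hpi.le, ← Real.rpow_add hpi]
    norm_num
  linear_combination ((2 * Real.pi) ^ (2 * r) * ∫ ζ, ‖ζ‖ ^ (2 * r) * ‖hat f ζ‖ ^ 2) * hc2

theorem exists_hat_bound (f : radialTest n) : ∃ C : ℝ, 0 ≤ C ∧ ∀ ζ, ‖hat f ζ‖ ≤ C := by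
  obtain ⟨C, hC0, hC⟩ := (hat f).decay 0 0
  exact ⟨C, hC0.le, fun ζ => by simpa using hC ζ⟩

theorem integrable_homSq {r : ℝ} (hr : -(n : ℝ) / 2 < r) (f : radialTest n) :
    Integrable (fun ζ => ‖ζ‖ ^ (2 * r) * ‖hat f ζ‖ ^ 2) := by
  obtain ⟨C, hC0, hC⟩ := exists_hat_bound f
  refine ((integrable_weight (r := 2 * r) (by linarith) (hat f)).const_mul C).mono' ?_
    (Eventually.of_forall fun ζ => ?_)
  · have h1 : Measurable (fun ζ : Sp n => ‖ζ‖ ^ (2 * r)) := measurable_norm.pow_const _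
    exact h1.aestronglyMeasurable.mul ((hat f).continuous.norm.pow 2).aestronglyMeasurable
  · rw [Real.norm_of_nonneg (by positivity)]
    have : 0 ≤ ‖ζ‖ ^ (2 * r) := by positivity
    calc ‖ζ‖ ^ (2 * r) * ‖hat f ζ‖ ^ 2 = ‖ζ‖ ^ (2 * r) * (‖hat f ζ‖ * ‖hat f ζ‖) := by ring
      _ ≤ ‖ζ‖ ^ (2 * r) * (C * ‖hat f ζ‖) := by gcongr; exact hC ζ
      _ = _ := by ring

/-- The intersection norm of two homogeneous Sobolev spaces. -/
def interNorm (s k : ℝ) (f : radialTest n) : ℝ :=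
  √(sobInner s (f : Sp n → ℝ) f + sobInner k (f : Sp n → ℝ) f)

theorem interNorm_nonneg (s k : ℝ) (f : radialTest n) : 0 ≤ interNorm s k f := Real.sqrt_nonneg _

theorem interNorm_sq (s k : ℝ) (f : radialTest n) :
    interNorm s k f ^ 2 = sobInner s (f : Sp n → ℝ) f + sobInner k (f : Sp n → ℝ) f :=
  Real.sq_sqrt (add_nonneg (sobInner_self_nonneg _ _) (sobInner_self_nonneg _ _))

/-- Each term of the denominator may be dropped: keeping the power s leaves |ζ|^(-2(s-β)),
integrable at the origin, and keeping k leaves |ζ|^(-2(k-β)), integrable at infinity. -/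
theorem integrable_weight_quotient (hn : 0 < n) {s k β : ℝ} (hs : 2 * (s - β) < n)
    (hk : (n : ℝ) < 2 * (k - β)) :
    Integrable (fun ζ : Sp n => ‖ζ‖ ^ (2 * β) * (‖ζ‖ ^ (2 * s) + ‖ζ‖ ^ (2 * k))⁻¹) := by
  have hmeas : AEStronglyMeasurable
      (fun ζ : Sp n => ‖ζ‖ ^ (2 * β) * (‖ζ‖ ^ (2 * s) + ‖ζ‖ ^ (2 * k))⁻¹) volume := by
    have h : ∀ r : ℝ, Measurable (fun ζ : Sp n => ‖ζ‖ ^ r) := fun r => measurable_norm.pow_const r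
    exact ((h _).mul ((h _).add (h _)).inv).aestronglyMeasurable
  have hle : ∀ (ζ : Sp n) (r : ℝ), 0 < ‖ζ‖ → (r = s ∨ r = k) →
      ‖ζ‖ ^ (2 * β) * (‖ζ‖ ^ (2 * s) + ‖ζ‖ ^ (2 * k))⁻¹ ≤ ‖ζ‖ ^ (-(2 * (r - β))) := by
    intro ζ r hζ hr
    have h1 : 0 < ‖ζ‖ ^ (2 * s) := Real.rpow_pos_of_pos hζ _
    have h2 : 0 < ‖ζ‖ ^ (2 * k) := Real.rpow_pos_of_pos hζ _
    have e : ‖ζ‖ ^ (-(2 * (r - β))) = ‖ζ‖ ^ (2 * β) * (‖ζ‖ ^ (2 * r))⁻¹ := by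
      rw [← Real.rpow_neg hζ.le, ← Real.rpow_add hζ]
      ring_nf
    rw [e]
    refine mul_le_mul_of_nonneg_left ?_ (by positivity)
    rcases hr with rfl | rfl
    · exact inv_anti₀ h1 (by linarith)
    · exact inv_anti₀ h2 (by linarith)
  have hnn : ∀ ζ : Sp n, 0 ≤ ‖ζ‖ ^ (2 * β) * (‖ζ‖ ^ (2 * s) + ‖ζ‖ ^ (2 * k))⁻¹ :=
    fun ζ => by positivity
  have h0 : ∀ᵐ ζ : Sp n, 0 < ‖ζ‖ := by
    have : Nonempty (Fin n) := ⟨⟨0, hn⟩⟩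
    have h0 : ∀ᵐ y : Sp n, y ≠ 0 := by rw [ae_iff]; simp
    filter_upwards [h0] with y hy using norm_pos_iff.2 hy
  have hball : IntegrableOn
      (fun ζ : Sp n => ‖ζ‖ ^ (2 * β) * (‖ζ‖ ^ (2 * s) + ‖ζ‖ ^ (2 * k))⁻¹) (Metric.ball 0 1) := by
    refine integrableOn_ball_of_norm_le_rpow (C := 1) (α := 2 * (s - β)) ?_ ?_ ?_ hmeas
    · rw [finrank_euclideanSpace, Fintype.card_fin]
      exact hn
    · rw [finrank_euclideanSpace, Fintype.card_fin]
      exact hs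
    · filter_upwards [ae_restrict_of_ae h0] with ζ hζ
      rw [Real.norm_of_nonneg (hnn ζ), one_mul]
      exact hle ζ s hζ (Or.inl rfl)
  have hcompl : IntegrableOn
      (fun ζ : Sp n => ‖ζ‖ ^ (2 * β) * (‖ζ‖ ^ (2 * s) + ‖ζ‖ ^ (2 * k))⁻¹)
      (Metric.ball 0 1)ᶜ := by
    have h1 : Integrable (fun ζ : Sp n => (1 + ‖ζ‖) ^ (-(2 * (k - β)))) :=
      integrable_one_add_norm (by rw [finrank_euclideanSpace, Fintype.card_fin]; exact hk)
    refine Integrable.mono' (h1.const_mul (2 ^ (2 * (k - β)))).integrableOn hmeas.restrict ?_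
    filter_upwards [ae_restrict_mem Metric.isOpen_ball.measurableSet.compl] with ζ hζ
    have hζ1 : 1 ≤ ‖ζ‖ := by simpa using hζ
    have hζ0 : 0 < ‖ζ‖ := by linarith
    rw [Real.norm_of_nonneg (hnn ζ)]
    refine (hle ζ k hζ0 (Or.inr rfl)).trans ?_
    rw [Real.rpow_neg hζ0.le, Real.rpow_neg (by linarith), ← div_eq_mul_inv, inv_eq_one_div,
      div_le_div_iff₀ (by positivity) (by positivity), one_mul,
      ← Real.mul_rpow (by norm_num) hζ0.le]
    exact Real.rpow_le_rpow (by linarith) (by linarith)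
      (by linarith [show (0 : ℝ) ≤ n from Nat.cast_nonneg n])
  have := hball.union hcompl
  rwa [Set.union_compl_self, integrableOn_univ] at this

theorem homSq_le_sobInner {s k r : ℝ} (hrs : r = s ∨ r = k) (f : radialTest n) :
    homSq r f ≤ (2 * Real.pi) ^ (-(2 * r)) * interNorm s k f ^ 2 := by
  have hp : 0 < (2 * Real.pi) ^ (2 * r) := Real.rpow_pos_of_pos two_pi_pos _
  rw [Real.rpow_neg two_pi_pos.le, ← div_eq_inv_mul, le_div_iff₀ hp, mul_comm,
    ← sobInner_eq_homSq, interNorm_sq]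
  have h1 := sobInner_self_nonneg s (f : Sp n → ℝ)
  have h2 := sobInner_self_nonneg k (f : Sp n → ℝ)
  rcases hrs with rfl | rfl <;> linarith

/-- Weighted `L¹` bounds of the Fourier transform. -/
theorem exists_integral_hat_le (hn : 0 < n) {s k β : ℝ} (hs0 : -(n : ℝ) / 2 < s)
    (hk0 : -(n : ℝ) / 2 < k) (hs : 2 * (s - β) < n) (hk : (n : ℝ) < 2 * (k - β)) :
    ∃ C : ℝ, 0 ≤ C ∧ ∀ f : radialTest n,
      Integrable (fun ζ => ‖ζ‖ ^ β * ‖hat f ζ‖) ∧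
      ∫ ζ, ‖ζ‖ ^ β * ‖hat f ζ‖ ≤ C * interNorm s k f := by
  have hQ := integrable_weight_quotient hn hs hk
  set Q : ℝ := ∫ ζ : Sp n, ‖ζ‖ ^ (2 * β) * (‖ζ‖ ^ (2 * s) + ‖ζ‖ ^ (2 * k))⁻¹ with hQd
  have hQ0 : 0 ≤ Q := integral_nonneg fun ζ => by positivity
  set c : ℝ := (2 * Real.pi) ^ (-(2 * s)) + (2 * Real.pi) ^ (-(2 * k)) with hc
  have hc0 : 0 ≤ c := by have := two_pi_pos; positivity
  refine ⟨√c * √Q, by positivity, fun f => ?_⟩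
  set w : Sp n → ℝ := fun ζ => ‖ζ‖ ^ (2 * s) + ‖ζ‖ ^ (2 * k) with hw
  have hw0 : ∀ ζ, 0 ≤ w ζ := fun ζ => by simp only [hw]; positivity
  have hwm : Measurable w :=
    (measurable_norm.pow_const _).add (measurable_norm.pow_const _)
  have hP : Integrable (fun ζ => w ζ * ‖hat f ζ‖ ^ 2) := by
    simp only [hw, add_mul]
    exact (integrable_homSq hs0 f).add (integrable_homSq hk0 f)
  have hPv : ∫ ζ, w ζ * ‖hat f ζ‖ ^ 2 ≤ c * interNorm s k f ^ 2 := by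
    simp only [hw, add_mul]
    rw [integral_add (integrable_homSq hs0 f) (integrable_homSq hk0 f), hc, add_mul]
    exact add_le_add (homSq_le_sobInner (Or.inl rfl) f) (homSq_le_sobInner (Or.inr rfl) f)
  -- Cauchy-Schwarz with the weight w of the intersection norm, split as (√w |f̂|) · (|ζ|^β / √w).
  set F : Sp n → ℝ := fun ζ => √(w ζ) * ‖hat f ζ‖ with hF
  set G : Sp n → ℝ := fun ζ => ‖ζ‖ ^ β * √((w ζ)⁻¹) with hG
  have hFsq : ∀ ζ, F ζ ^ 2 = w ζ * ‖hat f ζ‖ ^ 2 := fun ζ => by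
    simp only [hF]; rw [mul_pow, Real.sq_sqrt (hw0 ζ)]
  have hGsq : ∀ ζ, G ζ ^ 2 = ‖ζ‖ ^ (2 * β) * (‖ζ‖ ^ (2 * s) + ‖ζ‖ ^ (2 * k))⁻¹ := fun ζ => by
    simp only [hG]
    rw [mul_pow, Real.sq_sqrt (inv_nonneg.2 (hw0 ζ)), ← Real.rpow_natCast,
      ← Real.rpow_mul (norm_nonneg _), mul_comm β]
    norm_num
    left; rfl
  have hFm : AEStronglyMeasurable F volume :=
    hwm.sqrt.aestronglyMeasurable.mul (hat f).continuous.norm.aestronglyMeasurable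
  have hGm : AEStronglyMeasurable G volume :=
    ((measurable_norm.pow_const β).mul hwm.inv.sqrt).aestronglyMeasurable
  have hF2 : MemLp F 2 volume := (memLp_two_iff_integrable_sq hFm).2 (by simpa only [hFsq] using hP)
  have hG2 : MemLp G 2 volume := (memLp_two_iff_integrable_sq hGm).2 (by simpa only [hGsq] using hQ)
  have hFG : (fun ζ => F ζ * G ζ) =ᵐ[volume] fun ζ => ‖ζ‖ ^ β * ‖hat f ζ‖ := by
    have : Nonempty (Fin n) := ⟨⟨0, hn⟩⟩
    have h0 : ∀ᵐ y : Sp n, y ≠ 0 := by rw [ae_iff]; simp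
    filter_upwards [h0] with ζ hζ
    have hpos : 0 < w ζ := by
      have := norm_pos_iff.2 hζ
      simp only [hw]; positivity
    simp only [hF, hG]
    have : √(w ζ) * √((w ζ)⁻¹) = 1 := by
      rw [← Real.sqrt_mul hpos.le, mul_inv_cancel₀ hpos.ne', Real.sqrt_one]
    linear_combination ‖hat f ζ‖ * ‖ζ‖ ^ β * this
  refine ⟨(hF2.integrable_mul hG2).congr hFG, ?_⟩
  have hCS := integral_mul_le_Lp_mul_Lq_of_nonneg Real.HolderConjugate.two_two
    (μ := (volume : Measure (Sp n))) (f := F) (g := G)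
    (Eventually.of_forall fun ζ => by simp only [hF]; positivity)
    (Eventually.of_forall fun ζ => by simp only [hG]; positivity)
    (by simpa using hF2) (by simpa using hG2)
  rw [integral_congr_ae hFG] at hCS
  refine hCS.trans ?_
  have e1 : ∫ ζ, F ζ ^ (2 : ℝ) = ∫ ζ, w ζ * ‖hat f ζ‖ ^ 2 := by
    refine integral_congr_ae (Eventually.of_forall fun ζ => ?_)
    simp only [← hFsq]; norm_num
  have e2 : ∫ ζ, G ζ ^ (2 : ℝ) = Q := by
    refine integral_congr_ae (Eventually.of_forall fun ζ => ?_)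
    simp only [← hGsq]; norm_num
  rw [e1, e2, ← Real.sqrt_eq_rpow, ← Real.sqrt_eq_rpow]
  have h3 : √(∫ ζ, w ζ * ‖hat f ζ‖ ^ 2) ≤ √c * interNorm s k f := by
    calc _ ≤ √(c * interNorm s k f ^ 2) := Real.sqrt_le_sqrt hPv
      _ = _ := by rw [Real.sqrt_mul hc0, Real.sqrt_sq (interNorm_nonneg _ _ _)]
  calc _ ≤ √c * interNorm s k f * √Q := mul_le_mul_of_nonneg_right h3 (Real.sqrt_nonneg _)
    _ = _ := by ring

end

/-! ### Pointwise decay of derivatives of radial functions -/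

open scoped LineDeriv

noncomputable section

variable {n : ℕ}

/-- The `j`-th derivative of `u` at `x` in the direction `e`. -/
def dirD (e : Sp n) (j : ℕ) (u : Sp n → ℝ) (x : Sp n) : ℝ :=
  iteratedDeriv j (fun t : ℝ => u (x + t • e)) 0

theorem contDiff_line (f : radialTest n) (e x : Sp n) :
    ContDiff ℝ ∞ (fun t : ℝ => (f : Sp n → ℝ) (x + t • e)) :=
  f.2.1.comp (contDiff_const.add (contDiff_id.smul contDiff_const))

theorem iteratedDeriv_line (u : Sp n → ℝ) (e x : Sp n) (j : ℕ) (t : ℝ) :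
    iteratedDeriv j (fun s : ℝ => u (x + s • e)) t = dirD e j u (x + t • e) := by
  have h := congrFun (iteratedDeriv_comp_add_const j (fun s : ℝ => u (x + s • e)) t) 0
  simp only [zero_add] at h
  rw [← h, dirD]
  congr 2
  ext s
  rw [add_smul]
  congr 1
  abel

theorem fourier_inversion_line (f : radialTest n) (y : Sp n) :
    (((f : Sp n → ℝ) y : ℝ) : ℂ) =
      ∫ ζ, hat f ζ * Complex.exp (2 * Real.pi * Complex.I * (inner ℝ ζ y : ℝ)) := by
  have h : 𝓕⁻ (hat f) y = cplx f y := by rw [hat, FourierTransform.fourierInv_fourier_eq]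
  rw [← cplx_apply, ← h, SchwartzMap.fourierInv_coe, Real.fourierInv_eq']
  refine integral_congr_ae (Eventually.of_forall fun ζ => ?_)
  simp only [smul_eq_mul]
  rw [mul_comm]
  congr 2
  push_cast
  ring

/-- A radial test function is a superposition of Fourier transforms of spheres. -/
theorem radial_eq_integral_sphExp (hn : 0 < n) (f : radialTest n) (e x : Sp n) :
    ((sphMeasure n).real Set.univ : ℂ) * (((f : Sp n → ℝ) x : ℝ) : ℂ) =
      ∫ ζ, hat f ζ * sphExp e 0 ((2 * Real.pi * ‖ζ‖) • x) := by
  -- A radial function equals its mean over the sphere of radius |x|; Fourier inversion is then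
  -- applied under the mean.
  have h1 : ((sphMeasure n).real Set.univ : ℂ) * (((f : Sp n → ℝ) x : ℝ) : ℂ) =
      ∫ σ, (((f : Sp n → ℝ) (‖x‖ • σ) : ℝ) : ℂ) ∂(sphMeasure n) := by
    have h2 : ∫ σ, (((f : Sp n → ℝ) (‖x‖ • σ) : ℝ) : ℂ) ∂(sphMeasure n) =
        ∫ _, (((f : Sp n → ℝ) x : ℝ) : ℂ) ∂(sphMeasure n) := by
      refine integral_congr_ae ?_
      filter_upwards [ae_sphMeasure_norm hn] with σ hσ
      rw [f.2.2.2 (‖x‖ • σ) x (by rw [norm_smul, norm_norm, hσ, mul_one])]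
    rw [h2, integral_const]
    simp
  have hprod : Integrable (Function.uncurry fun (σ ζ : Sp n) =>
      hat f ζ * Complex.exp (2 * Real.pi * Complex.I * (inner ℝ ζ (‖x‖ • σ) : ℝ)))
      ((sphMeasure n).prod volume) := by
    have h1 : Integrable (fun p : Sp n × Sp n => hat f p.2) ((sphMeasure n).prod volume) :=
      (hat f).integrable.comp_snd _
    refine h1.norm.mono' ?_ (Eventually.of_forall fun p => ?_)
    · refine Continuous.aestronglyMeasurable ?_
      have := (hat f).continuous
      simp only [Function.uncurry_def]
      fun_prop
    · have : (2 * Real.pi * Complex.I * ((inner ℝ p.2 (‖x‖ • p.1) : ℝ) : ℂ)) =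
          Complex.I * ((2 * Real.pi * inner ℝ p.2 (‖x‖ • p.1) : ℝ) : ℂ) := by push_cast; ring
      rw [Function.uncurry, norm_mul, this, norm_exp_I_mul, mul_one]
  rw [h1]
  simp only [fourier_inversion_line]
  rw [integral_integral_swap hprod]
  refine integral_congr_ae (Eventually.of_forall fun ζ => ?_)
  simp only
  rw [integral_const_mul]
  congr 1
  -- The inner integral is the transform of the sphere at 2π|x|ζ. By radiality the norm is moved
  -- from x to ζ, after which the argument is linear in x and can be differentiated along lines.
  have hr : ‖(2 * Real.pi * ‖ζ‖) • x‖ = ‖(2 * Real.pi * ‖x‖) • ζ‖ := by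
    rw [norm_smul, norm_smul, norm_mul, norm_mul (2 * Real.pi), norm_norm, norm_norm]
    ring
  rw [sphExp_zero_radial e hr, sphExp]
  refine integral_congr_ae (Eventually.of_forall fun σ => ?_)
  simp only [pow_zero, one_mul, inner_smul_left, inner_smul_right, conj_trivial]
  congr 1
  push_cast
  ring

theorem integrable_norm_pow_mul_hat (f : radialTest n) (j : ℕ) :
    Integrable (fun ζ => ‖ζ‖ ^ j * ‖hat f ζ‖) := (hat f).integrable_pow_mul volume j

theorem continuous_sphExp (hn : 0 < n) {e : Sp n} (he : ‖e‖ = 1) (j : ℕ) :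
    Continuous (sphExp e j) := by
  refine continuous_of_dominated (bound := fun _ => 1) (fun x => ?_) (fun x => ?_)
    (integrable_const 1) (Eventually.of_forall fun σ => ?_)
  · exact Continuous.aestronglyMeasurable (by fun_prop)
  · exact (ae_norm_sphExp_integrand_le hn he j).mono fun σ h => h x
  · fun_prop

/-- The derivatives of a radial test function in terms of its Fourier transform. -/
theorem dirD_eq_integral_sphExp (hn : 0 < n) (f : radialTest n) {e : Sp n} (he : ‖e‖ = 1)
    (j : ℕ) (x : Sp n) :
    ((sphMeasure n).real Set.univ : ℂ) * ((dirD e j (f : Sp n → ℝ) x : ℝ) : ℂ) =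
      ∫ ζ, hat f ζ * ((2 * Real.pi * ‖ζ‖ : ℝ) : ℂ) ^ j *
        sphExp e j ((2 * Real.pi * ‖ζ‖) • x) := by
  induction j generalizing x with
  | zero => simpa [dirD] using radial_eq_integral_sphExp hn f e x
  | succ j ih =>
    set V := (sphMeasure n).real Set.univ with hV
    have h1 : HasDerivAt (fun t : ℝ => (V : ℂ) * ((dirD e j (f : Sp n → ℝ) (x + t • e) : ℝ) : ℂ))
        ((V : ℂ) * ((dirD e (j + 1) (f : Sp n → ℝ) x : ℝ) : ℂ)) 0 := by
      refine HasDerivAt.const_mul _ (HasDerivAt.ofReal_comp ?_)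
      simp only [← iteratedDeriv_line]
      have hd : Differentiable ℝ (iteratedDeriv j fun t : ℝ => (f : Sp n → ℝ) (x + t • e)) :=
        (contDiff_line f e x).differentiable_iteratedDeriv j (by exact_mod_cast WithTop.coe_lt_top _)
      have h := (hd 0).hasDerivAt
      rwa [← iteratedDeriv_succ] at h
    have h2 : HasDerivAt (fun t : ℝ => ∫ ζ, hat f ζ * ((2 * Real.pi * ‖ζ‖ : ℝ) : ℂ) ^ j *
        sphExp e j ((2 * Real.pi * ‖ζ‖) • (x + t • e)))
        (∫ ζ, hat f ζ * ((2 * Real.pi * ‖ζ‖ : ℝ) : ℂ) ^ (j + 1) *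
        sphExp e (j + 1) ((2 * Real.pi * ‖ζ‖) • (x + (0 : ℝ) • e))) 0 := by
      have hcs := continuous_sphExp hn he j
      have hcs1 := continuous_sphExp hn he (j + 1)
      have hch := (hat f).continuous
      have hnorm : ∀ (l : ℕ) (ζ y : Sp n), ‖hat f ζ * ((2 * Real.pi * ‖ζ‖ : ℝ) : ℂ) ^ l *
          sphExp e l ((2 * Real.pi * ‖ζ‖) • y)‖ ≤
          (2 * Real.pi) ^ l * V * (‖ζ‖ ^ l * ‖hat f ζ‖) := by
        intro l ζ y
        have h0 : (0 : ℝ) ≤ 2 * Real.pi * ‖ζ‖ := mul_nonneg two_pi_pos.le (norm_nonneg _)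
        rw [norm_mul, norm_mul, norm_pow, Complex.norm_real, Real.norm_of_nonneg h0]
        calc _ ≤ ‖hat f ζ‖ * (2 * Real.pi * ‖ζ‖) ^ l * V :=
              mul_le_mul_of_nonneg_left (norm_sphExp_le hn he l _) (by positivity)
          _ = _ := by rw [mul_pow]; ring
      have := hasDerivAt_integral_of_dominated_loc_of_deriv_le (μ := (volume : Measure (Sp n)))
        (s := Set.univ)
        (F := fun (t : ℝ) ζ => hat f ζ * ((2 * Real.pi * ‖ζ‖ : ℝ) : ℂ) ^ j *
          sphExp e j ((2 * Real.pi * ‖ζ‖) • (x + t • e)))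
        (F' := fun (t : ℝ) ζ => hat f ζ * ((2 * Real.pi * ‖ζ‖ : ℝ) : ℂ) ^ (j + 1) *
          sphExp e (j + 1) ((2 * Real.pi * ‖ζ‖) • (x + t • e))) (x₀ := 0)
        (bound := fun ζ => (2 * Real.pi) ^ (j + 1) * V * (‖ζ‖ ^ (j + 1) * ‖hat f ζ‖))
        Filter.univ_mem
        (Eventually.of_forall fun t => Continuous.aestronglyMeasurable (by fun_prop))
        (((integrable_norm_pow_mul_hat f j).const_mul ((2 * Real.pi) ^ j * V)).mono'
          (Continuous.aestronglyMeasurable (by fun_prop))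
          (Eventually.of_forall fun ζ => hnorm j ζ _))
        (Continuous.aestronglyMeasurable (by fun_prop))
        (Eventually.of_forall fun ζ t _ => hnorm (j + 1) ζ _)
        ((integrable_norm_pow_mul_hat f (j + 1)).const_mul _)
        (Eventually.of_forall fun ζ t _ => ?_)
      · exact this.2
      · refine ((hasDerivAt_sphExp hn he j x (2 * Real.pi * ‖ζ‖) t).const_mul
          (hat f ζ * ((2 * Real.pi * ‖ζ‖ : ℝ) : ℂ) ^ j)).congr_deriv ?_
        ring
    simp only [ih] at h1
    rw [h1.unique h2, zero_smul, add_zero]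

/-- Decay of the derivatives of radial functions. -/
theorem exists_dirD_decay (hn : 3 ≤ n) {s k A : ℝ} {j : ℕ} (hs0 : -(n : ℝ) / 2 < s)
    (hk0 : -(n : ℝ) / 2 < k) (hA : 0 ≤ A) (hA' : A ≤ ((n : ℝ) - 1) / 2)
    (hs : 2 * (s - j + A) < n) (hk : (n : ℝ) < 2 * (k - j)) {e : Sp n} (he : ‖e‖ = 1) :
    ∃ C : ℝ, 0 ≤ C ∧ ∀ (f : radialTest n) (x : Sp n),
      |dirD e j (f : Sp n → ℝ) x| ≤ C * (max 1 ‖x‖) ^ (-A) * interNorm s k f := by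
  have hn0 : 0 < n := by omega
  set V := (sphMeasure n).real Set.univ with hV
  have hV0 : 0 < V := sphMeasure_univ_pos n
  -- Two moments of |f̂|: β = j for |x| ≤ 1, where the transform of the sphere is merely bounded,
  -- and β = j - A for |x| ≥ 1, where its decay provides (|x||ζ|)^(-A).
  obtain ⟨C₁, hC₁, h1⟩ := exists_integral_hat_le hn0 (β := (j : ℝ)) hs0 hk0 (by linarith) hk
  obtain ⟨C₂, hC₂, h2⟩ := exists_integral_hat_le hn0 (β := (j : ℝ) - A) hs0 hk0
    (by linarith) (by linarith)
  obtain ⟨C₃, hC₃, h3⟩ := exists_sphExp_decay hn e j hA hA'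
  have hpi := two_pi_pos
  refine ⟨V⁻¹ * (2 * Real.pi) ^ j * (V * C₁ + C₃ * C₂), by positivity, fun f x => ?_⟩
  have hX := interNorm_nonneg s k f
  have hrep := dirD_eq_integral_sphExp hn0 f he j x
  have hval : V * |dirD e j (f : Sp n → ℝ) x| =
      ‖∫ ζ, hat f ζ * ((2 * Real.pi * ‖ζ‖ : ℝ) : ℂ) ^ j *
        sphExp e j ((2 * Real.pi * ‖ζ‖) • x)‖ := by
    rw [← hrep, norm_mul, Complex.norm_real, Complex.norm_real, Real.norm_of_nonneg hV0.le,
      Real.norm_eq_abs]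
  have hnn : ∀ ζ : Sp n, (0 : ℝ) ≤ 2 * Real.pi * ‖ζ‖ := fun ζ => by positivity
  obtain ⟨i1, b1⟩ := h1 f
  obtain ⟨i2, b2⟩ := h2 f
  have key : V * |dirD e j (f : Sp n → ℝ) x| ≤
      (2 * Real.pi) ^ j * (V * C₁ + C₃ * C₂) * (max 1 ‖x‖) ^ (-A) * interNorm s k f := by
    rw [hval]
    rcases le_total ‖x‖ 1 with hx | hx
    · rw [max_eq_left hx, Real.one_rpow, mul_one]
      have hb : ‖∫ ζ, hat f ζ * ((2 * Real.pi * ‖ζ‖ : ℝ) : ℂ) ^ j *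
          sphExp e j ((2 * Real.pi * ‖ζ‖) • x)‖ ≤
          ∫ ζ, (2 * Real.pi) ^ j * V * (‖ζ‖ ^ (j : ℝ) * ‖hat f ζ‖) := by
        refine norm_integral_le_of_norm_le (i1.const_mul _) (Eventually.of_forall fun ζ => ?_)
        rw [norm_mul, norm_mul, norm_pow, Complex.norm_real, Real.norm_of_nonneg (hnn ζ),
          Real.rpow_natCast]
        calc _ ≤ ‖hat f ζ‖ * (2 * Real.pi * ‖ζ‖) ^ j * V :=
              mul_le_mul_of_nonneg_left (norm_sphExp_le hn0 he j _) (by positivity)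
          _ = _ := by rw [mul_pow]; ring
      rw [integral_const_mul] at hb
      refine hb.trans ?_
      calc _ ≤ (2 * Real.pi) ^ j * V * (C₁ * interNorm s k f) :=
            mul_le_mul_of_nonneg_left b1 (by positivity)
        _ = (2 * Real.pi) ^ j * (V * C₁) * interNorm s k f := by ring
        _ ≤ _ := by gcongr; linarith [mul_nonneg hC₃ hC₂]
    · rw [max_eq_right hx]
      have hx0 : 0 < ‖x‖ := by linarith
      have hb : ‖∫ ζ, hat f ζ * ((2 * Real.pi * ‖ζ‖ : ℝ) : ℂ) ^ j *
          sphExp e j ((2 * Real.pi * ‖ζ‖) • x)‖ ≤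
          ∫ ζ, (2 * Real.pi) ^ j * C₃ * ‖x‖ ^ (-A) * (‖ζ‖ ^ ((j : ℝ) - A) * ‖hat f ζ‖) := by
        refine norm_integral_le_of_norm_le (i2.const_mul _) ?_
        have : Nonempty (Fin n) := ⟨⟨0, hn0⟩⟩
        have h0 : ∀ᵐ y : Sp n, y ≠ 0 := by rw [ae_iff]; simp
        filter_upwards [h0] with ζ hζ
        have hζ0 : 0 < ‖ζ‖ := norm_pos_iff.2 hζ
        rw [norm_mul, norm_mul, norm_pow, Complex.norm_real, Real.norm_of_nonneg (hnn ζ)]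
        have hdec : ‖sphExp e j ((2 * Real.pi * ‖ζ‖) • x)‖ ≤ C₃ * (‖x‖ ^ (-A) * ‖ζ‖ ^ (-A)) := by
          refine (h3 _).trans (mul_le_mul_of_nonneg_left ?_ hC₃)
          rw [norm_smul, Real.norm_of_nonneg (hnn ζ), ← Real.mul_rpow hx0.le hζ0.le,
            Real.rpow_neg (by positivity), Real.rpow_neg (by positivity)]
          refine inv_anti₀ (by positivity) (Real.rpow_le_rpow (by positivity) ?_ hA)
          have : 1 ≤ 2 * Real.pi := by linarith [Real.pi_gt_three]
          have hm : 0 ≤ ‖x‖ * ‖ζ‖ := by positivity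
          nlinarith
        calc _ ≤ ‖hat f ζ‖ * (2 * Real.pi * ‖ζ‖) ^ j * (C₃ * (‖x‖ ^ (-A) * ‖ζ‖ ^ (-A))) :=
              mul_le_mul_of_nonneg_left hdec (by positivity)
          _ = _ := by
              rw [mul_pow, sub_eq_add_neg, Real.rpow_add hζ0, Real.rpow_natCast]; ring
      rw [integral_const_mul] at hb
      refine hb.trans ?_
      calc _ ≤ (2 * Real.pi) ^ j * C₃ * ‖x‖ ^ (-A) * (C₂ * interNorm s k f) :=
            mul_le_mul_of_nonneg_left b2 (by positivity)
        _ = (2 * Real.pi) ^ j * (C₃ * C₂) * ‖x‖ ^ (-A) * interNorm s k f := by ring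
        _ ≤ _ := by gcongr; linarith [mul_nonneg hV0.le hC₁]
  have : |dirD e j (f : Sp n → ℝ) x| = V⁻¹ * (V * |dirD e j (f : Sp n → ℝ) x|) := by
    field_simp
  rw [this]
  calc _ ≤ V⁻¹ * ((2 * Real.pi) ^ j * (V * C₁ + C₃ * C₂) * (max 1 ‖x‖) ^ (-A) *
        interNorm s k f) := mul_le_mul_of_nonneg_left key (by positivity)
    _ = _ := by ring

/-! ### Sobolev norms of integer order and pure derivatives -/

/-- Iterated derivatives in the direction `e` of the Schwartz function of a test function. -/
theorem iterate_lineDeriv_cplx (f : radialTest n) (e : Sp n) (j : ℕ) (x : Sp n) :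
    ((fun φ : 𝓢(Sp n, ℂ) => ∂_{e} φ)^[j] (cplx f)) x = ((dirD e j (f : Sp n → ℝ) x : ℝ) : ℂ) := by
  induction j generalizing x with
  | zero => simp [dirD, cplx_apply]
  | succ j ih =>
    rw [Function.iterate_succ_apply', SchwartzMap.lineDerivOp_apply]
    have h1 : HasDerivAt (fun t : ℝ => ((dirD e j (f : Sp n → ℝ) (x + t • e) : ℝ) : ℂ))
        ((dirD e (j + 1) (f : Sp n → ℝ) x : ℝ) : ℂ) 0 := by
      refine HasDerivAt.ofReal_comp ?_
      simp only [← iteratedDeriv_line]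
      have hd : Differentiable ℝ (iteratedDeriv j fun t : ℝ => (f : Sp n → ℝ) (x + t • e)) :=
        (contDiff_line f e x).differentiable_iteratedDeriv j (by exact_mod_cast WithTop.coe_lt_top _)
      have h := (hd 0).hasDerivAt
      rwa [← iteratedDeriv_succ] at h
    simp only [← ih] at h1
    exact HasLineDerivAt.lineDeriv h1

theorem fourier_iterate_lineDeriv (φ : 𝓢(Sp n, ℂ)) (e : Sp n) (j : ℕ) (ζ : Sp n) :
    𝓕 ((fun φ : 𝓢(Sp n, ℂ) => ∂_{e} φ)^[j] φ) ζ =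
      (2 * Real.pi * Complex.I * (inner ℝ ζ e : ℝ)) ^ j * 𝓕 φ ζ := by
  induction j with
  | zero => simp
  | succ j ih =>
    have : (fun ζ : Sp n => inner ℝ ζ e).HasTemperateGrowth := by fun_prop
    rw [Function.iterate_succ_apply', SchwartzMap.fourier_lineDerivOp_eq, smul_apply,
      SchwartzMap.smulLeftCLM_apply_apply this, ih, smul_eq_mul, Complex.real_smul]
    ring

/-- Plancherel's identity for the derivatives of test functions. -/
theorem integral_dirD_sq (f : radialTest n) (e : Sp n) (j : ℕ) :
    ∫ x, dirD e j (f : Sp n → ℝ) x ^ 2 =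
      (2 * Real.pi) ^ (2 * j) * ∫ ζ, (inner ℝ ζ e : ℝ) ^ (2 * j) * ‖hat f ζ‖ ^ 2 := by
  have h := SchwartzMap.integral_norm_sq_fourier
    ((fun φ : 𝓢(Sp n, ℂ) => ∂_{e} φ)^[j] (cplx f))
  simp only [iterate_lineDeriv_cplx, fourier_iterate_lineDeriv, Complex.norm_real,
    Real.norm_eq_abs, sq_abs] at h
  rw [← h, ← integral_const_mul]
  refine integral_congr_ae (Eventually.of_forall fun ζ => ?_)
  simp only [norm_mul, norm_pow, Complex.norm_real, Complex.norm_I, Complex.norm_ofNat, mul_one,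
    Real.norm_eq_abs, abs_of_pos Real.pi_pos, hat]
  rw [mul_pow, ← pow_mul, mul_pow, mul_comm j 2, pow_mul (|(inner ℝ ζ e : ℝ)|) 2 j, sq_abs,
    ← pow_mul, mul_assoc]

theorem integrable_dirD_sq (f : radialTest n) (e : Sp n) (j : ℕ) :
    Integrable (fun x => dirD e j (f : Sp n → ℝ) x ^ 2) := by
  have h := ((fun φ : 𝓢(Sp n, ℂ) => ∂_{e} φ)^[j] (cplx f)).memLp 2 volume
  have h2 := h.integrable_norm_pow (by norm_num)
  refine h2.congr (Eventually.of_forall fun x => ?_)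
  simp [iterate_lineDeriv_cplx]

/-- Pointwise in frequency |ξ|^(2r) is at most |ξ|^(2r₁) for |ξ| ≤ 1 and at most |ξ|^(2r₂) for |ξ| ≥
1. -/
theorem sobInner_le_add {r₁ r r₂ : ℝ} (h₁ : r₁ ≤ r) (h₂ : r ≤ r₂) (hr : -(n : ℝ) / 2 < r₁)
    (f : radialTest n) :
    sobInner r (f : Sp n → ℝ) f ≤ sobInner r₁ (f : Sp n → ℝ) f + sobInner r₂ (f : Sp n → ℝ) f := by
  unfold sobInner
  have i := fun t (ht : -(n : ℝ) / 2 < t) => integrable_sobInner ht f f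
  rw [← integral_add (i r₁ hr) (i r₂ (by linarith))]
  have hnn : ∀ ξ : Sp n, 0 ≤ (FT (f : Sp n → ℝ) ξ * (starRingEnd ℂ) (FT (f : Sp n → ℝ) ξ)).re := by
    intro ξ
    rw [Complex.mul_conj, Complex.ofReal_re]
    exact Complex.normSq_nonneg _
  -- In dimension zero the origin is not a null set; there `0 ^ (2 * r) = 0` because r ≠ 0.
  rcases Nat.eq_zero_or_pos n with rfl | hn
  · refine integral_mono (i r (by linarith)) ((i r₁ hr).add (i r₂ (by linarith))) fun ξ => ?_
    have hξ : ξ = 0 := Subsingleton.elim _ _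
    have hr0 : r ≠ 0 := by norm_num at hr; linarith
    simp only [hξ, norm_zero]
    rw [Real.zero_rpow (by simpa using hr0), zero_mul]
    have := hnn 0
    positivity
  refine integral_mono_ae (i r (by linarith)) ((i r₁ hr).add (i r₂ (by linarith))) ?_
  have : Nonempty (Fin n) := ⟨⟨0, hn⟩⟩
  have h0 : ∀ᵐ y : Sp n, y ≠ 0 := by rw [ae_iff]; simp
  filter_upwards [h0] with ξ hξ
  have hξ0 : 0 < ‖ξ‖ := norm_pos_iff.2 hξ
  rw [← add_mul]
  refine mul_le_mul_of_nonneg_right ?_ (hnn ξ)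
  rcases le_total ‖ξ‖ 1 with h | h
  · refine (Real.rpow_le_rpow_of_exponent_ge hξ0 h (by linarith : 2 * r₁ ≤ 2 * r)).trans ?_
    exact le_add_of_nonneg_right (by positivity)
  · refine (Real.rpow_le_rpow_of_exponent_le h (by linarith : 2 * r ≤ 2 * r₂)).trans ?_
    exact le_add_of_nonneg_left (by positivity)

theorem sobInner_natCast (f : radialTest n) (j : ℕ) :
    sobInner (j : ℝ) (f : Sp n → ℝ) f =
      (2 * Real.pi) ^ (2 * j) * ∫ ζ, ‖ζ‖ ^ (2 * j) * ‖hat f ζ‖ ^ 2 := by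
  rw [sobInner_eq_homSq, homSq]
  have e : ∀ t : ℝ, t ^ (2 * (j : ℝ)) = t ^ (2 * j) := fun t => by
    rw [← Real.rpow_natCast]; push_cast; rfl
  simp only [e]

theorem integrable_pow_hat_sq (f : radialTest n) (j : ℕ) :
    Integrable (fun ζ => ‖ζ‖ ^ (2 * j) * ‖hat f ζ‖ ^ 2) := by
  obtain ⟨C, hC0, hC⟩ := exists_hat_bound f
  refine ((integrable_norm_pow_mul_hat f (2 * j)).const_mul C).mono' ?_
    (Eventually.of_forall fun ζ => ?_)
  · have := (hat f).continuous
    exact Continuous.aestronglyMeasurable (by fun_prop)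
  · rw [Real.norm_of_nonneg (by positivity)]
    calc ‖ζ‖ ^ (2 * j) * ‖hat f ζ‖ ^ 2 = ‖ζ‖ ^ (2 * j) * (‖hat f ζ‖ * ‖hat f ζ‖) := by ring
      _ ≤ ‖ζ‖ ^ (2 * j) * (C * ‖hat f ζ‖) := by gcongr; exact hC ζ
      _ = _ := by ring

theorem integrable_inner_pow_hat_sq (f : radialTest n) (e : Sp n) (j : ℕ) :
    Integrable (fun ζ => (inner ℝ ζ e : ℝ) ^ (2 * j) * ‖hat f ζ‖ ^ 2) := by
  refine ((integrable_pow_hat_sq f j).const_mul (‖e‖ ^ (2 * j))).mono' ?_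
    (Eventually.of_forall fun ζ => ?_)
  · have := (hat f).continuous
    exact Continuous.aestronglyMeasurable (by fun_prop)
  · rw [norm_mul, norm_pow, Real.norm_of_nonneg (sq_nonneg ‖hat f ζ‖), ← mul_assoc, ← mul_pow]
    refine mul_le_mul_of_nonneg_right (pow_le_pow_left₀ (norm_nonneg _) ?_ _) (sq_nonneg _)
    rw [mul_comm]
    exact norm_inner_le_norm _ _

theorem integral_dirD_sq_le_sobInner (f : radialTest n) {e : Sp n} (he : ‖e‖ = 1) (j : ℕ) :
    ∫ x, dirD e j (f : Sp n → ℝ) x ^ 2 ≤ sobInner (j : ℝ) (f : Sp n → ℝ) f := by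
  rw [integral_dirD_sq, sobInner_natCast]
  refine mul_le_mul_of_nonneg_left ?_ (by have := two_pi_pos; positivity)
  refine integral_mono (integrable_inner_pow_hat_sq f e j) (integrable_pow_hat_sq f j) fun ζ => ?_
  refine mul_le_mul_of_nonneg_right ?_ (sq_nonneg _)
  rw [pow_mul, pow_mul]
  refine pow_le_pow_left₀ (sq_nonneg _) ?_ _
  rw [sq_le_sq, abs_norm]
  have := abs_real_inner_le_norm ζ e
  rwa [he, mul_one] at this

theorem integral_dirD_sq_le_interNorm {s k : ℝ} (hs0 : -(n : ℝ) / 2 < s) (f : radialTest n)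
    {e : Sp n} (he : ‖e‖ = 1) {j : ℕ} (hsj : s ≤ j) (hjk : (j : ℝ) ≤ k) :
    ∫ x, dirD e j (f : Sp n → ℝ) x ^ 2 ≤ interNorm s k f ^ 2 := by
  rw [interNorm_sq]
  exact (integral_dirD_sq_le_sobInner f he j).trans (sobInner_le_add hsj hjk hs0 f)

/-- The power mean inequality for the squares of the coordinates. It makes mixed derivatives
unnecessary, which is what permits working on lines. The additional 1 at order zero covers the empty
sum when n = 0. -/
theorem norm_pow_le_sum_coord (ζ : Sp n) (j : ℕ) :
    ‖ζ‖ ^ (2 * j) ≤ (1 + (n : ℝ) ^ j) * (∑ i, ζ i ^ (2 * j) + if j = 0 then 1 else 0) := by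
  rcases j with _ | j
  · simp only [mul_zero, pow_zero, if_true]
    have : (0 : ℝ) ≤ ∑ _i : Fin n, (1 : ℝ) := Finset.sum_nonneg fun _ _ => zero_le_one
    nlinarith
  · have h := pow_sum_div_card_le_sum_pow (s := Finset.univ) (f := fun i : Fin n => ζ i ^ 2)
      (fun i _ => sq_nonneg _) j
    rw [Finset.card_univ, Fintype.card_fin, ← EuclideanSpace.real_norm_sq_eq, ← pow_mul] at h
    simp only [← pow_mul] at h
    have hS : 0 ≤ ∑ i, ζ i ^ (2 * (j + 1)) :=
      Finset.sum_nonneg fun i _ => by rw [pow_mul]; positivity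
    simp only [Nat.add_eq_zero_iff, one_ne_zero, and_false, if_false, add_zero]
    rcases Nat.eq_zero_or_pos n with rfl | hn
    · have : ζ = 0 := Subsingleton.elim _ _
      rw [this]
      simp
    · have hn0 : (0 : ℝ) < (n : ℝ) ^ j := by positivity
      rw [div_le_iff₀ hn0] at h
      have hn1 : (n : ℝ) ^ j ≤ (n : ℝ) ^ (j + 1) :=
        pow_le_pow_right₀ (by exact_mod_cast hn) (Nat.le_succ j)
      nlinarith

/-- The homogeneous Sobolev norms of integer order are controlled by pure derivatives. -/
theorem sobInner_natCast_le (hn : 0 < n) (j : ℕ) :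
    ∃ C : ℝ, 0 ≤ C ∧ ∀ f : radialTest n, sobInner (j : ℝ) (f : Sp n → ℝ) f ≤
      C * ∑ i, ∫ x, dirD (EuclideanSpace.single i 1) j (f : Sp n → ℝ) x ^ 2 := by
  refine ⟨(1 + (n : ℝ) ^ j) * 2, by positivity, fun f => ?_⟩
  simp only [integral_dirD_sq]
  rw [sobInner_natCast, ← Finset.mul_sum, mul_left_comm]
  refine mul_le_mul_of_nonneg_left ?_ (by have := two_pi_pos; positivity)
  rw [← integral_finsetSum _ fun i _ => integrable_inner_pow_hat_sq f _ j, ← integral_const_mul]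
  refine integral_mono (integrable_pow_hat_sq f j)
    ((integrable_finsetSum _ fun i _ => integrable_inner_pow_hat_sq f _ j).const_mul _) fun ζ => ?_
  simp only [EuclideanSpace.inner_single_right, one_mul, conj_trivial]
  rw [← Finset.sum_mul, ← mul_assoc]
  refine mul_le_mul_of_nonneg_right ((norm_pow_le_sum_coord ζ j).trans ?_) (sq_nonneg _)
  rw [mul_assoc]
  refine mul_le_mul_of_nonneg_left ?_ (by positivity)
  have hS : 0 ≤ ∑ i, ζ i ^ (2 * j) :=
    Finset.sum_nonneg fun i _ => by rw [pow_mul]; positivity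
  split_ifs with h
  · subst h
    simp only [mul_zero, pow_zero, Finset.sum_const, Finset.card_univ, Fintype.card_fin,
      nsmul_eq_mul, mul_one]
    have : (1 : ℝ) ≤ n := by exact_mod_cast hn
    linarith
  · linarith

/-! ### The nonlinear estimate on test functions -/

/-- The weights used in the pointwise estimate: decay for derivatives of low order, and a
majorant `H` for derivatives of high order. -/
def lowHigh (W H : ℝ) (M J : ℕ) (j : ℕ) : ℝ :=
  if j ≤ J then (W ^ (min j M))⁻¹ else (W ^ M)⁻¹ + H

/-- Orders i and m with i + m ≤ N ≤ 2J + 1 cannot both exceed J. The majorant H thus never meets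
itself in a product, and a low-order factor next to it is at most 1. Capping the exponent at M
preserves the Leibniz property since min(i + m, M) ≤ min(i, M) + min(m, M). -/
theorem decayWeight_lowHigh {N M J : ℕ} {l W H : ℝ} (hW : 1 ≤ W) (hWl : W ≤ l) (hH : 0 ≤ H)
    (hMJ : M ≤ J) (hN : N ≤ 2 * J + 1) : DecayWeight N (lowHigh W H M J) l W := by
  have hW0 : 0 < W := by linarith
  have hl0 : 0 < l := by linarith
  have hanti : ∀ {a b : ℕ}, a ≤ b → (W ^ b)⁻¹ ≤ (W ^ a)⁻¹ := fun {a b} h =>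
    inv_anti₀ (by positivity) (pow_le_pow_right₀ hW h)
  have hge : ∀ j, (W ^ j)⁻¹ ≤ lowHigh W H M J j := by
    intro j
    unfold lowHigh
    split_ifs with h
    · exact hanti (min_le_left _ _)
    · exact (hanti (by omega)).trans (le_add_of_nonneg_right hH)
  have hle1 : ∀ j, j ≤ J → lowHigh W H M J j ≤ 1 := by
    intro j hj
    rw [lowHigh, if_pos hj]
    exact inv_le_one_of_one_le₀ (one_le_pow₀ hW)
  have hnn : ∀ j, 0 ≤ lowHigh W H M J j := fun j => le_trans (by positivity) (hge j)
  refine { nonneg := hnn, zero := by simp [lowHigh], mul_le := ?_, one_le_W := hW, W_le := hWl,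
           symbol_le := ?_, shift_le := ?_ }
  · intro i m him
    by_cases hi : i ≤ J
    · by_cases hm : m ≤ J
      · have e : lowHigh W H M J i * lowHigh W H M J m = (W ^ (min i M + min m M))⁻¹ := by
          rw [lowHigh, lowHigh, if_pos hi, if_pos hm, pow_add, mul_inv]
        rw [e]
        unfold lowHigh
        split_ifs with h
        · exact hanti (by omega)
        · exact (hanti (by omega)).trans (le_add_of_nonneg_right hH)
      · have e : lowHigh W H M J (i + m) = lowHigh W H M J m := by
          rw [lowHigh, lowHigh, if_neg hm, if_neg (by omega)]
        rw [e]
        exact mul_le_of_le_one_left (hnn m) (hle1 i hi)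
    · have hm : m ≤ J := by omega
      have e : lowHigh W H M J (i + m) = lowHigh W H M J i := by
        rw [lowHigh, lowHigh, if_neg hi, if_neg (by omega)]
      rw [e]
      exact mul_le_of_le_one_right (hnn i) (hle1 m hm)
  · intro j _
    exact (inv_anti₀ (by positivity) (pow_le_pow_left₀ hW0.le hWl j)).trans (hge j)
  · intro j hj _
    obtain ⟨i, rfl⟩ : ∃ i, j = i + 1 := ⟨j - 1, by omega⟩
    calc l * (l ^ (i + 1))⁻¹ = (l ^ i)⁻¹ := by rw [pow_succ]; field_simp
      _ ≤ (W ^ i)⁻¹ := inv_anti₀ (by positivity) (pow_le_pow_left₀ hW0.le hWl i)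
      _ = W * (W ^ (i + 1))⁻¹ := by rw [pow_succ]; field_simp
      _ ≤ _ := mul_le_mul_of_nonneg_left (hge _) hW0.le

/-- The nonlinearity on radial test functions. -/
def nonlinTest (n : ℕ) (hn : 5 ≤ n) (u : radialTest n) : radialTest n :=
  ⟨fun x => nonlinExt n (‖x‖ ^ 2) ((u : Sp n → ℝ) x), by
    have hn5 : (5 : ℝ) ≤ n := by exact_mod_cast hn
    have ha : 0 < √((n : ℝ) - 4) := Real.sqrt_pos.2 (by linarith)
    have hp : ContDiff ℝ ∞ (fun x : Sp n => ((√((n : ℝ) - 4)) ^ 2 + ‖x‖ ^ 2)⁻¹) :=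
      (contDiff_const.add (contDiff_norm_sq ℝ)).inv fun x => by positivity
    have hu : ContDiff ℝ ∞ (u : Sp n → ℝ) := u.2.1
    have hq : ContDiff ℝ ∞ (fun x : Sp n => ‖x‖ ^ 2) := contDiff_norm_sq ℝ
    refine ⟨?_, ?_, ?_⟩
    · have h1 : ContDiff ℝ ∞ (fun x => sinKer (‖x‖ ^ 2) ((u : Sp n → ℝ) x)) :=
        hu.mul (contDiff_sincSqrt.comp (hq.mul (hu.pow 2)))
      have h2 : ContDiff ℝ ∞ (fun x => cubKer (‖x‖ ^ 2) (2 * (u : Sp n → ℝ) x)) :=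
        ((contDiff_const.mul hu).pow 3).mul
          (contDiff_cubicSqrt.comp (hq.mul ((contDiff_const.mul hu).pow 2)))
      have h3 : ContDiff ℝ ∞ (fun x : Sp n =>
          sinCoeff √((n : ℝ) - 4) ((√((n : ℝ) - 4)) ^ 2 + ‖x‖ ^ 2)⁻¹) := by
        unfold sinCoeff
        exact (contDiff_const.mul hp).mul ((contDiff_const.mul hp).sub contDiff_const)
      have h4 : ContDiff ℝ ∞ (fun x : Sp n =>
          cosCoeff √((n : ℝ) - 4) ((√((n : ℝ) - 4)) ^ 2 + ‖x‖ ^ 2)⁻¹) := by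
        unfold cosCoeff
        exact (contDiff_const.mul (((contDiff_const.mul hp).sub contDiff_const).pow 2)).sub
          contDiff_const
      exact contDiff_const.mul ((h3.mul (h1.pow 2)).add (h4.mul (h2.div_const 2)))
    · refine u.2.2.1.mono ?_
      intro x hx
      rw [Function.mem_support] at hx ⊢
      contrapose! hx
      rw [hx]
      simp [nonlinExt, sinKer, cubKer]
    · intro x y hxy
      show nonlinExt n (‖x‖ ^ 2) _ = nonlinExt n (‖y‖ ^ 2) _
      rw [hxy, u.2.2.2 x y hxy]⟩

theorem norm_sq_add_smul {e : Sp n} (he : ‖e‖ = 1) (x : Sp n) (t : ℝ) :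
    ‖x + t • e‖ ^ 2 = ‖x‖ ^ 2 + 2 * inner ℝ x e * t + t ^ 2 := by
  rw [norm_add_sq_real, norm_smul, he, inner_smul_right, Real.norm_eq_abs, mul_one, sq_abs]
  ring

/-- The decay exponent of the low-order derivatives. -/
def decayExp (n : ℕ) : ℝ := 1 - 1 / n

theorem decayExp_nonneg (hn : 5 ≤ n) : 0 ≤ decayExp n := by
  have : (5 : ℝ) ≤ n := by exact_mod_cast hn
  rw [decayExp, sub_nonneg, div_le_one (by linarith)]
  linarith

theorem decayExp_le_one (n : ℕ) : decayExp n ≤ 1 := by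
  rw [decayExp, sub_le_self_iff]
  positivity

/-- The decay factor `max 1 |x| ^ (1 - 1/n)`. -/
def decayFactor (x : Sp n) : ℝ := (max 1 ‖x‖) ^ decayExp n

theorem one_le_decayFactor (hn : 5 ≤ n) (x : Sp n) : 1 ≤ decayFactor x :=
  Real.one_le_rpow (le_max_left _ _) (decayExp_nonneg hn)

theorem decayFactor_le (x : Sp n) : decayFactor x ≤ max 1 ‖x‖ := by
  have := Real.rpow_le_rpow_of_exponent_le (le_max_left 1 ‖x‖) (decayExp_le_one n)
  rwa [Real.rpow_one] at this

/-- For n ≥ 5 one has n < 2(n - 2), so the admissible excess of s over n/2 - 1 is below 1/n. This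
bounds the usable decay exponent from above; `integrable_decay_sq` is the matching requirement from
below. -/
theorem exponent_lt (hn : 5 ≤ n) {s : ℝ}
    (hs' : s ≤ (n : ℝ) / 2 - 1 + 1 / (2 * ((n : ℝ) - 2))) : s + decayExp n < n / 2 := by
  have h5 : (5 : ℝ) ≤ n := by exact_mod_cast hn
  have : 1 / (2 * ((n : ℝ) - 2)) < 1 / n :=
    one_div_lt_one_div_of_lt (by linarith) (by linarith)
  rw [decayExp]
  linarith

theorem dirD_zero (e : Sp n) (u : Sp n → ℝ) (x : Sp n) : dirD e 0 u x = u x := by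
  simp [dirD]

/-- The derivative of order j ≥ 1 decays with exponent 1 + δ min(j, (n-3)/2). The cap keeps this
below (n-1)/2, the decay rate of the transform of the sphere; the restriction j ≤ (k-1)/2 ensures n
< 2(k - j), the convergence at high frequency. -/
theorem exists_low_order_bounds (hn : 5 ≤ n) {s : ℝ} (hs : (n : ℝ) / 2 - 1 < s)
    (hs' : s ≤ (n : ℝ) / 2 - 1 + 1 / (2 * ((n : ℝ) - 2))) {k : ℕ} (hk : n < k)
    {e : Sp n} (he : ‖e‖ = 1) :
    ∃ C : ℝ, 0 < C ∧ ∀ (f : radialTest n) (x : Sp n),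
      |(f : Sp n → ℝ) x| ≤ C * interNorm s k f / decayFactor x ∧
      ∀ j, 1 ≤ j → j ≤ (k - 1) / 2 →
        |dirD e j (f : Sp n → ℝ) x| ≤ C * interNorm s k f / max 1 ‖x‖ *
          (decayFactor x ^ min j ((n - 3) / 2))⁻¹ := by
  have h5 : (5 : ℝ) ≤ n := by exact_mod_cast hn
  have hδ0 := decayExp_nonneg hn
  have hδ1 := decayExp_le_one n
  have hlt := exponent_lt hn hs'
  have hkn : (n : ℝ) + 1 ≤ k := by exact_mod_cast hk
  have hs0 : -(n : ℝ) / 2 < s := by linarith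
  have hk0 : -(n : ℝ) / 2 < (k : ℝ) := by linarith
  obtain ⟨C₀, hC₀, h₀⟩ := exists_dirD_decay (k := k) (j := 0) (A := decayExp n)
    (by omega) hs0 hk0 hδ0 (by linarith) (by push_cast; linarith) (by push_cast; linarith) he
  have H : ∀ j : ℕ, ∃ C : ℝ, 0 ≤ C ∧ (1 ≤ j → j ≤ (k - 1) / 2 →
      ∀ (f : radialTest n) (x : Sp n), |dirD e j (f : Sp n → ℝ) x| ≤
        C * (max 1 ‖x‖) ^ (-(1 + decayExp n * (min j ((n - 3) / 2) : ℕ))) * interNorm s k f) := by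
    intro j
    by_cases hj : 1 ≤ j ∧ j ≤ (k - 1) / 2
    · set M : ℕ := min j ((n - 3) / 2) with hM
      have hMj : (M : ℝ) ≤ j := by exact_mod_cast min_le_left _ _
      have hMn : (M : ℝ) * 2 + 3 ≤ n := by
        have : M * 2 + 3 ≤ n := by omega
        exact_mod_cast this
      have hM0 : (0 : ℝ) ≤ M := Nat.cast_nonneg _
      have hj1 : (1 : ℝ) ≤ j := by exact_mod_cast hj.1
      have hjk : (j : ℝ) * 2 + 1 ≤ k := by
        have : j * 2 + 1 ≤ k := by omega
        exact_mod_cast this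
      have hδM : decayExp n * M ≤ M := mul_le_of_le_one_left hM0 hδ1
      -- From M ≤ j and (j - 1)(1 - δ) ≥ 0. The condition s - j + A < n/2 thereby reduces to s + δ <
      -- n/2.
      have hδj : decayExp n * M ≤ decayExp n + (j - 1) := by nlinarith
      obtain ⟨C, hC0, hC⟩ := exists_dirD_decay (s := s) (k := k) (j := j)
        (A := 1 + decayExp n * M) (by omega) hs0 hk0 (by positivity) (by linarith)
        (by linarith) (by linarith) he
      exact ⟨C, hC0, fun _ _ => hC⟩
    · exact ⟨0, le_rfl, fun h1 h2 => absurd ⟨h1, h2⟩ hj⟩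
  choose C hC0 hC using H
  -- The summand 1 makes the constant strictly positive; its inverse is used later.
  refine ⟨C₀ + ∑ j ∈ Finset.range ((k - 1) / 2 + 1), C j + 1, ?_, fun f x => ⟨?_, fun j h1 h2 => ?_⟩⟩
  · have := Finset.sum_nonneg fun j (_ : j ∈ Finset.range ((k - 1) / 2 + 1)) => hC0 j
    linarith
  · have hsum := Finset.sum_nonneg fun j (_ : j ∈ Finset.range ((k - 1) / 2 + 1)) => hC0 j
    have h := h₀ f x
    have hX := interNorm_nonneg s k f
    have hl : 0 < max 1 ‖x‖ := lt_max_of_lt_left one_pos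
    rw [dirD_zero, Real.rpow_neg hl.le] at h
    refine h.trans ?_
    rw [mul_right_comm, div_eq_mul_inv, decayFactor]
    refine mul_le_mul_of_nonneg_right (mul_le_mul_of_nonneg_right (by linarith) hX) ?_
    positivity
  · have hle : C j ≤ ∑ j ∈ Finset.range ((k - 1) / 2 + 1), C j :=
      Finset.single_le_sum (fun j _ => hC0 j) (Finset.mem_range.2 (by omega))
    have h := hC j h1 h2 f x
    have hX := interNorm_nonneg s k f
    have hl : 0 < max 1 ‖x‖ := lt_max_of_lt_left one_pos
    rw [Real.rpow_neg hl.le, Real.rpow_add hl, Real.rpow_one, Real.rpow_mul hl.le,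
      Real.rpow_natCast, ← decayFactor, mul_inv] at h
    refine h.trans ?_
    have hW := decayFactor_le x
    have hW1 := one_le_decayFactor hn x
    calc _ = C j * (interNorm s k f * ((max 1 ‖x‖)⁻¹ *
          (decayFactor x ^ min j ((n - 3) / 2))⁻¹)) := by ring
      _ ≤ (C₀ + ∑ j ∈ Finset.range ((k - 1) / 2 + 1), C j + 1) * (interNorm s k f *
          ((max 1 ‖x‖)⁻¹ * (decayFactor x ^ min j ((n - 3) / 2))⁻¹)) := by
        refine mul_le_mul_of_nonneg_right (by linarith) ?_
        positivity
      _ = _ := by ring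

/-- Pointwise estimate of the derivatives of a difference of nonlinear terms. -/
theorem exists_dirD_nonlin_le (hn : 5 ≤ n) {s : ℝ} (hs : (n : ℝ) / 2 - 1 < s)
    (hs' : s ≤ (n : ℝ) / 2 - 1 + 1 / (2 * ((n : ℝ) - 2))) {k : ℕ} (hk : n < k)
    {e : Sp n} (he : ‖e‖ = 1) {B : ℝ} (hB : 0 ≤ B) :
    ∃ C : ℝ, 0 ≤ C ∧ ∀ (u v : radialTest n) (D S : ℝ), 0 < D → D ≤ S → S ≤ B →
      interNorm s k (u - v) ≤ D → interNorm s k (u + v) ≤ S → ∀ x : Sp n, ∀ j,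
      j = (n - 4) / 2 ∨ j = k - 1 →
      |dirD e j ((nonlinTest n hn u - nonlinTest n hn v : radialTest n) : Sp n → ℝ) x| ≤
        C * (D * S) * ((max 1 ‖x‖) ^ (-(1 + decayExp n * ((n - 4) / 2 + 2 : ℕ))) +
          ∑ i ∈ Finset.Ioc ((k - 1) / 2) (k - 1),
            (|dirD e i ((u - v : radialTest n) : Sp n → ℝ) x| / D +
              |dirD e i ((u + v : radialTest n) : Sp n → ℝ) x| / S)) := by
  obtain ⟨C₁, hC₁, h₁⟩ := exists_low_order_bounds hn hs hs' hk he
  obtain ⟨C₂, hC₂, h₂⟩ := exists_jetLE_nonlinExt_sub hn (k - 1) (C₁ * B) (by positivity)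
  refine ⟨C₂ * (C₁ * C₁) * (1 + C₁⁻¹), by positivity, ?_⟩
  intro u v D S hD hDS hSB hXD hXS x j hj
  have hS : 0 < S := hD.trans_le hDS
  set l : ℝ := max 1 ‖x‖ with hl
  set W : ℝ := decayFactor x with hW
  set M : ℕ := (n - 3) / 2 with hM
  set J : ℕ := (k - 1) / 2 with hJ
  set T : ℝ := ∑ i ∈ Finset.Ioc J (k - 1),
            (|dirD e i ((u - v : radialTest n) : Sp n → ℝ) x| / D +
              |dirD e i ((u + v : radialTest n) : Sp n → ℝ) x| / S) with hT
  have hT0 : 0 ≤ T := Finset.sum_nonneg fun i _ => by positivity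
  have hl1 : 1 ≤ l := le_max_left _ _
  have hl0 : 0 < l := by linarith
  have hW1 : 1 ≤ W := one_le_decayFactor hn x
  have hW0 : 0 < W := by linarith
  have hH : 0 ≤ l * (C₁⁻¹ * T) := by positivity
  -- The majorant H = l C₁⁻¹ T is chosen so that (C₁ Q / l) H = Q T, which dominates the high
  -- derivatives of a function of size Q. The factor l is cancelled at the end by the l⁻¹ of the
  -- nonlinear estimate, so T itself remains.
  have hw : DecayWeight (k - 1) (lowHigh W (l * (C₁⁻¹ * T)) M J) l W :=
    decayWeight_lowHigh hW1 (decayFactor_le x) hH (by omega) (by omega)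
  have adm : ∀ (f : radialTest n) (Q : ℝ), 0 < Q → interNorm s k f ≤ Q →
      (∀ i, J < i → i ≤ k - 1 → |dirD e i (f : Sp n → ℝ) x| / Q ≤ T) →
      Adm (k - 1) (lowHigh W (l * (C₁⁻¹ * T)) M J) l W (C₁ * Q)
        (fun t => (f : Sp n → ℝ) (x + t • e)) := by
    intro f Q hQ hfQ hhigh
    refine ⟨(contDiff_line f e x).contDiffAt, ?_, fun i h1 hi => ?_⟩
    · have := (h₁ f x).1
      simp only [zero_smul, add_zero]
      refine this.trans ?_
      gcongr
    · change |dirD e i (f : Sp n → ℝ) x| ≤ _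
      by_cases hiJ : i ≤ J
      · rw [lowHigh, if_pos hiJ]
        refine ((h₁ f x).2 i h1 hiJ).trans ?_
        gcongr
      · rw [lowHigh, if_neg hiJ]
        have := hhigh i (by omega) hi
        rw [div_le_iff₀ hQ] at this
        calc _ ≤ T * Q := this
          _ = C₁ * Q / l * (l * (C₁⁻¹ * T)) := by field_simp
          _ ≤ _ := by
            refine mul_le_mul_of_nonneg_left ?_ (by positivity)
            exact le_add_of_nonneg_left (by positivity)
  have hd : Adm (k - 1) (lowHigh W (l * (C₁⁻¹ * T)) M J) l W (C₁ * D)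
      (fun t => (u : Sp n → ℝ) (x + t • e) - (v : Sp n → ℝ) (x + t • e)) := by
    refine adm (u - v) D hD hXD fun i h1 h2 => ?_
    refine le_trans (le_add_of_nonneg_right ?_) (Finset.single_le_sum (f := fun i =>
      (|dirD e i ((u - v : radialTest n) : Sp n → ℝ) x| / D +
              |dirD e i ((u + v : radialTest n) : Sp n → ℝ) x| / S))
      (fun i _ => by positivity) (Finset.mem_Ioc.2 ⟨h1, h2⟩))
    positivity
  have hs2 : Adm (k - 1) (lowHigh W (l * (C₁⁻¹ * T)) M J) l W (C₁ * S)
      (fun t => (u : Sp n → ℝ) (x + t • e) + (v : Sp n → ℝ) (x + t • e)) := by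
    refine adm (u + v) S hS hXS fun i h1 h2 => ?_
    refine le_trans (le_add_of_nonneg_left ?_) (Finset.single_le_sum (f := fun i =>
      (|dirD e i ((u - v : radialTest n) : Sp n → ℝ) x| / D +
              |dirD e i ((u + v : radialTest n) : Sp n → ℝ) x| / S))
      (fun i _ => by positivity) (Finset.mem_Ioc.2 ⟨h1, h2⟩))
    positivity
  have hc : |(inner ℝ x e : ℝ)| ≤ ‖x‖ := by
    have := abs_real_inner_le_norm x e
    rwa [he, mul_one] at this
  have key := (h₂ _ ‖x‖ (inner ℝ x e) l W (C₁ * D) (C₁ * S) _ _ (norm_nonneg x) hc rfl hw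
    (mul_le_mul_of_nonneg_left hDS hC₁.le) (mul_le_mul_of_nonneg_left hSB hC₁.le) hd hs2).2 j
    (by omega)
  have e1 : dirD e j ((nonlinTest n hn u - nonlinTest n hn v : radialTest n) : Sp n → ℝ) x =
      iteratedDeriv j (fun t => nonlinExt n (‖x‖ ^ 2 + 2 * inner ℝ x e * t + t ^ 2)
        ((u : Sp n → ℝ) (x + t • e)) - nonlinExt n (‖x‖ ^ 2 + 2 * inner ℝ x e * t + t ^ 2)
        ((v : Sp n → ℝ) (x + t • e))) 0 := by
    simp only [← norm_sq_add_smul he]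
    rfl
  rw [e1]
  refine key.trans ?_
  have eW : l ^ (-(1 + decayExp n * ((n - 4) / 2 + 2 : ℕ))) =
      l⁻¹ * (W ^ 2)⁻¹ * (W ^ ((n - 4) / 2))⁻¹ := by
    rw [Real.rpow_neg hl0.le, Real.rpow_add hl0, Real.rpow_one, Real.rpow_mul hl0.le,
      Real.rpow_natCast, ← decayFactor, ← hW, pow_add, mul_inv, mul_inv]
    ring
  have hw2 : (W ^ 2)⁻¹ ≤ 1 := inv_le_one_of_one_le₀ (one_le_pow₀ hW1)
  -- At order (n-4)/2 the cap (n-3)/2 is not active; at order k - 1 the cap gives an exponent that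
  -- is at least (n-4)/2.
  have hwj : lowHigh W (l * (C₁⁻¹ * T)) M J j ≤ (W ^ ((n - 4) / 2))⁻¹ + l * (C₁⁻¹ * T) := by
    unfold lowHigh
    rcases hj with rfl | rfl
    · rw [if_pos (by omega), min_eq_left (by omega)]
      exact le_add_of_nonneg_right hH
    · rw [if_neg (by omega)]
      refine add_le_add_left (inv_anti₀ (by positivity) (pow_le_pow_right₀ hW1 (by omega))) _
  rw [eW]
  calc _ ≤ C₂ * (C₁ * D * (C₁ * S) * (l⁻¹ * (W ^ 2)⁻¹)) *
        ((W ^ ((n - 4) / 2))⁻¹ + l * (C₁⁻¹ * T)) :=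
        mul_le_mul_of_nonneg_left hwj (by positivity)
    _ = C₂ * (C₁ * C₁) * (D * S) * (l⁻¹ * (W ^ 2)⁻¹ * (W ^ ((n - 4) / 2))⁻¹ +
        C₁⁻¹ * ((W ^ 2)⁻¹ * T)) := by field_simp
    _ ≤ C₂ * (C₁ * C₁) * (D * S) * ((1 + C₁⁻¹) *
        (l⁻¹ * (W ^ 2)⁻¹ * (W ^ ((n - 4) / 2))⁻¹ + T)) := by
        refine mul_le_mul_of_nonneg_left ?_ (by positivity)
        have hi : 0 < C₁⁻¹ := by positivity
        have hp : 0 ≤ l⁻¹ * (W ^ 2)⁻¹ * (W ^ ((n - 4) / 2))⁻¹ := by positivity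
        have hq : (W ^ 2)⁻¹ * T ≤ T := mul_le_of_le_one_left hT0 hw2
        nlinarith [mul_le_mul_of_nonneg_left hq hi.le, mul_nonneg hi.le hp]
    _ = _ := by ring

/-- With integer division (n-4)/2 + 2 ≥ (n-1)/2, and (1 - 1/n)(n - 1) = n - 2 + 1/n. Twice the
exponent is therefore at least n + 1/n, just beyond the threshold n. -/
theorem integrable_decay_sq (hn : 5 ≤ n) : Integrable (fun x : Sp n =>
    ((max 1 ‖x‖) ^ (-(1 + decayExp n * ((n - 4) / 2 + 2 : ℕ)))) ^ 2) := by
  have h5 : (5 : ℝ) ≤ n := by exact_mod_cast hn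
  set q : ℝ := 1 + decayExp n * ((n - 4) / 2 + 2 : ℕ) with hq
  have hq0 : 0 ≤ q := by have := decayExp_nonneg hn; positivity
  have hqn : (n : ℝ) < 2 * q := by
    have h1 : (n : ℝ) - 1 ≤ 2 * (((n - 4) / 2 + 2 : ℕ) : ℝ) := by
      have : n ≤ 2 * ((n - 4) / 2 + 2) + 1 := by omega
      have : (n : ℝ) ≤ 2 * (((n - 4) / 2 + 2 : ℕ) : ℝ) + 1 := by exact_mod_cast this
      linarith
    have h2 : decayExp n * (n - 1) ≤ decayExp n * (2 * (((n - 4) / 2 + 2 : ℕ) : ℝ)) :=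
      mul_le_mul_of_nonneg_left h1 (decayExp_nonneg hn)
    have h3 : decayExp n * (n - 1) = n - 2 + 1 / n := by
      rw [decayExp]
      field_simp
      ring
    have h4 : (0 : ℝ) < 1 / n := by positivity
    rw [hq]
    linarith
  have hfin : ((Module.finrank ℝ (Sp n) : ℕ) : ℝ) < 2 * q := by
    rwa [finrank_euclideanSpace, Fintype.card_fin]
  refine ((integrable_one_add_norm (μ := (volume : Measure (Sp n))) hfin).const_mul
    (2 ^ (2 * q))).mono' ?_ (Eventually.of_forall fun x => ?_)
  · refine (Continuous.pow ?_ 2).aestronglyMeasurable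
    exact (continuous_const.max continuous_norm).rpow_const fun x =>
      Or.inl (lt_max_of_lt_left one_pos).ne'
  · have hl : 0 < max 1 ‖x‖ := lt_max_of_lt_left one_pos
    rw [Real.norm_of_nonneg (by positivity), ← Real.rpow_natCast, ← Real.rpow_mul hl.le]
    have e : -q * ((2 : ℕ) : ℝ) = -(2 * q) := by push_cast; ring
    rw [e, Real.rpow_neg hl.le, Real.rpow_neg (by positivity), ← div_eq_mul_inv, inv_eq_one_div,
      div_le_div_iff₀ (by positivity) (by positivity), one_mul,
      ← Real.mul_rpow (by norm_num) hl.le]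
    refine Real.rpow_le_rpow (by positivity) ?_ (by positivity)
    have := le_max_left 1 ‖x‖
    have := le_max_right 1 ‖x‖
    linarith

theorem exists_integral_dirD_nonlin_sq_le (hn : 5 ≤ n) {s : ℝ} (hs : (n : ℝ) / 2 - 1 < s)
    (hs' : s ≤ (n : ℝ) / 2 - 1 + 1 / (2 * ((n : ℝ) - 2))) {k : ℕ} (hk : n < k)
    {e : Sp n} (he : ‖e‖ = 1) {B : ℝ} (hB : 0 ≤ B) :
    ∃ K : ℝ, 0 ≤ K ∧ ∀ (u v : radialTest n) (D S : ℝ), 0 < D → D ≤ S → S ≤ B →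
      interNorm s k (u - v) ≤ D → interNorm s k (u + v) ≤ S → ∀ j,
      j = (n - 4) / 2 ∨ j = k - 1 →
      ∫ x, dirD e j ((nonlinTest n hn u - nonlinTest n hn v : radialTest n) : Sp n → ℝ) x ^ 2 ≤
        K * (D * S) ^ 2 := by
  obtain ⟨C, hC0, hC⟩ := exists_dirD_nonlin_le hn hs hs' hk he hB
  have h5 : (5 : ℝ) ≤ n := by exact_mod_cast hn
  set I := Finset.Ioc ((k - 1) / 2) (k - 1) with hI
  set g : Sp n → ℝ := fun x => (max 1 ‖x‖) ^ (-(1 + decayExp n * ((n - 4) / 2 + 2 : ℕ))) with hg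
  have hgi : Integrable (fun x => g x ^ 2) := integrable_decay_sq hn
  have hg0 : 0 ≤ ∫ x, g x ^ 2 := integral_nonneg fun _ => sq_nonneg _
  refine ⟨C ^ 2 * (2 * ∫ x, g x ^ 2) + C ^ 2 * (2 * (I.card * (I.card * 4))), by positivity, ?_⟩
  intro u v D S hD hDS hSB hXD hXS j hj
  have hS : 0 < S := hD.trans_le hDS
  set p : ℕ → Sp n → ℝ := fun i => dirD e i ((u - v : radialTest n) : Sp n → ℝ) with hp
  set q : ℕ → Sp n → ℝ := fun i => dirD e i ((u + v : radialTest n) : Sp n → ℝ) with hq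
  have hpi : ∀ i, Integrable (fun x => p i x ^ 2) := fun i => integrable_dirD_sq (u - v) e i
  have hqi : ∀ i, Integrable (fun x => q i x ^ 2) := fun i => integrable_dirD_sq (u + v) e i
  have hsn : s ≤ n / 2 := by
    have := exponent_lt hn hs'
    have := decayExp_nonneg hn
    linarith
  -- The high orders lie between s and k: an index above (k-1)/2 satisfies 2i ≥ n, and s ≤ n/2.
  -- Their L² norms are thus bounded by the intersection norm, and after division by D or S by
  -- constants.
  have hIb : ∀ i ∈ I, s ≤ (i : ℝ) ∧ (i : ℝ) ≤ (k : ℝ) := by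
    intro i hi
    rw [hI, Finset.mem_Ioc] at hi
    have h1 : n ≤ 2 * i := by omega
    have h2 : i ≤ k := by omega
    have h1' : (n : ℝ) ≤ 2 * i := by exact_mod_cast h1
    exact ⟨by linarith, by exact_mod_cast h2⟩
  have hpb : ∀ i ∈ I, ∫ x, p i x ^ 2 ≤ D ^ 2 := fun i hi =>
    (integral_dirD_sq_le_interNorm (by linarith) (u - v) he (hIb i hi).1 (hIb i hi).2).trans
      (pow_le_pow_left₀ (interNorm_nonneg _ _ _) hXD 2)
  have hqb : ∀ i ∈ I, ∫ x, q i x ^ 2 ≤ S ^ 2 := fun i hi =>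
    (integral_dirD_sq_le_interNorm (by linarith) (u + v) he (hIb i hi).1 (hIb i hi).2).trans
      (pow_le_pow_left₀ (interNorm_nonneg _ _ _) hXS 2)
  have hti : ∀ i, Integrable (fun x => 2 / D ^ 2 * p i x ^ 2 + 2 / S ^ 2 * q i x ^ 2) := fun i =>
    ((hpi i).const_mul _).add ((hqi i).const_mul _)
  have hsi : Integrable (fun x => ∑ i ∈ I, (2 / D ^ 2 * p i x ^ 2 + 2 / S ^ 2 * q i x ^ 2)) :=
    integrable_finsetSum _ fun i _ => hti i
  have hpt : ∀ x, dirD e j ((nonlinTest n hn u - nonlinTest n hn v : radialTest n) : Sp n → ℝ) x ^ 2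
      ≤ (C * (D * S)) ^ 2 * (2 * g x ^ 2 + 2 * (I.card *
        ∑ i ∈ I, (2 / D ^ 2 * p i x ^ 2 + 2 / S ^ 2 * q i x ^ 2))) := by
    intro x
    have h := hC u v D S hD hDS hSB hXD hXS x j hj
    rw [← sq_abs]
    refine (pow_le_pow_left₀ (abs_nonneg _) h 2).trans ?_
    rw [mul_pow]
    refine mul_le_mul_of_nonneg_left ?_ (sq_nonneg _)
    refine (add_sq_le).trans ?_
    rw [mul_add]
    refine add_le_add_right (mul_le_mul_of_nonneg_left ?_ (by norm_num)) _
    refine sq_sum_le_card_mul_sum_sq.trans ?_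
    refine mul_le_mul_of_nonneg_left (Finset.sum_le_sum fun i _ => ?_) (by positivity)
    refine (add_sq_le).trans (le_of_eq ?_)
    rw [div_pow, div_pow, sq_abs, sq_abs]
    ring
  refine (integral_mono (integrable_dirD_sq _ e j)
    (((hgi.const_mul 2).add ((hsi.const_mul _).const_mul 2)).const_mul _) hpt).trans ?_
  simp only [Pi.add_apply]
  rw [integral_const_mul, integral_add (hgi.const_mul 2) ((hsi.const_mul _).const_mul 2),
    integral_const_mul, integral_const_mul, integral_const_mul,
    integral_finsetSum _ fun i _ => hti i]
  have hsum : (∑ i ∈ I, ∫ x, (2 / D ^ 2 * p i x ^ 2 + 2 / S ^ 2 * q i x ^ 2)) ≤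
      (I.card : ℝ) * 4 := by
    rw [← nsmul_eq_mul]
    refine Finset.sum_le_card_nsmul _ _ _ fun i hi => ?_
    rw [integral_add ((hpi i).const_mul _) ((hqi i).const_mul _), integral_const_mul,
      integral_const_mul]
    have h1 : 2 / D ^ 2 * ∫ x, p i x ^ 2 ≤ 2 := by
      calc _ ≤ 2 / D ^ 2 * D ^ 2 := mul_le_mul_of_nonneg_left (hpb i hi) (by positivity)
        _ = 2 := by field_simp
    have h2 : 2 / S ^ 2 * ∫ x, q i x ^ 2 ≤ 2 := by
      calc _ ≤ 2 / S ^ 2 * S ^ 2 := mul_le_mul_of_nonneg_left (hqb i hi) (by positivity)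
        _ = 2 := by field_simp
    linarith
  calc _ ≤ (C * (D * S)) ^ 2 * (2 * ∫ x, g x ^ 2) +
        (C * (D * S)) ^ 2 * (2 * (I.card * (I.card * 4))) := by
        rw [mul_add]
        gcongr
    _ = _ := by ring

/-- The nonlinear operator on pairs of test functions. -/
def nonlinPair {s₁ s₂ : ℝ} {h₁ : -(n : ℝ) / 2 + 1 < s₁} {h₂ : -(n : ℝ) / 2 + 1 < s₂} (hn : 5 ≤ n)
    (φ : TestPair n s₁ s₂ h₁ h₂) : TestPair n s₁ s₂ h₁ h₂ :=
  ((0 : radialTest n), nonlinTest n hn φ.1)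

section

variable {s₁ s₂ : ℝ} {h₁ : -(n : ℝ) / 2 + 1 < s₁} {h₂ : -(n : ℝ) / 2 + 1 < s₂}

theorem TestPair.norm_sq_eq (φ : TestPair n s₁ s₂ h₁ h₂) :
    ‖φ‖ ^ 2 = interNorm s₁ s₂ φ.1 ^ 2 + interNorm (s₁ - 1) (s₂ - 1) φ.2 ^ 2 := by
  rw [TestPair.norm_sq, interNorm_sq, interNorm_sq]
  rfl

theorem interNorm_fst_le (φ : TestPair n s₁ s₂ h₁ h₂) : interNorm s₁ s₂ φ.1 ≤ ‖φ‖ := by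
  refine abs_le_of_sq_le_sq' ?_ (norm_nonneg _) |>.2
  rw [TestPair.norm_sq_eq]
  exact le_add_of_nonneg_right (sq_nonneg _)

theorem interNorm_snd_le (φ : TestPair n s₁ s₂ h₁ h₂) :
    interNorm (s₁ - 1) (s₂ - 1) φ.2 ≤ ‖φ‖ := by
  refine abs_le_of_sq_le_sq' ?_ (norm_nonneg _) |>.2
  rw [TestPair.norm_sq_eq]
  exact le_add_of_nonneg_left (sq_nonneg _)

theorem sobInner_zero (r : ℝ) :
    sobInner r ((0 : radialTest n) : Sp n → ℝ) ((0 : radialTest n) : Sp n → ℝ) = 0 := by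
  have := sobInner_smul_left r 0 (0 : radialTest n) 0
  rwa [zero_smul, zero_mul] at this

theorem norm_nonlinPair_sub_sq (hn : 5 ≤ n) (φ ψ : TestPair n s₁ s₂ h₁ h₂) :
    ‖nonlinPair hn φ - nonlinPair hn ψ‖ ^ 2 =
      interNorm (s₁ - 1) (s₂ - 1) (nonlinTest n hn φ.1 - nonlinTest n hn ψ.1) ^ 2 := by
  have e1 : (nonlinPair hn φ - nonlinPair hn ψ).1 = (0 : radialTest n) :=
    sub_zero (0 : radialTest n)
  have e2 : (nonlinPair hn φ - nonlinPair hn ψ).2 =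
      nonlinTest n hn φ.1 - nonlinTest n hn ψ.1 := rfl
  rw [TestPair.norm_sq_eq, e1, e2, interNorm_sq s₁, sobInner_zero, sobInner_zero]
  ring

end

/-- From s - 1 > n/2 - 2 the integer (n-4)/2 lies below s - 1, so the norm of order s - 1 is
interpolated between the orders (n-4)/2 and k - 1, both controlled by pure derivatives. -/
theorem exists_interNorm_nonlin_sub_le (hn : 5 ≤ n) {s : ℝ} (hs : (n : ℝ) / 2 - 1 < s)
    (hs' : s ≤ (n : ℝ) / 2 - 1 + 1 / (2 * ((n : ℝ) - 2))) {k : ℕ} (hk : n < k)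
    {B : ℝ} (hB : 0 ≤ B) :
    ∃ K : ℝ, 0 ≤ K ∧ ∀ (u v : radialTest n) (D S : ℝ), 0 < D → D ≤ S → S ≤ B →
      interNorm s k (u - v) ≤ D → interNorm s k (u + v) ≤ S →
      interNorm (s - 1) (k - 1) (nonlinTest n hn u - nonlinTest n hn v) ^ 2 ≤
        K * (D * S) ^ 2 := by
  have h5 : (5 : ℝ) ≤ n := by exact_mod_cast hn
  have hkn : (n : ℝ) + 1 ≤ k := by exact_mod_cast hk
  have hlt := exponent_lt hn hs'
  have hd0 := decayExp_nonneg hn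
  have hk1 : ((k - 1 : ℕ) : ℝ) = k - 1 := by
    rw [Nat.cast_sub (by omega), Nat.cast_one]
  have hm : (((n - 4) / 2 : ℕ) : ℝ) ≤ s - 1 := by
    have : 2 * ((n - 4) / 2) + 4 ≤ n := by omega
    have : 2 * (((n - 4) / 2 : ℕ) : ℝ) + 4 ≤ n := by exact_mod_cast this
    linarith
  have hm0 : (0 : ℝ) ≤ (((n - 4) / 2 : ℕ) : ℝ) := Nat.cast_nonneg _
  have hall : ∀ i : Fin n, ∃ K : ℝ, 0 ≤ K ∧ ∀ (u v : radialTest n) (D S : ℝ), 0 < D → D ≤ S →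
      S ≤ B → interNorm s k (u - v) ≤ D → interNorm s k (u + v) ≤ S → ∀ j,
      j = (n - 4) / 2 ∨ j = k - 1 →
      ∫ x, dirD (EuclideanSpace.single i 1) j
        ((nonlinTest n hn u - nonlinTest n hn v : radialTest n) : Sp n → ℝ) x ^ 2 ≤
        K * (D * S) ^ 2 := fun i =>
    exists_integral_dirD_nonlin_sq_le hn hs hs' hk (by simp) hB
  choose K hK0 hK using hall
  obtain ⟨C₁, hC₁, h₁⟩ := sobInner_natCast_le (n := n) (by omega) ((n - 4) / 2)
  obtain ⟨C₂, hC₂, h₂⟩ := sobInner_natCast_le (n := n) (by omega) (k - 1)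
  have hKs : 0 ≤ ∑ i, K i := Finset.sum_nonneg fun i _ => hK0 i
  refine ⟨(C₁ + 2 * C₂) * ∑ i, K i, by positivity, ?_⟩
  intro u v D S hD hDS hSB hXD hXS
  set F := nonlinTest n hn u - nonlinTest n hn v with hF
  have hsum : ∀ j, j = (n - 4) / 2 ∨ j = k - 1 →
      ∑ i, ∫ x, dirD (EuclideanSpace.single i 1) j (F : Sp n → ℝ) x ^ 2 ≤
        (∑ i, K i) * (D * S) ^ 2 := by
    intro j hj
    rw [Finset.sum_mul]
    exact Finset.sum_le_sum fun i _ => hK i u v D S hD hDS hSB hXD hXS j hj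
  have hm' := (h₁ F).trans (mul_le_mul_of_nonneg_left (hsum _ (Or.inl rfl)) hC₁)
  have hk' := (h₂ F).trans (mul_le_mul_of_nonneg_left (hsum _ (Or.inr rfl)) hC₂)
  rw [hk1] at hk'
  have hmid := sobInner_le_add hm (by linarith : s - 1 ≤ (k : ℝ) - 1) (by linarith) F
  rw [interNorm_sq]
  linarith

/-- The nonlinear operator is locally Lipschitz continuous on test functions. -/
theorem exists_norm_nonlinPair_sub_le (hn : 5 ≤ n) {s : ℝ} (hs : (n : ℝ) / 2 - 1 < s)
    (hs' : s ≤ (n : ℝ) / 2 - 1 + 1 / (2 * ((n : ℝ) - 2))) {k : ℕ} (hk : n < k)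
    {B : ℝ} (hB : 0 ≤ B) :
    ∃ C : ℝ, 0 ≤ C ∧ ∀ φ ψ : TestPair n s k (exponent_s hn hs) (exponent_k hn hk),
      ‖φ‖ ≤ B → ‖ψ‖ ≤ B →
      ‖nonlinPair hn φ - nonlinPair hn ψ‖ ≤ C * (‖φ‖ + ‖ψ‖) * ‖φ - ψ‖ := by
  -- The sizes D and S must be positive, so ‖φ - ψ‖ and ‖φ‖ + ‖ψ‖ are enlarged by ε ∈ (0, 1], which
  -- the bound 2B + 1 accommodates; then ε tends to 0.
  obtain ⟨K, hK0, hK⟩ := exists_interNorm_nonlin_sub_le hn hs hs' hk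
    (by positivity : 0 ≤ 2 * B + 1)
  refine ⟨√K, Real.sqrt_nonneg _, fun φ ψ hφ hψ => ?_⟩
  have key : ∀ ε : ℝ, 0 < ε → ε ≤ 1 → ‖nonlinPair hn φ - nonlinPair hn ψ‖ ≤
      √K * (‖φ‖ + ‖ψ‖ + ε) * (‖φ - ψ‖ + ε) := by
    intro ε hε hε1
    refine abs_le_of_sq_le_sq' ?_ (by positivity) |>.2
    rw [norm_nonlinPair_sub_sq]
    have h := hK φ.1 ψ.1 (‖φ - ψ‖ + ε) (‖φ‖ + ‖ψ‖ + ε) (by positivity)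
      (by linarith [norm_sub_le φ ψ]) (by linarith)
      (le_trans (interNorm_fst_le (φ - ψ)) (by linarith))
      (le_trans (interNorm_fst_le (φ + ψ)) (by linarith [norm_add_le φ ψ]))
    refine h.trans (le_of_eq ?_)
    rw [mul_pow, mul_pow, mul_pow, Real.sq_sqrt hK0]
    ring
  have ht : Tendsto (fun ε : ℝ => √K * (‖φ‖ + ‖ψ‖ + ε) * (‖φ - ψ‖ + ε)) (𝓝[>] 0)
      (𝓝 (√K * (‖φ‖ + ‖ψ‖ + 0) * (‖φ - ψ‖ + 0))) := by
    refine (Continuous.tendsto ?_ 0).mono_left nhdsWithin_le_nhds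
    fun_prop
  rw [add_zero, add_zero] at ht
  refine ge_of_tendsto ht ?_
  filter_upwards [Ioc_mem_nhdsGT (zero_lt_one' ℝ)] with ε hε
  exact key ε hε.1 hε.2

/-! ### Uniform limits determine limits in norm -/

theorem exists_tendsto_ae_of_cauchy {α : Type*} [MeasurableSpace α] {μ : Measure α}
    {F : ℕ → α → ℂ} (hF : ∀ i, Integrable (F i) μ)
    (hC : ∀ ε > 0, ∃ m, ∀ i ≥ m, ∀ j ≥ m, ∫ x, ‖F i x - F j x‖ ∂μ < ε) :
    ∃ g : α → ℂ, Integrable g μ ∧ Tendsto (fun j => ∫ x, ‖F j x - g x‖ ∂μ) atTop (𝓝 0) ∧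
      ∃ σ : ℕ → ℕ, StrictMono σ ∧ ∀ᵐ x ∂μ, Tendsto (fun i => F (σ i) x) atTop (𝓝 (g x)) := by
  have hcs : CauchySeq (fun i => (hF i).toL1 (F i)) := by
    refine Metric.cauchySeq_iff.2 fun ε hε => ?_
    obtain ⟨m, hm⟩ := hC ε hε
    refine ⟨m, fun i hi j hj => ?_⟩
    rw [dist_eq_norm, ← Integrable.toL1_sub, L1.norm_of_fun_eq_integral_norm]
    exact hm i hi j hj
  obtain ⟨G, hG⟩ := cauchySeq_tendsto_of_complete hcs
  refine ⟨G, L1.integrable_coeFn G, ?_, ?_⟩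
  · have := tendsto_iff_dist_tendsto_zero.1 hG
    refine this.congr fun j => ?_
    rw [L1.dist_eq_integral_dist]
    refine integral_congr_ae ?_
    filter_upwards [(hF j).coeFn_toL1] with x hx
    rw [hx, dist_eq_norm]
  · obtain ⟨σ, hσ, h⟩ := (tendstoInMeasure_of_tendsto_Lp hG).exists_seq_tendsto_ae
    refine ⟨σ, hσ, ?_⟩
    have hall : ∀ᵐ x ∂μ, ∀ i, (hF i).toL1 (F i) x = F i x :=
      ae_all_iff.2 fun i => (hF i).coeFn_toL1
    filter_upwards [h, hall] with x hx hx'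
    simpa only [hx'] using hx

/-- Fatou's lemma for weighted square integrals. -/
theorem integral_weight_sq_le_of_tendsto {α : Type*} [MeasurableSpace α] {μ : Measure α}
    {w : α → ℝ} (hw : ∀ x, 0 ≤ w x) {F : ℕ → α → ℂ} {G : α → ℂ}
    (hF : ∀ i, Integrable (fun x => w x * ‖F i x‖ ^ 2) μ)
    (hG : Integrable (fun x => w x * ‖G x‖ ^ 2) μ)
    (ht : ∀ᵐ x ∂μ, Tendsto (fun i => F i x) atTop (𝓝 (G x))) {K : ℝ} (hK : 0 ≤ K)
    (h : ∀ᶠ i in atTop, ∫ x, w x * ‖F i x‖ ^ 2 ∂μ ≤ K) :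
    ∫ x, w x * ‖G x‖ ^ 2 ∂μ ≤ K := by
  have hnn : ∀ (H : α → ℂ) x, 0 ≤ w x * ‖H x‖ ^ 2 := fun H x => mul_nonneg (hw x) (sq_nonneg _)
  rw [← ENNReal.ofReal_le_ofReal_iff hK,
    ofReal_integral_eq_lintegral_ofReal hG (Eventually.of_forall (hnn G))]
  calc ∫⁻ x, ENNReal.ofReal (w x * ‖G x‖ ^ 2) ∂μ
      = ∫⁻ x, liminf (fun i => ENNReal.ofReal (w x * ‖F i x‖ ^ 2)) atTop ∂μ := by
        refine lintegral_congr_ae ?_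
        filter_upwards [ht] with x hx
        exact (ENNReal.tendsto_ofReal ((hx.norm.pow 2).const_mul (w x))).liminf_eq.symm
    _ ≤ liminf (fun i => ∫⁻ x, ENNReal.ofReal (w x * ‖F i x‖ ^ 2) ∂μ) atTop :=
        lintegral_liminf_le' fun i => (hF i).aestronglyMeasurable.aemeasurable.ennreal_ofReal
    _ ≤ ENNReal.ofReal K := by
        refine liminf_le_of_frequently_le' (Eventually.frequently ?_)
        filter_upwards [h] with i hi
        rw [← ofReal_integral_eq_lintegral_ofReal (hF i) (Eventually.of_forall (hnn (F i)))]
        exact ENNReal.ofReal_le_ofReal hi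

theorem hat_sub_apply (f g : radialTest n) (ζ : Sp n) : hat (f - g) ζ = hat f ζ - hat g ζ := by
  have h : cplx (f - g) = cplx f - cplx g := by
    ext x
    simp [cplx_apply]
  rw [hat, h, sub_eq_add_neg, FourierTransform.fourier_add, FourierTransform.fourier_neg,
    ← sub_eq_add_neg]
  rfl

/-- The weight of the intersection norm in frequency space. -/
def freqWeight (s k : ℝ) (ζ : Sp n) : ℝ :=
  (2 * Real.pi) ^ (2 * s) * ‖ζ‖ ^ (2 * s) + (2 * Real.pi) ^ (2 * k) * ‖ζ‖ ^ (2 * k)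

theorem freqWeight_nonneg (s k : ℝ) (ζ : Sp n) : 0 ≤ freqWeight s k ζ := by
  have := two_pi_pos
  unfold freqWeight
  positivity

theorem freqWeight_mul (s k : ℝ) (f : radialTest n) (ζ : Sp n) :
    freqWeight s k ζ * ‖hat f ζ‖ ^ 2 =
      (2 * Real.pi) ^ (2 * s) * (‖ζ‖ ^ (2 * s) * ‖hat f ζ‖ ^ 2) +
      (2 * Real.pi) ^ (2 * k) * (‖ζ‖ ^ (2 * k) * ‖hat f ζ‖ ^ 2) := by
  unfold freqWeight
  ring

theorem integrable_freqWeight {s k : ℝ} (hs0 : -(n : ℝ) / 2 < s) (hk0 : -(n : ℝ) / 2 < k)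
    (f : radialTest n) : Integrable (fun ζ => freqWeight s k ζ * ‖hat f ζ‖ ^ 2) := by
  simp only [freqWeight_mul]
  exact ((integrable_homSq hs0 f).const_mul _).add ((integrable_homSq hk0 f).const_mul _)

theorem interNorm_sq_eq_integral {s k : ℝ} (hs0 : -(n : ℝ) / 2 < s) (hk0 : -(n : ℝ) / 2 < k)
    (f : radialTest n) :
    interNorm s k f ^ 2 = ∫ ζ, freqWeight s k ζ * ‖hat f ζ‖ ^ 2 := by
  simp only [freqWeight_mul]
  rw [interNorm_sq, integral_add ((integrable_homSq hs0 f).const_mul _)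
    ((integrable_homSq hk0 f).const_mul _), integral_const_mul, integral_const_mul,
    sobInner_eq_homSq, sobInner_eq_homSq, homSq, homSq]

/-- Self-adjointness of the Fourier transform moves it onto ψ, so a uniform bound of f suffices
although f need not be small in any Lᵖ norm with p < ∞. -/
theorem integral_hat_mul_le (f : radialTest n) (ψ : 𝓢(Sp n, ℂ)) {ε : ℝ}
    (hf : ∀ x, |(f : Sp n → ℝ) x| ≤ ε) :
    ‖∫ ζ, hat f ζ * ψ ζ‖ ≤ ε * ∫ x, ‖(𝓕 ψ) x‖ := by
  rw [hat, SchwartzMap.integral_fourier_mul_eq, ← integral_const_mul]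
  refine norm_integral_le_of_norm_le (((𝓕 ψ).integrable).norm.const_mul ε)
    (Eventually.of_forall fun x => ?_)
  rw [norm_mul, cplx_apply, Complex.norm_real, Real.norm_eq_abs]
  exact mul_le_mul_of_nonneg_right (hf x) (norm_nonneg _)

/-- A uniform null sequence whose Fourier transforms converge in `L¹` has limit zero there. -/
theorem ae_eq_zero_of_tendsto_hat {f : ℕ → radialTest n} {g : Sp n → ℂ} (hg : Integrable g)
    (h : Tendsto (fun j => ∫ x, ‖hat (f j) x - g x‖) atTop (𝓝 0))
    (h0 : TendstoUniformly (fun j => (f j : Sp n → ℝ)) 0 atTop) : ∀ᵐ x, g x = 0 := by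
  refine ae_eq_zero_of_integral_contDiff_smul_eq_zero hg.locallyIntegrable fun ψ hψ hψc => ?_
  have hψc' : HasCompactSupport (fun x => (ψ x : ℂ)) :=
    hψc.comp_left (g := fun t : ℝ => (t : ℂ)) (by simp)
  set Ψ : 𝓢(Sp n, ℂ) := hψc'.toSchwartzMap (Complex.ofRealCLM.contDiff.comp hψ) with hΨ
  have hΨa : ∀ x, Ψ x = (ψ x : ℂ) := fun x => rfl
  obtain ⟨C, hC0, hC⟩ : ∃ C : ℝ, 0 ≤ C ∧ ∀ x, ‖Ψ x‖ ≤ C := by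
    obtain ⟨C, hC0, hC⟩ := Ψ.decay 0 0
    exact ⟨C, hC0.le, fun ζ => by simpa using hC ζ⟩
  have e : ∫ x, ψ x • g x = ∫ x, g x * Ψ x := by
    refine integral_congr_ae (Eventually.of_forall fun x => ?_)
    simp only [hΨa, Complex.real_smul, mul_comm]
  rw [e]
  have hΨm : AEStronglyMeasurable (fun x => Ψ x) volume := Ψ.continuous.aestronglyMeasurable
  have i1 : ∀ j, Integrable (fun x => hat (f j) x * Ψ x) := fun j =>
    (hat (f j)).integrable.mul_bdd hΨm (Eventually.of_forall hC)
  have i2 : Integrable (fun x => g x * Ψ x) := hg.mul_bdd hΨm (Eventually.of_forall hC)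
  have t1 : Tendsto (fun j => ∫ x, hat (f j) x * Ψ x) atTop (𝓝 (∫ x, g x * Ψ x)) := by
    rw [tendsto_iff_norm_sub_tendsto_zero]
    have := h.const_mul C
    rw [mul_zero] at this
    refine squeeze_zero (fun _ => norm_nonneg _) (fun j => ?_) this
    rw [← integral_sub (i1 j) i2, ← integral_const_mul]
    refine norm_integral_le_of_norm_le ((((hat (f j)).integrable).sub hg).norm.const_mul C)
      (Eventually.of_forall fun x => ?_)
    rw [← sub_mul, norm_mul, mul_comm]
    exact mul_le_mul_of_nonneg_right (hC x) (norm_nonneg _)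
  have t2 : Tendsto (fun j => ∫ x, hat (f j) x * Ψ x) atTop (𝓝 0) := by
    set Q : ℝ := ∫ x, ‖(𝓕 Ψ) x‖ with hQ
    have hQ0 : 0 ≤ Q := integral_nonneg fun _ => norm_nonneg _
    rw [Metric.tendsto_atTop]
    intro ε hε
    have hu := Metric.tendstoUniformly_iff.1 h0 (ε / (Q + 1)) (by positivity)
    obtain ⟨m, hm⟩ := eventually_atTop.1 hu
    refine ⟨m, fun j hj => ?_⟩
    rw [dist_zero_right]
    refine (integral_hat_mul_le (f j) Ψ (ε := ε / (Q + 1)) fun x => ?_).trans_lt ?_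
    · have := (hm j hj x).le
      rwa [Pi.zero_apply, dist_zero_left, Real.norm_eq_abs] at this
    · rw [← hQ, div_mul_eq_mul_div, div_lt_iff₀ (by positivity)]
      nlinarith
  exact tendsto_nhds_unique t1 t2

/-- A Cauchy sequence in the intersection norm that tends to zero uniformly tends to zero in
norm. -/
theorem tendsto_interNorm_zero (hn : 0 < n) {s k : ℝ} (hs0 : -(n : ℝ) / 2 < s)
    (hk0 : -(n : ℝ) / 2 < k) (hs : 2 * s < n) (hk : (n : ℝ) < 2 * k) {f : ℕ → radialTest n}
    (hC : ∀ ε > 0, ∃ m, ∀ i ≥ m, ∀ j ≥ m, interNorm s k (f i - f j) < ε)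
    (h0 : TendstoUniformly (fun j => (f j : Sp n → ℝ)) 0 atTop) :
    Tendsto (fun j => interNorm s k (f j)) atTop (𝓝 0) := by
  obtain ⟨C, hC0, hC'⟩ := exists_integral_hat_le hn (β := 0) hs0 hk0 (by simpa using hs)
    (by simpa using hk)
  simp only [Real.rpow_zero, one_mul] at hC'
  obtain ⟨g, hg, hgt, σ, hσ, hσt⟩ := exists_tendsto_ae_of_cauchy
    (F := fun j => (hat (f j) : Sp n → ℂ)) (fun j => (hat (f j)).integrable) (by
      intro ε hε
      obtain ⟨m, hm⟩ := hC (ε / (C + 1)) (by positivity)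
      refine ⟨m, fun i hi j hj => ?_⟩
      have h1 := (hC' (f i - f j)).2
      simp only [hat_sub_apply] at h1
      refine h1.trans_lt ?_
      have h2 := hm i hi j hj
      rw [lt_div_iff₀ (by positivity)] at h2
      have := interNorm_nonneg s k (f i - f j)
      nlinarith)
  -- The norm controls f̂ in L¹, so the transforms converge there. The limit vanishes because,
  -- tested against smooth functions, it only sees the uniform limit 0.
  have hg0 := ae_eq_zero_of_tendsto_hat hg hgt h0
  rw [Metric.tendsto_atTop]
  intro ε hε
  obtain ⟨m, hm⟩ := hC (ε / 2) (by positivity)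
  refine ⟨m, fun i hi => ?_⟩
  rw [dist_zero_right, Real.norm_of_nonneg (interNorm_nonneg _ _ _)]
  refine lt_of_le_of_lt (abs_le_of_sq_le_sq' ?_ (by positivity : 0 ≤ ε / 2)).2 (half_lt_self hε)
  rw [interNorm_sq_eq_integral hs0 hk0]
  -- Fatou along the subsequence σ: the transform of f i - f (σ j) tends almost everywhere to that
  -- of f i, and the Cauchy property bounds the norms of the differences.
  refine integral_weight_sq_le_of_tendsto (freqWeight_nonneg s k)
    (F := fun j => (hat (f i - f (σ j)) : Sp n → ℂ)) (fun j => integrable_freqWeight hs0 hk0 _)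
    (integrable_freqWeight hs0 hk0 _) ?_ (by positivity) ?_
  · filter_upwards [hσt, hg0] with x hx hx0
    rw [hx0] at hx
    simpa only [hat_sub_apply, sub_zero] using tendsto_const_nhds.sub hx
  · filter_upwards [eventually_ge_atTop m] with j hj
    rw [← interNorm_sq_eq_integral hs0 hk0]
    exact pow_le_pow_left₀ (interNorm_nonneg _ _ _)
      (hm i hi (σ j) (hj.trans (hσ.id_le j))).le 2

/-- The case A = 0, j = 0 of the decay estimate. -/
theorem exists_sup_le (hn : 3 ≤ n) {s k : ℝ} (hs0 : -(n : ℝ) / 2 < s)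
    (hk0 : -(n : ℝ) / 2 < k) (hs : 2 * s < n) (hk : (n : ℝ) < 2 * k) :
    ∃ C : ℝ, 0 ≤ C ∧ ∀ (f : radialTest n) (x : Sp n),
      |(f : Sp n → ℝ) x| ≤ C * interNorm s k f := by
  have h3 : (3 : ℝ) ≤ n := by exact_mod_cast hn
  obtain ⟨C, hC0, hC⟩ := exists_dirD_decay hn (A := 0) (j := 0) hs0 hk0 le_rfl (by linarith)
    (by simpa using hs) (by simpa using hk)
    (e := EuclideanSpace.single (⟨0, by omega⟩ : Fin n) (1 : ℝ)) (by simp)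
  refine ⟨C, hC0, fun f x => ?_⟩
  have := hC f x
  rwa [dirD_zero, neg_zero, Real.rpow_zero, mul_one] at this

/-! ### Functions attached to the completion, and extension of the operator -/

section

variable {s₁ s₂ : ℝ} {h₁ : -(n : ℝ) / 2 + 1 < s₁} {h₂ : -(n : ℝ) / 2 + 1 < s₂}

/-- The hypothesis on s₂ is the embedding condition n < 2(s₂ - 1) of the second component. -/
theorem exists_fst_snd_le (hn : 3 ≤ n) (hs : 2 * s₁ < n) (hk : (n : ℝ) + 2 < 2 * s₂) :
    ∃ C : ℝ, 0 ≤ C ∧ ∀ (φ : TestPair n s₁ s₂ h₁ h₂) (x : Sp n),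
      |φ.fst x| ≤ C * ‖φ‖ ∧ |φ.snd x| ≤ C * ‖φ‖ := by
  obtain ⟨C₁, hC₁, H₁⟩ := exists_sup_le hn (s := s₁) (k := s₂) (by linarith) (by linarith)
    (by linarith) (by linarith)
  obtain ⟨C₂, hC₂, H₂⟩ := exists_sup_le hn (s := s₁ - 1) (k := s₂ - 1) (by linarith)
    (by linarith) (by linarith) (by linarith)
  refine ⟨C₁ + C₂, by positivity, fun φ x => ⟨(H₁ φ.1 x).trans ?_, (H₂ φ.2 x).trans ?_⟩⟩
  · have := interNorm_fst_le φ
    have := interNorm_nonneg s₁ s₂ φ.1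
    gcongr
    linarith
  · have := interNorm_snd_le φ
    have := interNorm_nonneg (s₁ - 1) (s₂ - 1) φ.2
    gcongr
    linarith

theorem exists_seq_tendsto (U : HSpace n s₁ s₂ h₁ h₂) :
    ∃ φ : ℕ → TestPair n s₁ s₂ h₁ h₂,
      Tendsto (fun j => (φ j : HSpace n s₁ s₂ h₁ h₂)) atTop (𝓝 U) := by
  have hU : U ∈ closure (Set.range ((↑) : TestPair n s₁ s₂ h₁ h₂ → HSpace n s₁ s₂ h₁ h₂)) :=
    UniformSpace.Completion.denseRange_coe U
  obtain ⟨y, hy, hyU⟩ := mem_closure_iff_seq_limit.1 hU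
  choose φ hφ using hy
  exact ⟨φ, by simpa only [hφ] using hyU⟩

theorem tendsto_norm_sub_zero {U : HSpace n s₁ s₂ h₁ h₂} {φ ψ : ℕ → TestPair n s₁ s₂ h₁ h₂}
    (hφ : Tendsto (fun j => (φ j : HSpace n s₁ s₂ h₁ h₂)) atTop (𝓝 U))
    (hψ : Tendsto (fun j => (ψ j : HSpace n s₁ s₂ h₁ h₂)) atTop (𝓝 U)) :
    Tendsto (fun j => ‖φ j - ψ j‖) atTop (𝓝 0) := by
  have := (hφ.sub hψ).norm
  rw [sub_self, norm_zero] at this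
  refine this.congr fun j => ?_
  rw [← UniformSpace.Completion.coe_sub, UniformSpace.Completion.norm_coe]

theorem norm_sub_lt_of_tendsto {U : HSpace n s₁ s₂ h₁ h₂} {φ : ℕ → TestPair n s₁ s₂ h₁ h₂}
    (hφ : Tendsto (fun j => (φ j : HSpace n s₁ s₂ h₁ h₂)) atTop (𝓝 U)) :
    ∀ ε > 0, ∃ m, ∀ i ≥ m, ∀ j ≥ m, ‖φ i - φ j‖ < ε := by
  intro ε hε
  obtain ⟨m, hm⟩ := Metric.cauchySeq_iff.1 hφ.cauchySeq ε hε
  refine ⟨m, fun i hi j hj => ?_⟩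
  have := hm i hi j hj
  rwa [dist_eq_norm, ← UniformSpace.Completion.coe_sub, UniformSpace.Completion.norm_coe] at this

/-- Sequences of functions that are dominated by a Cauchy sequence converge uniformly. -/
theorem exists_tendstoUniformly {X : Type*} {F : ℕ → X → ℝ} {d : ℕ → ℕ → ℝ} {C : ℝ} (hC : 0 ≤ C)
    (hF : ∀ i j x, |F i x - F j x| ≤ C * d i j) (hd : ∀ i j, 0 ≤ d i j)
    (hdc : ∀ ε > 0, ∃ m, ∀ i ≥ m, ∀ j ≥ m, d i j < ε) :
    ∃ f : X → ℝ, TendstoUniformly F f atTop := by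
  have hu : UniformCauchySeqOn F atTop Set.univ := by
    rw [Metric.uniformCauchySeqOn_iff]
    intro ε hε
    obtain ⟨m, hm⟩ := hdc (ε / (C + 1)) (by positivity)
    refine ⟨m, fun i hi j hj x _ => ?_⟩
    rw [Real.dist_eq]
    refine (hF i j x).trans_lt ?_
    have h2 := hm i hi j hj
    rw [lt_div_iff₀ (by positivity)] at h2
    have := hd i j
    nlinarith
  have hx : ∀ x, ∃ y, Tendsto (fun i => F i x) atTop (𝓝 y) := fun x =>
    cauchySeq_tendsto_of_complete (hu.cauchySeq (Set.mem_univ x))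
  choose f hf using hx
  exact ⟨f, tendstoUniformlyOn_univ.1 (hu.tendstoUniformlyOn_of_tendsto fun x _ => hf x)⟩

theorem exists_tendstoUniformly_fst_snd (hn : 3 ≤ n) (hs : 2 * s₁ < n) (hk : (n : ℝ) + 2 < 2 * s₂)
    {U : HSpace n s₁ s₂ h₁ h₂} {φ : ℕ → TestPair n s₁ s₂ h₁ h₂}
    (hφ : Tendsto (fun j => (φ j : HSpace n s₁ s₂ h₁ h₂)) atTop (𝓝 U)) :
    ∃ u : (Sp n → ℝ) × (Sp n → ℝ), TendstoUniformly (fun j => (φ j).fst) u.1 atTop ∧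
      TendstoUniformly (fun j => (φ j).snd) u.2 atTop := by
  obtain ⟨C, hC0, hC⟩ := exists_fst_snd_le (h₁ := h₁) (h₂ := h₂) hn hs hk
  have hc := norm_sub_lt_of_tendsto hφ
  obtain ⟨u₁, hu₁⟩ := exists_tendstoUniformly (F := fun j => (φ j).fst) hC0
    (fun i j x => (hC (φ i - φ j) x).1) (fun i j => norm_nonneg _) hc
  obtain ⟨u₂, hu₂⟩ := exists_tendstoUniformly (F := fun j => (φ j).snd) hC0
    (fun i j x => (hC (φ i - φ j) x).2) (fun i j => norm_nonneg _) hc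
  exact ⟨(u₁, u₂), hu₁, hu₂⟩

theorem Represents.unique (hn : 3 ≤ n) (hs : 2 * s₁ < n) (hk : (n : ℝ) + 2 < 2 * s₂)
    {U : HSpace n s₁ s₂ h₁ h₂} {u v : (Sp n → ℝ) × (Sp n → ℝ)} (hu : Represents U u)
    (hv : Represents U v) : u = v := by
  obtain ⟨C, hC0, hC⟩ := exists_fst_snd_le (h₁ := h₁) (h₂ := h₂) hn hs hk
  obtain ⟨φ, hφ, hφ1, hφ2⟩ := hu
  obtain ⟨ψ, hψ, hψ1, hψ2⟩ := hv
  have ht := (tendsto_norm_sub_zero hφ hψ).const_mul C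
  rw [mul_zero] at ht
  refine Prod.ext (funext fun x => ?_) (funext fun x => ?_)
  · have h0 := squeeze_zero_norm (f := fun j => (φ j - ψ j).fst x)
      (fun j => (hC (φ j - ψ j) x).1) ht
    exact sub_eq_zero.1 (tendsto_nhds_unique ((hφ1.tendsto_at x).sub (hψ1.tendsto_at x)) h0)
  · have h0 := squeeze_zero_norm (f := fun j => (φ j - ψ j).snd x)
      (fun j => (hC (φ j - ψ j) x).2) ht
    exact sub_eq_zero.1 (tendsto_nhds_unique ((hφ2.tendsto_at x).sub (hψ2.tendsto_at x)) h0)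

/-- The differences of two approximating sequences are Cauchy in norm and tend to zero uniformly, so
`tendsto_interNorm_zero` applies to each component; their norms also tend to ‖U - V‖. -/
theorem Represents.injective (hn : 3 ≤ n) (hs : 2 * s₁ < n) (hk : (n : ℝ) + 2 < 2 * s₂)
    {U V : HSpace n s₁ s₂ h₁ h₂} {u : (Sp n → ℝ) × (Sp n → ℝ)} (hu : Represents U u)
    (hv : Represents V u) : U = V := by
  obtain ⟨φ, hφ, hφ1, hφ2⟩ := hu
  obtain ⟨ψ, hψ, hψ1, hψ2⟩ := hv
  have hsub : Tendsto (fun j => ((φ j - ψ j : TestPair n s₁ s₂ h₁ h₂) : HSpace n s₁ s₂ h₁ h₂))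
      atTop (𝓝 (U - V)) := by
    simpa only [UniformSpace.Completion.coe_sub] using hφ.sub hψ
  have hc := norm_sub_lt_of_tendsto hsub
  have t1 : Tendsto (fun j => interNorm s₁ s₂ (φ j - ψ j).1) atTop (𝓝 0) := by
    refine tendsto_interNorm_zero (by omega) (by linarith) (by linarith) hs (by linarith) ?_ ?_
    · intro ε hε
      obtain ⟨m, hm⟩ := hc ε hε
      exact ⟨m, fun i hi j hj => (interNorm_fst_le (φ i - ψ i - (φ j - ψ j))).trans_lt
        (hm i hi j hj)⟩
    · have := hφ1.sub hψ1
      rwa [sub_self] at this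
  have t2 : Tendsto (fun j => interNorm (s₁ - 1) (s₂ - 1) (φ j - ψ j).2) atTop (𝓝 0) := by
    refine tendsto_interNorm_zero (by omega) (by linarith) (by linarith) (by linarith)
      (by linarith) ?_ ?_
    · intro ε hε
      obtain ⟨m, hm⟩ := hc ε hε
      exact ⟨m, fun i hi j hj => (interNorm_snd_le (φ i - ψ i - (φ j - ψ j))).trans_lt
        (hm i hi j hj)⟩
    · have := hφ2.sub hψ2
      rwa [sub_self] at this
  have t3 : Tendsto (fun j => ‖φ j - ψ j‖ ^ 2) atTop (𝓝 0) := by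
    simp only [TestPair.norm_sq_eq]
    simpa using (t1.pow 2).add (t2.pow 2)
  have t4 : Tendsto (fun j => ‖φ j - ψ j‖ ^ 2) atTop (𝓝 (‖U - V‖ ^ 2)) := by
    simpa only [UniformSpace.Completion.norm_coe] using hsub.norm.pow 2
  have := tendsto_nhds_unique t4 t3
  exact sub_eq_zero.1 (norm_eq_zero.1 (pow_eq_zero_iff two_ne_zero |>.1 this))

/-- A map on test functions that is Lipschitz continuous on bounded sets extends to the
completion, with the same bounds. -/
theorem exists_extension (T : TestPair n s₁ s₂ h₁ h₂ → TestPair n s₁ s₂ h₁ h₂)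
    (hT : ∀ B : ℝ, 0 ≤ B → ∃ C : ℝ, 0 ≤ C ∧ ∀ φ ψ, ‖φ‖ ≤ B → ‖ψ‖ ≤ B →
      ‖T φ - T ψ‖ ≤ C * (‖φ‖ + ‖ψ‖) * ‖φ - ψ‖) :
    ∃ N : HSpace n s₁ s₂ h₁ h₂ → HSpace n s₁ s₂ h₁ h₂,
      (∀ (U : HSpace n s₁ s₂ h₁ h₂) (φ : ℕ → TestPair n s₁ s₂ h₁ h₂),
        Tendsto (fun j => (φ j : HSpace n s₁ s₂ h₁ h₂)) atTop (𝓝 U) →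
        Tendsto (fun j => (T (φ j) : HSpace n s₁ s₂ h₁ h₂)) atTop (𝓝 (N U))) ∧
      ∀ δ : ℝ, 0 < δ → ∃ C : ℝ, 0 < C ∧ ∀ U V, ‖U‖ ≤ δ → ‖V‖ ≤ δ →
        ‖N U - N V‖ ≤ C * (‖U‖ + ‖V‖) * ‖U - V‖ := by
  have hbd : ∀ {U : HSpace n s₁ s₂ h₁ h₂} {φ : ℕ → TestPair n s₁ s₂ h₁ h₂},
      Tendsto (fun j => (φ j : HSpace n s₁ s₂ h₁ h₂)) atTop (𝓝 U) → ∀ {δ : ℝ}, ‖U‖ ≤ δ →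
      ∀ᶠ j in atTop, ‖φ j‖ ≤ δ + 1 := by
    intro U φ hφ δ hU
    have := hφ.norm
    simp only [UniformSpace.Completion.norm_coe] at this
    filter_upwards [this.eventually_le_const (by linarith : ‖U‖ < δ + 1)] with j hj using hj
  -- The Lipschitz constant depends on the radius, so extension by global uniform continuity is not
  -- available. The limit is constructed along one sequence inside the ball of radius ‖U‖ + 1 and
  -- then shown to be the same for all sequences.
  have hex : ∀ U : HSpace n s₁ s₂ h₁ h₂, ∃ V : HSpace n s₁ s₂ h₁ h₂,
      ∀ φ : ℕ → TestPair n s₁ s₂ h₁ h₂,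
        Tendsto (fun j => (φ j : HSpace n s₁ s₂ h₁ h₂)) atTop (𝓝 U) →
        Tendsto (fun j => (T (φ j) : HSpace n s₁ s₂ h₁ h₂)) atTop (𝓝 V) := by
    intro U
    obtain ⟨φ, hφ⟩ := exists_seq_tendsto U
    obtain ⟨C, hC0, hC⟩ := hT (‖U‖ + 1) (by positivity)
    have hle : ∀ φ ψ : TestPair n s₁ s₂ h₁ h₂, ‖φ‖ ≤ ‖U‖ + 1 → ‖ψ‖ ≤ ‖U‖ + 1 →
        ‖T φ - T ψ‖ ≤ C * (2 * (‖U‖ + 1)) * ‖φ - ψ‖ := fun φ ψ h1 h2 => by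
      refine (hC φ ψ h1 h2).trans ?_
      gcongr
      linarith
    have hcs : CauchySeq (fun j => (T (φ j) : HSpace n s₁ s₂ h₁ h₂)) := by
      refine Metric.cauchySeq_iff.2 fun ε hε => ?_
      set L : ℝ := C * (2 * (‖U‖ + 1)) with hL
      have hL0 : 0 ≤ L := by positivity
      obtain ⟨m₁, hm₁⟩ := eventually_atTop.1 (hbd hφ le_rfl)
      obtain ⟨m₂, hm₂⟩ := norm_sub_lt_of_tendsto hφ (ε / (L + 1)) (by positivity)
      refine ⟨max m₁ m₂, fun i hi j hj => ?_⟩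
      rw [dist_eq_norm, ← UniformSpace.Completion.coe_sub, UniformSpace.Completion.norm_coe]
      have h1 := hle _ _ (hm₁ i (le_of_max_le_left hi)) (hm₁ j (le_of_max_le_left hj))
      have h2 := hm₂ i (le_of_max_le_right hi) j (le_of_max_le_right hj)
      rw [lt_div_iff₀ (by positivity)] at h2
      have := norm_nonneg (φ i - φ j)
      nlinarith
    obtain ⟨V, hV⟩ := cauchySeq_tendsto_of_complete hcs
    refine ⟨V, fun ψ hψ => ?_⟩
    have h0 : Tendsto (fun j => ((T (ψ j) : HSpace n s₁ s₂ h₁ h₂) - T (φ j))) atTop (𝓝 0) := by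
      have ht := (tendsto_norm_sub_zero hψ hφ).const_mul (C * (2 * (‖U‖ + 1)))
      rw [mul_zero] at ht
      refine squeeze_zero_norm' ?_ ht
      filter_upwards [hbd hψ le_rfl, hbd hφ le_rfl] with j h1 h2
      rw [← UniformSpace.Completion.coe_sub, UniformSpace.Completion.norm_coe]
      exact hle _ _ h1 h2
    simpa using h0.add hV
  choose N hN using hex
  refine ⟨N, hN, fun δ hδ => ?_⟩
  obtain ⟨C, hC0, hC⟩ := hT (δ + 1) (by positivity)
  -- The given constant may be 0; adding 1 makes it strictly positive.
  refine ⟨C + 1, by positivity, fun U V hU hV => ?_⟩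
  obtain ⟨φ, hφ⟩ := exists_seq_tendsto U
  obtain ⟨ψ, hψ⟩ := exists_seq_tendsto V
  refine le_of_tendsto_of_tendsto ((hN U φ hφ).sub (hN V ψ hψ)).norm
    (((hφ.norm.add hψ.norm).const_mul (C + 1)).mul (hφ.sub hψ).norm) ?_
  filter_upwards [hbd hφ hU, hbd hψ hV] with j h1 h2
  rw [← UniformSpace.Completion.coe_sub, ← UniformSpace.Completion.coe_sub]
  simp only [UniformSpace.Completion.norm_coe]
  refine (hC _ _ h1 h2).trans ?_
  gcongr
  linarith

end

theorem continuous_nonlinExt (n : ℕ) (q : ℝ) : Continuous (nonlinExt n q) := by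
  have h1 : Continuous (sinKer q) := by
    unfold sinKer
    exact continuous_id.mul (contDiff_sincSqrt.continuous.comp (by fun_prop))
  have h2 : Continuous (cubKer q) := by
    unfold cubKer
    exact (continuous_id.pow 3).mul (contDiff_cubicSqrt.continuous.comp (by fun_prop))
  unfold nonlinExt
  fun_prop

end

end WaveMap

theorem lemma7p1 (n : ℕ) (hn : 5 ≤ n) (s : ℝ) (hs : (n : ℝ) / 2 - 1 < s)
    (hs' : s ≤ (n : ℝ) / 2 - 1 + 1 / (2 * ((n : ℝ) - 2))) (k : ℕ) (hk : n < k) :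
    -- every element of the space is a pair of functions, which determines it
    (∀ U : WaveMap.HSpace n s k (WaveMap.exponent_s hn hs) (WaveMap.exponent_k hn hk),
      ∃! u, WaveMap.Represents U u) ∧
    (∀ (U V : WaveMap.HSpace n s k (WaveMap.exponent_s hn hs) (WaveMap.exponent_k hn hk)) u,
      WaveMap.Represents U u → WaveMap.Represents V u → U = V) ∧
    -- the nonlinear operator maps the space into itself and is locally Lipschitz continuous
    ∃ N : WaveMap.HSpace n s k (WaveMap.exponent_s hn hs) (WaveMap.exponent_k hn hk) →
        WaveMap.HSpace n s k (WaveMap.exponent_s hn hs) (WaveMap.exponent_k hn hk),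
      (∀ U u, WaveMap.Represents U u →
        ∃ w, WaveMap.Represents (N U) w ∧ WaveMap.IsNonlin u w) ∧
      ∀ δ : ℝ, 0 < δ → ∃ C : ℝ, 0 < C ∧ ∀ U V, ‖U‖ ≤ δ → ‖V‖ ≤ δ →
        ‖N U - N V‖ ≤ C * (‖U‖ + ‖V‖) * ‖U - V‖ := by
  have h5 : (5 : ℝ) ≤ n := by exact_mod_cast hn
  have hkn : (n : ℝ) + 1 ≤ k := by exact_mod_cast hk
  have h3 : 3 ≤ n := by omega
  have hs2 : 2 * s < n := by
    have := WaveMap.exponent_lt hn hs'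
    have := WaveMap.decayExp_nonneg hn
    linarith
  have hk2 : (n : ℝ) + 2 < 2 * (k : ℝ) := by linarith
  refine ⟨fun U => ?_, fun U V u hu hv => hu.injective h3 hs2 hk2 hv, ?_⟩
  · obtain ⟨φ, hφ⟩ := WaveMap.exists_seq_tendsto U
    obtain ⟨u, hu1, hu2⟩ := WaveMap.exists_tendstoUniformly_fst_snd h3 hs2 hk2 hφ
    exact ⟨u, ⟨φ, hφ, hu1, hu2⟩, fun v hv => hv.unique h3 hs2 hk2 ⟨φ, hφ, hu1, hu2⟩⟩
  · obtain ⟨N, hN, hL⟩ := WaveMap.exists_extension (WaveMap.nonlinPair hn) fun B hB =>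
      WaveMap.exists_norm_nonlinPair_sub_le hn hs hs' hk hB
    refine ⟨N, ?_, hL⟩
    rintro U u ⟨φ, hφ, hφ1, hφ2⟩
    -- The images of the approximating test pairs tend to N U and converge uniformly to some pair w.
    -- Pointwise, the first components are identically 0, and the second are identified by the
    -- continuity of `nonlinExt` in y.
    obtain ⟨w, hw1, hw2⟩ := WaveMap.exists_tendstoUniformly_fst_snd h3 hs2 hk2 (hN U φ hφ)
    refine ⟨w, ⟨_, hN U φ hφ, hw1, hw2⟩, funext fun x => ?_, fun ξ hξ => ?_⟩
    · exact tendsto_nhds_unique (hw1.tendsto_at x) tendsto_const_nhds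
    · rw [WaveMap.nonlin_eq_nonlinExt hn hξ]
      exact tendsto_nhds_unique (hw2.tendsto_at ξ)
        (((WaveMap.continuous_nonlinExt n _).tendsto _).comp (hφ1.tendsto_at ξ))
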